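/- **Setting.** A lattice is a finite simple graph $G=(L,E)$ with graph distance $\mathrm{dist}$ (sites in different components are at infinite distance). Site $j$ carries the Hilbert space $\mathbb{C}^{d_j}$, and $\mathcal H=\bigotimes_{j\in L}\mathbb{C}^{d_j}$. A Hamiltonian on $\mathcal H$ is called local with range $r\in\mathbb{N}$ and strength $J$ if $H=\sum_{X\subseteq L}H_X$, where each $H_X$ is self-adjoint, acts non-trivially only on the sites of $X$, satisfies $\|H_X\|\le J$ (operator norm), and is zero unless $\mathrm{dist}(i,j)\le r$ for all $i,j\in X$. A product state vector is $|\psi\rangle=\bigotimes_{j\in L}|\varphi_j\rangle$ with unit vectors $|\varphi_j\rangle$. Put $\rho(t)=e^{-\mathrm{i}tH}|\psi\rangle\langle\psi|e^{\mathrm{i}tH}$, let $\rho_I(t)=\mathrm{tr}_{L\setminus I}\,\rho(t)$ for $I\subseteq L$, let $S(\rho)=-\mathrm{tr}[\rho\log_2\rho]$, and let $s(I)$ be the number of sites of $I$ that have a neighbour in $L\setminus I$. **Theorem (Area laws in non-equilibrium systems).** 1. For all $\Delta,q,r\in\mathbb{N}$, $J\in\mathbb{R}$ and every time $t>0$ there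 are constants $c_0,c_1>0$, depending only on $\Delta,q,r,J,t$, such that for every lattice in which each site has at most $\Delta$ neighbours, all local dimensions $d_j\le q$, every local Hamiltonian $H$ with range $r$ and strength $J$, every product state vector $|\psi\rangle$ and every $I\subseteq L$, $$S(\rho_I(t))\le c_0\,s(I)+c_1 .$$ 2. In particular, for all $\mathcal D,q,r\in\mathbb{N}$, $J\in\mathbb{R}$ and $t>0$ there are $c_0,c_1>0$ such that the same bound holds on the cubic lattices $(\mathbb{Z}/n\mathbb{Z})^{\mathcal D}$ with periodic boundary conditions for every $n\ge1$, with local dimensions at most $q$, for every local Hamiltonian with range $r$ and strength $J$, every product state vector and every region $I$. 3. Conversely, there are a local dimension $q$, a strength $J$ and, for every $N$, a product state vector $|\psi_N\rangle\in(\mathbb{C}^q)^{\otimes N}$ and a nearest-neighbour (range $1$) Hamiltonian $H_N$ with strength $J$ on the open chain $\{1,\dots,N\}$, as well as constants $c_2,c_3,c_4,t_0>0$ and positive integers $L_0,s_0$, such that for all $N\ge L_0$, all $s$ with $s_0\le s\le N$, the block $I=\{1,\dots,s\}$, and all $t$ with $t_0\le t\le c_4\min(s,N-s)$, $$S(\rho_I(t))\ge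 c_2\,t+c_3 .$$ -/

import Mathlib

namespace SpinLattice

section Quantum

variable {L : Type} [Fintype L] [DecidableEq L] {d : L → ℕ}

/-- Labels of the standard product basis of the Hilbert space `⨂ j, ℂ^(d j)`. Vectors of that
space are functions `Config d → ℂ`, operators are matrices indexed by `Config d`. -/
abbrev Config (d : L → ℕ) : Type := ∀ j, Fin (d j)

/-- Basis labels of the subsystem `I`. -/
abbrev ConfigIn (d : L → ℕ) (I : Finset L) : Type := ∀ j : {j : L // j ∈ I}, Fin (d j)

/-- Basis labels of the complement of `I`. -/
abbrev ConfigOut (d : L → ℕ) (I : Finset L) : Type := ∀ j : {j : L // j ∉ I}, Fin (d j)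

/-- The splitting of the whole system into the region `I` and its complement. -/
def split (d : L → ℕ) (I : Finset L) : Config d ≃ ConfigIn d I × ConfigOut d I :=
  Equiv.piEquivPiSubtypeProd (fun j => j ∈ I) (fun j => Fin (d j))

/-- `A` acts only on the sites in `X`: `A = B ⊗ 1` for an operator `B` on the subsystem `X`. -/
def SupportedOn (X : Finset L) (A : Matrix (Config d) (Config d) ℂ) : Prop :=
  ∃ B : Matrix (ConfigIn d X) (ConfigIn d X) ℂ,
    A = (Matrix.kronecker B (1 : Matrix (ConfigOut d X) (ConfigOut d X) ℂ)).submatrix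
      (split d X) (split d X)

/-- `H = ∑ X, h X` with self-adjoint terms `h X` that act on the sites of `X` only, vanish unless
`X` has diameter at most `r` in the graph `G`, and have operator norm at most `J`.
The extended distance is used, so that sites in different components are infinitely far apart. -/
def IsLocalHamiltonian (G : SimpleGraph L) (r : ℕ) (J : ℝ)
    (H : Matrix (Config d) (Config d) ℂ) : Prop :=
  ∃ h : Finset L → Matrix (Config d) (Config d) ℂ,
    (∀ X, (h X).IsHermitian) ∧
    (∀ X, SupportedOn X (h X)) ∧
    (∀ X, h X ≠ 0 → ∀ i ∈ X, ∀ j ∈ X, G.edist i j ≤ (r : ℕ∞)) ∧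
    (∀ X, ‖Matrix.toEuclideanCLM (n := Config d) (𝕜 := ℂ) (h X)‖ ≤ J) ∧
    H = ∑ X, h X

/-- A product vector `⨂ j, φ j` of unit vectors. -/
def IsProductState (ψ : Config d → ℂ) : Prop :=
  ∃ φ : ∀ j, Fin (d j) → ℂ, (∀ j, ∑ a, ‖φ j a‖ ^ 2 = 1) ∧ ∀ σ, ψ σ = ∏ j, φ j (σ j)

/-- `ψ(t) = exp(-i t H) ψ`. -/
noncomputable def evolve (H : Matrix (Config d) (Config d) ℂ) (t : ℝ) (ψ : Config d → ℂ) :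
    Config d → ℂ :=
  (NormedSpace.exp ((-(Complex.I * (t : ℂ))) • H)).mulVec ψ

/-- The density operator `|ψ⟩⟨ψ|`. -/
def pureState (ψ : Config d → ℂ) : Matrix (Config d) (Config d) ℂ :=
  Matrix.vecMulVec ψ (star ψ)

/-- The reduction `ρ_I` of `ρ` to the region `I`: the partial trace over the complement. -/
def reducedState (I : Finset L) (ρ : Matrix (Config d) (Config d) ℂ) :
    Matrix (ConfigIn d I) (ConfigIn d I) ℂ :=
  fun a b => ∑ o : ConfigOut d I, ρ ((split d I).symm (a, o)) ((split d I).symm (b, o))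

/-- `S(ρ) = -tr (ρ log₂ ρ)`, computed from the eigenvalues of `ρ`. -/
noncomputable def vonNeumannEntropy {n : Type} [Fintype n] [DecidableEq n] {ρ : Matrix n n ℂ}
    (hρ : ρ.IsHermitian) : ℝ :=
  -∑ k, hρ.eigenvalues k * Real.logb 2 (hρ.eigenvalues k)

theorem reducedState_pureState_isHermitian (I : Finset L) (ψ : Config d → ℂ) :
    (reducedState I (pureState ψ)).IsHermitian := by
  refine Matrix.IsHermitian.ext fun a b => ?_
  simp only [reducedState, pureState, Matrix.vecMulVec_apply, Pi.star_apply]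
  rw [star_sum]
  refine Finset.sum_congr rfl fun o _ => ?_
  rw [star_mul, star_star]

/-- The entropy `S(ρ_I)` of the reduction to `I` of the pure state `ψ`. -/
noncomputable def entanglementEntropy (I : Finset L) (ψ : Config d → ℂ) : ℝ :=
  vonNeumannEntropy (reducedState_pureState_isHermitian I ψ)

end Quantum

/-- The number of sites of `I` that have a neighbour outside `I`. -/
noncomputable def boundaryArea {L : Type} (G : SimpleGraph L) (I : Finset L) : ℕ :=
  {i : L | i ∈ I ∧ ∃ j, j ∉ I ∧ G.Adj i j}.ncard

/-- The cubic lattice `(ℤ/n)^D` with periodic boundary conditions: two distinct sites are adjacent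
when they differ by `±1` in one coordinate and agree in all others. -/
def cubicLattice (D n : ℕ) : SimpleGraph (Fin D → ZMod n) where
  Adj x y := x ≠ y ∧ ∃ k, (y k = x k + 1 ∨ x k = y k + 1) ∧ ∀ l, l ≠ k → x l = y l
  symm := ⟨by
    rintro x y ⟨hne, k, hk, hl⟩
    exact ⟨hne.symm, k, hk.symm, fun l h => (hl l h).symm⟩⟩
  loopless := ⟨fun _ h => h.1 rfl⟩

/-- The block of the first `s` sites of the open chain with `N` sites. -/
def block (N s : ℕ) : Finset (Fin N) := Finset.univ.filter (fun j => j.val < s)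

end SpinLattice

/-!
Upper bound. Write the evolved vector as a matrix whose rows are labelled by `I` and whose columns
by its complement. Its entropy is at most `2 log₂` of its trace norm, and the trace norm is the
largest overlap with vectors whose matrix is a contraction. Let the evolution act backwards on such
a vector instead. The terms of the Hamiltonian on one side of the cut multiply the matrix by
unitaries, and so drop out in the interaction picture; each of the `O(|∂I|)` terms across the cut
changes the norm at a bounded rate. By Gronwall's inequality the norm stays below `exp (c |∂I| t)`,
and the overlap of a product vector with any vector is at most the norm of the matrix of the latter.

Lower bound. By the Jordan–Wigner transformation, the nearest-neighbour XX chain is free fermion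
hopping, and it takes the Néel state to a Slater determinant with one-particle projection `P`. The
square of the largest Schmidt coefficient of a Slater determinant is at most `∏ max (ν, 1 - ν)`,
the `ν` being the eigenvalues of the part of the projection inside the block, hence the entropy is
at least `∑ ν (1 - ν)`, the sum of `|P x z|²` over the pairs `(x, z)` separated by the cut. On the
Néel state this is a quarter of the weight that the one-particle propagator carries across the cut
in time `2 t`. By the method of images it is compared with the propagator of a cycle, where a
particle spreads at a positive speed; so the weight grows linearly in `t`.
-/

namespace SpinLattice

open Matrix
open scoped Matrix.Norms.L2Operator

section OperatorNorm

variable {m n : Type*} [Fintype n]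

lemma norm_mulVec_apply_sq_le (A : Matrix m n ℂ) (v : n → ℂ) (i : m) :
    ‖(A *ᵥ v) i‖ ^ 2 ≤ (∑ j, ‖A i j‖) * ∑ j, ‖A i j‖ * ‖v j‖ ^ 2 := by
  calc ‖(A *ᵥ v) i‖ ^ 2
      ≤ (∑ j, √‖A i j‖ * (√‖A i j‖ * ‖v j‖)) ^ 2 := by
        gcongr
        refine (norm_sum_le _ _).trans_eq (Finset.sum_congr rfl fun j _ => ?_)
        rw [norm_mul, ← mul_assoc, Real.mul_self_sqrt (norm_nonneg _)]
    _ ≤ (∑ j, √‖A i j‖ ^ 2) * ∑ j, (√‖A i j‖ * ‖v j‖) ^ 2 :=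
        Finset.sum_mul_sq_le_sq_mul_sq _ _ _
    _ = (∑ j, ‖A i j‖) * ∑ j, ‖A i j‖ * ‖v j‖ ^ 2 := by
        simp only [mul_pow, Real.sq_sqrt (norm_nonneg _)]

lemma sum_norm_le_one_of_ne_zero_unique {f : n → ℂ} (hf : ∀ j, ‖f j‖ ≤ 1)
    (hunique : ∀ i j, f i ≠ 0 → f j ≠ 0 → i = j) : ∑ j, ‖f j‖ ≤ 1 := by
  by_cases h : ∃ j, f j ≠ 0
  · obtain ⟨j, hj⟩ := h
    rw [Finset.sum_eq_single j (fun i _ hij => ?_) (by simp)]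
    · exact hf j
    · by_contra hi
      exact hij (hunique i j (norm_ne_zero_iff.1 hi) hj)
  · push Not at h
    simp [h]

variable [Fintype m] [DecidableEq n]

lemma sum_norm_sq_mulVec_le (A : Matrix m n ℂ) (v : n → ℂ) :
    ∑ i, ‖(A *ᵥ v) i‖ ^ 2 ≤ ‖A‖ ^ 2 * ∑ j, ‖v j‖ ^ 2 := by
  have h := pow_le_pow_left₀ (norm_nonneg _) (A.l2_opNorm_mulVec (WithLp.toLp 2 v)) 2
  rwa [mul_pow, EuclideanSpace.norm_sq_eq, EuclideanSpace.norm_sq_eq] at h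

lemma opNorm_le_of_sum_norm_sq_mulVec_le (A : Matrix m n ℂ) {c : ℝ} (hc : 0 ≤ c)
    (h : ∀ v : n → ℂ, ∑ i, ‖(A *ᵥ v) i‖ ^ 2 ≤ c ^ 2 * ∑ j, ‖v j‖ ^ 2) : ‖A‖ ≤ c := by
  rw [l2_opNorm_def]
  refine ContinuousLinearMap.opNorm_le_bound _ hc fun v => le_of_sq_le_sq ?_ (by positivity)
  rw [mul_pow, EuclideanSpace.norm_sq_eq, EuclideanSpace.norm_sq_eq]
  exact h v.ofLp

lemma sum_norm_sq_single_one {κ : Type*} [Fintype κ] [DecidableEq κ] (k : κ) :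
    ∑ a, ‖(Pi.single k 1 : κ → ℂ) a‖ ^ 2 = 1 := by
  rw [Finset.sum_eq_single k] <;> simp +contextual

lemma norm_apply_le_opNorm (A : Matrix m n ℂ) (i : m) (j : n) : ‖A i j‖ ≤ ‖A‖ := by
  have h := sum_norm_sq_mulVec_le A (Pi.single j 1)
  rw [sum_norm_sq_single_one, mul_one] at h
  simp only [mulVec_single_one, col_apply] at h
  refine le_of_sq_le_sq (le_trans ?_ h) (norm_nonneg _)
  exact Finset.single_le_sum (f := fun i => ‖A i j‖ ^ 2) (fun i _ => by positivity)
    (Finset.mem_univ i)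

lemma opNorm_le_of_sum_norm_row_le_of_sum_norm_col_le (A : Matrix m n ℂ) {c : ℝ} (hc : 0 ≤ c)
    (hrow : ∀ i, ∑ j, ‖A i j‖ ≤ c) (hcol : ∀ j, ∑ i, ‖A i j‖ ≤ c) : ‖A‖ ≤ c := by
  refine opNorm_le_of_sum_norm_sq_mulVec_le A hc fun v => ?_
  calc ∑ i, ‖(A *ᵥ v) i‖ ^ 2
      ≤ ∑ i, c * ∑ j, ‖A i j‖ * ‖v j‖ ^ 2 := by
        gcongr with i
        exact (norm_mulVec_apply_sq_le A v i).trans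
          (mul_le_mul_of_nonneg_right (hrow i) (by positivity))
    _ = c * ∑ j, (∑ i, ‖A i j‖) * ‖v j‖ ^ 2 := by
        rw [← Finset.mul_sum, Finset.sum_comm]
        simp only [Finset.sum_mul]
    _ ≤ c * ∑ j, c * ‖v j‖ ^ 2 := by
        gcongr with j
        exact hcol j
    _ = c ^ 2 * ∑ j, ‖v j‖ ^ 2 := by rw [← Finset.mul_sum, ← mul_assoc, sq]

lemma opNorm_le_one_of_ne_zero_unique (A : Matrix m n ℂ) (hA : ∀ i j, ‖A i j‖ ≤ 1)
    (hrow : ∀ i j j', A i j ≠ 0 → A i j' ≠ 0 → j = j')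
    (hcol : ∀ i i' j, A i j ≠ 0 → A i' j ≠ 0 → i = i') : ‖A‖ ≤ 1 :=
  opNorm_le_of_sum_norm_row_le_of_sum_norm_col_le A zero_le_one
    (fun i => sum_norm_le_one_of_ne_zero_unique (hA i) (hrow i))
    (fun j => sum_norm_le_one_of_ne_zero_unique (fun i => hA i j) (fun i i' => hcol i i' j))

lemma opNorm_unitary_mul [DecidableEq m] {U : Matrix m m ℂ} (hU : U ∈ unitaryGroup m ℂ)
    (A : Matrix m n ℂ) : ‖U * A‖ = ‖A‖ := by
  have hUA : (U * A)ᴴ * (U * A) = Aᴴ * A := by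
    rw [conjTranspose_mul, Matrix.mul_assoc, ← Matrix.mul_assoc Uᴴ, ← star_eq_conjTranspose U,
      mem_unitaryGroup_iff'.1 hU, Matrix.one_mul]
  have h := l2_opNorm_conjTranspose_mul_self (U * A)
  rw [hUA, l2_opNorm_conjTranspose_mul_self] at h
  exact (mul_self_inj (norm_nonneg _) (norm_nonneg _)).1 h.symm

lemma opNorm_mul_unitary (A : Matrix m n ℂ) {U : Matrix n n ℂ} (hU : U ∈ unitaryGroup n ℂ) :
    ‖A * U‖ = ‖A‖ := by
  classical
  rw [← l2_opNorm_conjTranspose, conjTranspose_mul, ← star_eq_conjTranspose U,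
    opNorm_unitary_mul (Unitary.star_mem hU), l2_opNorm_conjTranspose]

omit [DecidableEq n] in
lemma star_dotProduct_self (v : n → ℂ) : star v ⬝ᵥ v = (∑ i, ‖v i‖ ^ 2 : ℝ) := by
  simp [dotProduct, Complex.conj_mul']

lemma sum_norm_sq_unitary_mulVec {U : Matrix n n ℂ} (hU : U ∈ unitaryGroup n ℂ) (v : n → ℂ) :
    ∑ i, ‖(U *ᵥ v) i‖ ^ 2 = ∑ i, ‖v i‖ ^ 2 := by
  have : ((∑ i, ‖(U *ᵥ v) i‖ ^ 2 : ℝ) : ℂ) = (∑ i, ‖v i‖ ^ 2 : ℝ) := by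
    rw [← star_dotProduct_self, ← star_dotProduct_self, star_mulVec, dotProduct_mulVec,
      vecMul_vecMul, ← star_eq_conjTranspose, mem_unitaryGroup_iff'.1 hU, vecMul_one]
  exact_mod_cast this

end OperatorNorm

section UnitaryEvolution

variable {n : Type*} [Fintype n] [DecidableEq n]

/-- The time evolution operator `exp(-i t H)`. -/
noncomputable def unitaryEvolution (H : Matrix n n ℂ) (t : ℝ) : Matrix n n ℂ :=
  NormedSpace.exp ((-(Complex.I * (t : ℂ))) • H)

@[simp]
lemma unitaryEvolution_zero (H : Matrix n n ℂ) : unitaryEvolution H 0 = 1 := by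
  simp [unitaryEvolution]

lemma unitaryEvolution_neg (H : Matrix n n ℂ) (t : ℝ) :
    unitaryEvolution (-H) t = unitaryEvolution H (-t) := by
  simp [unitaryEvolution]

lemma commute_unitaryEvolution (H : Matrix n n ℂ) (t : ℝ) : Commute H (unitaryEvolution H t) :=
  ((Commute.refl H).smul_right _).exp_right

lemma unitaryEvolution_add (H : Matrix n n ℂ) (s t : ℝ) :
    unitaryEvolution H (s + t) = unitaryEvolution H s * unitaryEvolution H t := by
  have h_comm : Commute ((-(Complex.I * (s : ℂ))) • H) ((-(Complex.I * (t : ℂ))) • H) :=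
    ((Commute.refl H).smul_left _).smul_right _
  rw [unitaryEvolution, unitaryEvolution, unitaryEvolution,
    ← Matrix.exp_add_of_commute _ _ h_comm, ← add_smul, Complex.ofReal_add, mul_add, neg_add]

lemma unitaryEvolution_mul_neg (H : Matrix n n ℂ) (t : ℝ) :
    unitaryEvolution H t * unitaryEvolution H (-t) = 1 := by
  rw [← unitaryEvolution_add, add_neg_cancel, unitaryEvolution_zero]

lemma unitaryEvolution_neg_mul (H : Matrix n n ℂ) (t : ℝ) :
    unitaryEvolution H (-t) * unitaryEvolution H t = 1 := by
  simpa using unitaryEvolution_mul_neg H (-t)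

lemma conjTranspose_unitaryEvolution {H : Matrix n n ℂ} (hH : H.IsHermitian) (t : ℝ) :
    (unitaryEvolution H t)ᴴ = unitaryEvolution H (-t) := by
  rw [unitaryEvolution, ← Matrix.exp_conjTranspose, conjTranspose_smul, hH.eq, unitaryEvolution]
  simp

lemma unitaryEvolution_mem_unitaryGroup {H : Matrix n n ℂ} (hH : H.IsHermitian) (t : ℝ) :
    unitaryEvolution H t ∈ unitaryGroup n ℂ := by
  rw [mem_unitaryGroup_iff, star_eq_conjTranspose, conjTranspose_unitaryEvolution hH,
    unitaryEvolution_mul_neg]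

lemma hasDerivAt_unitaryEvolution (H : Matrix n n ℂ) (t : ℝ) :
    HasDerivAt (unitaryEvolution H) (-(Complex.I • (H * unitaryEvolution H t))) t := by
  have h := (hasDerivAt_exp_smul_const' (𝕂 := ℂ) (-(Complex.I • H)) (t : ℂ)).scomp t
    Complex.ofRealCLM.hasDerivAt
  simp only [Complex.ofRealCLM_apply, Complex.ofReal_one, one_smul, neg_mul, smul_mul_assoc] at h
  have h_exp (s : ℝ) : NormedSpace.exp ((s : ℂ) • -(Complex.I • H)) = unitaryEvolution H s := by
    rw [unitaryEvolution, smul_neg, smul_smul, neg_smul, mul_comm]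
  simp only [Function.comp_def, h_exp] at h
  exact h

end UnitaryEvolution

section InteractionPicture

lemma hasDerivAt_matrix_iff {m n : Type*} [Finite m] [Finite n] {A : ℝ → Matrix m n ℂ}
    {A' : Matrix m n ℂ} {t : ℝ} :
    HasDerivAt A A' t ↔ ∀ i j, HasDerivAt (fun s => A s i j) (A' i j) t := by
  have := Fintype.ofFinite m
  have := Fintype.ofFinite n
  exact hasDerivAt_pi.trans (forall_congr' fun _ => hasDerivAt_pi)

lemma hasDerivAt_matrix_mul {l m n : Type*} [Finite l] [Fintype m] [Finite n]
    {A : ℝ → Matrix l m ℂ} {B : ℝ → Matrix m n ℂ} {A' : Matrix l m ℂ} {B' : Matrix m n ℂ} {t : ℝ}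
    (hA : HasDerivAt A A' t) (hB : HasDerivAt B B' t) :
    HasDerivAt (fun s => A s * B s) (A' * B t + A t * B') t := by
  rw [hasDerivAt_matrix_iff] at hA hB ⊢
  intro i j
  simp only [Matrix.add_apply, mul_apply, ← Finset.sum_add_distrib]
  exact HasDerivAt.fun_sum fun k _ => (hA i k).fun_mul (hB k j)

variable {m n : Type*} [Fintype m] [Fintype n] [DecidableEq m] [DecidableEq n]

lemma hasDerivAt_unitaryEvolution_mulVec (H : Matrix n n ℂ) (v : n → ℂ) (t : ℝ) :
    HasDerivAt (fun s => unitaryEvolution H s *ᵥ v)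
      (-(Complex.I • (H *ᵥ (unitaryEvolution H t *ᵥ v)))) t := by
  have h_entry := hasDerivAt_matrix_iff.1 (hasDerivAt_unitaryEvolution H t)
  refine hasDerivAt_pi.2 fun i =>
    (HasDerivAt.fun_sum fun j _ => (h_entry i j).mul_const (v j)).congr_deriv ?_
  rw [mulVec_mulVec, ← smul_mulVec, ← neg_mulVec]
  rfl

lemma hasDerivAt_unitaryEvolution_neg (H : Matrix n n ℂ) (t : ℝ) :
    HasDerivAt (fun s => unitaryEvolution H (-s))
      (Complex.I • (unitaryEvolution H (-t) * H)) t := by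
  have h := hasDerivAt_unitaryEvolution (-H) t
  simp only [unitaryEvolution_neg, neg_mul, smul_neg, neg_neg,
    (commute_unitaryEvolution H (-t)).eq] at h
  exact (funext fun s => unitaryEvolution_neg H s) ▸ h

/-- If the generator of `F` splits into `K` acting from the left, `K'` acting from the right and a
remainder `R`, then in the interaction picture only the remainder drives the motion. -/
lemma hasDerivAt_interactionPicture {K : Matrix m m ℂ} {K' : Matrix n n ℂ}
    {F R : ℝ → Matrix m n ℂ} {t : ℝ}
    (hF : HasDerivAt F (-(Complex.I • (K * F t + F t * K' + R t))) t) :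
    HasDerivAt (fun s => unitaryEvolution K (-s) * F s * unitaryEvolution K' (-s))
      (-(Complex.I • (unitaryEvolution K (-t) * R t * unitaryEvolution K' (-t)))) t := by
  refine (hasDerivAt_matrix_mul (hasDerivAt_matrix_mul (hasDerivAt_unitaryEvolution_neg K t) hF)
    (hasDerivAt_unitaryEvolution_neg K' t)).congr_deriv ?_
  rw [← (commute_unitaryEvolution K' (-t)).eq]
  simp only [Matrix.mul_add, Matrix.add_mul, Matrix.neg_mul, Matrix.mul_neg, Matrix.smul_mul,
    Matrix.mul_smul, smul_add, Matrix.mul_assoc]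
  abel

lemma eq_unitaryEvolution_mul_mul_of_hasDerivAt {K : Matrix m m ℂ} {K' : Matrix n n ℂ}
    {F : ℝ → Matrix m n ℂ}
    (hF : ∀ s, HasDerivAt F (-(Complex.I • (K * F s + F s * K'))) s) (t : ℝ) :
    F t = unitaryEvolution K t * F 0 * unitaryEvolution K' t := by
  have hG (s : ℝ) :
      HasDerivAt (fun s => unitaryEvolution K (-s) * F s * unitaryEvolution K' (-s)) 0 s :=
    (hasDerivAt_interactionPicture (R := 0) (by simpa using hF s)).congr_deriv (by simp)
  have h_const := is_const_of_deriv_eq_zero (fun s => (hG s).differentiableAt)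
    (fun s => (hG s).deriv) t 0
  simp only [neg_zero, unitaryEvolution_zero, Matrix.one_mul, Matrix.mul_one] at h_const
  rw [← h_const]
  calc F t = (unitaryEvolution K t * unitaryEvolution K (-t)) * F t *
        (unitaryEvolution K' (-t) * unitaryEvolution K' t) := by
        rw [unitaryEvolution_mul_neg, unitaryEvolution_neg_mul, Matrix.one_mul, Matrix.mul_one]
    _ = _ := by simp only [Matrix.mul_assoc]

lemma unitaryEvolution_mul_eq_of_intertwining {K : Matrix m m ℂ} {K' : Matrix n n ℂ}
    {V : Matrix m n ℂ} (hV : K * V = V * K') (t : ℝ) :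
    unitaryEvolution K t * V = V * unitaryEvolution K' t := by
  have h := eq_unitaryEvolution_mul_mul_of_hasDerivAt (K := K) (K' := -K') (F := fun _ => V)
    (fun s => by simpa [hV] using hasDerivAt_const s V) t
  rw [unitaryEvolution_neg] at h
  calc unitaryEvolution K t * V
      = unitaryEvolution K t * V * (unitaryEvolution K' (-t) * unitaryEvolution K' t) := by
        rw [unitaryEvolution_neg_mul, Matrix.mul_one]
    _ = V * unitaryEvolution K' t := by rw [← Matrix.mul_assoc, ← h]

omit [Fintype m] [DecidableEq m] in
lemma unitaryEvolution_mulVec_of_mulVec_eq_smul {H : Matrix n n ℂ} {v : n → ℂ} {μ : ℂ}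
    (hv : H *ᵥ v = μ • v) (t : ℝ) :
    unitaryEvolution H t *ᵥ v = Complex.exp (-(Complex.I * t) * μ) • v := by
  have h_col : H * replicateCol Unit v = replicateCol Unit v * (μ • (1 : Matrix Unit Unit ℂ)) := by
    rw [← replicateCol_mulVec, hv, Matrix.mul_smul, Matrix.mul_one, replicateCol_smul]
  have h_scalar : unitaryEvolution (μ • (1 : Matrix Unit Unit ℂ)) t =
      Complex.exp (-(Complex.I * t) * μ) • 1 := by
    rw [unitaryEvolution, smul_smul, ← Algebra.algebraMap_eq_smul_one,
      ← Algebra.algebraMap_eq_smul_one, Complex.exp_eq_exp_ℂ, NormedSpace.algebraMap_exp_comm]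
  refine replicateCol_injective (ι := Unit) ?_
  rw [replicateCol_mulVec, unitaryEvolution_mul_eq_of_intertwining h_col, h_scalar,
    Matrix.mul_smul, Matrix.mul_one, replicateCol_smul]

omit [DecidableEq m] in
lemma norm_le_exp_mul_norm_zero_of_hasDerivAt_of_nonneg {K : Matrix m m ℂ} {K' : Matrix n n ℂ}
    (hK : K.IsHermitian) (hK' : K'.IsHermitian) {F R : ℝ → Matrix m n ℂ}
    (hF : ∀ s, HasDerivAt F (-(Complex.I • (K * F s + F s * K' + R s))) s) {c : ℝ}
    (hR : ∀ s, ‖R s‖ ≤ c * ‖F s‖) {t : ℝ} (ht : 0 ≤ t) :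
    ‖F t‖ ≤ Real.exp (c * t) * ‖F 0‖ := by
  classical
  set G := fun s => unitaryEvolution K (-s) * F s * unitaryEvolution K' (-s)
  have h_sandwich (A : Matrix m n ℂ) (s : ℝ) :
      ‖unitaryEvolution K (-s) * A * unitaryEvolution K' (-s)‖ = ‖A‖ := by
    rw [opNorm_mul_unitary _ (unitaryEvolution_mem_unitaryGroup hK' _),
      opNorm_unitary_mul (unitaryEvolution_mem_unitaryGroup hK _)]
  have hG (s : ℝ) := hasDerivAt_interactionPicture (hF s)
  have h_gronwall := norm_le_gronwallBound_of_norm_deriv_right_le (f := G) (a := 0) (b := t)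
    (K := c) (ε := 0) (δ := ‖F 0‖)
    (fun s _ => (hG s).continuousAt.continuousWithinAt) (fun s _ => (hG s).hasDerivWithinAt)
    (h_sandwich (F 0) 0).le
    (fun s _ => by simpa [norm_smul, G, h_sandwich] using hR s) t ⟨ht, le_rfl⟩
  rwa [h_sandwich, gronwallBound_ε0, sub_zero, mul_comm] at h_gronwall

omit [DecidableEq m] in
lemma norm_le_exp_mul_abs_mul_norm_zero_of_hasDerivAt {K : Matrix m m ℂ} {K' : Matrix n n ℂ}
    (hK : K.IsHermitian) (hK' : K'.IsHermitian) {F R : ℝ → Matrix m n ℂ}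
    (hF : ∀ s, HasDerivAt F (-(Complex.I • (K * F s + F s * K' + R s))) s) {c : ℝ}
    (hR : ∀ s, ‖R s‖ ≤ c * ‖F s‖) (t : ℝ) :
    ‖F t‖ ≤ Real.exp (c * |t|) * ‖F 0‖ := by
  rcases le_total 0 t with ht | ht
  · rw [abs_of_nonneg ht]
    exact norm_le_exp_mul_norm_zero_of_hasDerivAt_of_nonneg hK hK' hF hR ht
  · have hF_neg (s : ℝ) : HasDerivAt (fun s => F (-s))
        (-(Complex.I • (-K * F (-s) + F (-s) * -K' + -R (-s)))) s :=
      ((hF (-s)).scomp s (hasDerivAt_neg s)).congr_deriv (by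
        simp only [Matrix.neg_mul, Matrix.mul_neg, smul_add, smul_neg, neg_smul, one_smul])
    have h := norm_le_exp_mul_norm_zero_of_hasDerivAt_of_nonneg hK.neg hK'.neg hF_neg
      (fun s => (norm_neg _).trans_le (hR (-s))) (neg_nonneg.2 ht)
    simpa [abs_of_nonpos ht] using h

end InteractionPicture

section ShannonEntropy

variable {ι : Type*} [Fintype ι]

lemma neg_log_le_sum_negMulLog {p : ι → ℝ} (hp : ∀ k, 0 ≤ p k) (hsum : ∑ k, p k = 1) {b : ℝ}
    (hb : ∀ k, p k ≤ b) : -Real.log b ≤ ∑ k, Real.negMulLog (p k) := by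
  calc -Real.log b = ∑ k, p k * -Real.log b := by rw [← Finset.sum_mul, hsum, one_mul]
    _ ≤ ∑ k, Real.negMulLog (p k) := by
      refine Finset.sum_le_sum fun k _ => ?_
      rcases (hp k).eq_or_lt with h | h
      · simp [← h]
      · rw [Real.negMulLog, neg_mul_comm]
        gcongr
        exact hb k

lemma sum_sqrt_pos_of_sum_eq_one {p : ι → ℝ} (hsum : ∑ k, p k = 1) :
    0 < ∑ k, √(p k) := by
  obtain ⟨k, -, hk⟩ : ∃ k ∈ Finset.univ, 0 < p k :=
    Finset.exists_lt_of_sum_lt (f := fun _ => (0 : ℝ)) (by simp [hsum])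
  exact (Real.sqrt_pos.2 hk).trans_le
    (Finset.single_le_sum (f := fun k => √(p k)) (fun k _ => Real.sqrt_nonneg _)
      (Finset.mem_univ k))

-- This is `log y ≤ y - 1` at `y = 1 / (√x * z)`.
lemma negMulLog_le_two_mul {x z : ℝ} (hx : 0 ≤ x) (hz : 0 < z) :
    Real.negMulLog x ≤ 2 * (x * Real.log z + (√x / z - x)) := by
  rcases hx.eq_or_lt with rfl | hx
  · simp
  have h_log := Real.log_le_sub_one_of_pos (x := (√x * z)⁻¹) (by positivity)
  rw [Real.log_inv, Real.log_mul (by positivity) hz.ne', Real.log_sqrt hx.le] at h_log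
  have h_scaled := mul_le_mul_of_nonneg_left h_log hx.le
  have h_sqrt : x * (√x * z)⁻¹ = √x / z := by
    rw [mul_inv, ← mul_assoc, ← div_eq_mul_inv x, Real.div_sqrt, div_eq_mul_inv]
  rw [mul_sub, h_sqrt] at h_scaled
  rw [Real.negMulLog]
  linarith

lemma sum_negMulLog_le_two_mul_log_sum_sqrt {p : ι → ℝ} (hp : ∀ k, 0 ≤ p k)
    (hsum : ∑ k, p k = 1) :
    ∑ k, Real.negMulLog (p k) ≤ 2 * Real.log (∑ k, √(p k)) := by
  have hz := sum_sqrt_pos_of_sum_eq_one hsum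
  set z := ∑ k, √(p k)
  calc ∑ k, Real.negMulLog (p k)
      ≤ ∑ k, 2 * (p k * Real.log z + (√(p k) / z - p k)) :=
        Finset.sum_le_sum fun k _ => negMulLog_le_two_mul (hp k) hz
    _ = 2 * Real.log z := by
        rw [← Finset.mul_sum, Finset.sum_add_distrib, Finset.sum_sub_distrib, ← Finset.sum_mul,
          ← Finset.sum_div, hsum, div_self hz.ne']
        ring

end ShannonEntropy

section Eigenvalues

variable {m n : Type*} [Fintype m] [Fintype n] [DecidableEq n]

open ComplexOrder in
lemma eigenvalues_mul_conjTranspose_nonneg {M : Matrix n m ℂ} (hρ : (M * Mᴴ).IsHermitian)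
    (k : n) : 0 ≤ hρ.eigenvalues k :=
  (posSemidef_self_mul_conjTranspose M).eigenvalues_nonneg k

end Eigenvalues

section VonNeumannEntropy

variable {n : Type} [Fintype n] [DecidableEq n]

lemma vonNeumannEntropy_eq_sum_negMulLog_div {ρ : Matrix n n ℂ} (hρ : ρ.IsHermitian) :
    vonNeumannEntropy hρ = (∑ k, Real.negMulLog (hρ.eigenvalues k)) / Real.log 2 := by
  simp only [vonNeumannEntropy, Real.negMulLog, Real.logb, neg_mul, Finset.sum_neg_distrib,
    neg_div, Finset.sum_div, mul_div_assoc]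

lemma eigenvalue_le_opNorm {ρ : Matrix n n ℂ} (hρ : ρ.IsHermitian) (k : n) :
    hρ.eigenvalues k ≤ ‖ρ‖ := by
  have h_unit : ∑ i, ‖(hρ.eigenvectorBasis k).ofLp i‖ ^ 2 = 1 := by
    rw [← EuclideanSpace.norm_sq_eq, hρ.eigenvectorBasis.norm_eq_one, one_pow]
  have h := sum_norm_sq_mulVec_le ρ (hρ.eigenvectorBasis k)
  simp only [hρ.mulVec_eigenvectorBasis, Pi.smul_apply, norm_smul, mul_pow, ← Finset.mul_sum,
    h_unit, mul_one] at h
  exact (le_abs_self _).trans (le_of_sq_le_sq h (norm_nonneg _))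

lemma sum_eigenvalues_eq_one {ρ : Matrix n n ℂ} (hρ : ρ.IsHermitian) (htr : ρ.trace = 1) :
    ∑ k, hρ.eigenvalues k = 1 := by
  have h := hρ.trace_eq_sum_eigenvalues.symm.trans htr
  exact Complex.ofReal_injective (by simpa using h)

variable {m : Type} [Fintype m]

lemma neg_logb_norm_sq_le_vonNeumannEntropy [DecidableEq m] {M : Matrix n m ℂ}
    (hρ : (M * Mᴴ).IsHermitian) (htr : (M * Mᴴ).trace = 1) :
    -Real.logb 2 (‖M‖ ^ 2) ≤ vonNeumannEntropy hρ := by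
  rw [vonNeumannEntropy_eq_sum_negMulLog_div, Real.logb, ← neg_div]
  refine div_le_div_of_nonneg_right ?_ (Real.log_nonneg one_le_two)
  refine neg_log_le_sum_negMulLog (eigenvalues_mul_conjTranspose_nonneg hρ)
    (sum_eigenvalues_eq_one hρ htr) fun k => (eigenvalue_le_opNorm hρ k).trans ?_
  simpa only [l2_opNorm_conjTranspose, ← sq] using l2_opNorm_mul M Mᴴ

lemma vonNeumannEntropy_le_two_mul_logb_sum_sqrt {M : Matrix n m ℂ} (hρ : (M * Mᴴ).IsHermitian)
    (htr : (M * Mᴴ).trace = 1) :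
    vonNeumannEntropy hρ ≤ 2 * Real.logb 2 (∑ k, √(hρ.eigenvalues k)) := by
  rw [vonNeumannEntropy_eq_sum_negMulLog_div, Real.logb, ← mul_div_assoc]
  exact div_le_div_of_nonneg_right (sum_negMulLog_le_two_mul_log_sum_sqrt
    (eigenvalues_mul_conjTranspose_nonneg hρ) (sum_eigenvalues_eq_one hρ htr))
    (Real.log_nonneg one_le_two)

end VonNeumannEntropy

section TraceNormDuality

variable {m n : Type*} [Fintype m] [Fintype n] [DecidableEq n]

lemma exists_contraction_trace_eq_sum_sqrt_of_mul_conjTranspose_eq_diagonal {N : Matrix n m ℂ}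
    {l : n → ℝ} (hl : ∀ k, 0 ≤ l k) (hN : N * Nᴴ = diagonal fun k => (l k : ℂ)) :
    ∃ W : Matrix m n ℂ, ‖W‖ ≤ 1 ∧ (N * W).trace = ((∑ k, √(l k) : ℝ) : ℂ) := by
  set s : n → ℂ := fun k => ((√(l k))⁻¹ : ℝ) with hs
  have h_star : (diagonal s)ᴴ = diagonal s := by
    rw [diagonal_conjTranspose]
    exact congrArg diagonal (funext fun k => Complex.conj_ofReal _)
  have h_gram : (Nᴴ * diagonal s)ᴴ * (Nᴴ * diagonal s) = diagonal fun k => s k * l k * s k := by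
    rw [conjTranspose_mul, conjTranspose_conjTranspose, h_star, Matrix.mul_assoc,
      ← Matrix.mul_assoc N, hN, diagonal_mul_diagonal, diagonal_mul_diagonal]
    simp only [mul_assoc]
  refine ⟨Nᴴ * diagonal s, ?_, ?_⟩
  · have h_norm := l2_opNorm_conjTranspose_mul_self (Nᴴ * diagonal s)
    rw [h_gram, l2_opNorm_diagonal] at h_norm
    refine le_of_sq_le_sq ?_ zero_le_one
    rw [sq, ← h_norm, one_pow, pi_norm_le_iff_of_nonneg zero_le_one]
    intro k
    rcases (hl k).eq_or_lt with h | h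
    · simp [← h]
    · have h_one : (√(l k))⁻¹ * l k * (√(l k))⁻¹ = 1 := by
        rw [mul_right_comm, ← mul_inv, Real.mul_self_sqrt h.le, inv_mul_cancel₀ h.ne']
      simp only [hs]
      rw [← Complex.ofReal_mul, ← Complex.ofReal_mul, h_one]
      simp
  · rw [← Matrix.mul_assoc, hN, diagonal_mul_diagonal, trace_diagonal, Complex.ofReal_sum]
    refine Finset.sum_congr rfl fun k _ => ?_
    rw [hs, ← Complex.ofReal_mul, ← div_eq_mul_inv, Real.div_sqrt]

lemma exists_contraction_trace_eq_sum_sqrt_eigenvalues {M : Matrix n m ℂ}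
    (hρ : (M * Mᴴ).IsHermitian) :
    ∃ W : Matrix m n ℂ, ‖W‖ ≤ 1 ∧ (M * W).trace = ((∑ k, √(hρ.eigenvalues k) : ℝ) : ℂ) := by
  classical
  set U : Matrix n n ℂ := hρ.eigenvectorUnitary.1
  have hU : star U ∈ unitaryGroup n ℂ := Unitary.star_mem hρ.eigenvectorUnitary.2
  have h_diag : (star U * M) * (star U * M)ᴴ = diagonal fun k => (hρ.eigenvalues k : ℂ) := by
    rw [conjTranspose_mul, star_eq_conjTranspose, conjTranspose_conjTranspose, Matrix.mul_assoc,
      ← Matrix.mul_assoc M, ← Matrix.mul_assoc, ← star_eq_conjTranspose]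
    have h_spectral := hρ.conjStarAlgAut_star_eigenvectorUnitary
    rwa [Unitary.conjStarAlgAut_star_apply] at h_spectral
  obtain ⟨W, hW, h_trace⟩ := exists_contraction_trace_eq_sum_sqrt_of_mul_conjTranspose_eq_diagonal
    (eigenvalues_mul_conjTranspose_nonneg hρ) h_diag
  refine ⟨W * star U, (opNorm_mul_unitary W hU).trans_le hW, ?_⟩
  rw [← h_trace, ← Matrix.mul_assoc, trace_mul_comm, Matrix.mul_assoc]

end TraceNormDuality

section Reshape

variable {L : Type} [DecidableEq L] {d : L → ℕ}

/-- The coefficient matrix of a vector with respect to the bipartition into `I` (rows) and its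
complement (columns). Its singular values are the Schmidt coefficients of the vector. -/
def reshape (I : Finset L) : (Config d → ℂ) →ₗ[ℂ] Matrix (ConfigIn d I) (ConfigOut d I) ℂ where
  toFun ψ := of fun a o => ψ ((split d I).symm (a, o))
  map_add' _ _ := rfl
  map_smul' _ _ := rfl

lemma reshape_apply (I : Finset L) (ψ : Config d → ℂ) (a : ConfigIn d I) (o : ConfigOut d I) :
    reshape I ψ a o = ψ ((split d I).symm (a, o)) := rfl

lemma exists_reshape_eq (I : Finset L) (M : Matrix (ConfigIn d I) (ConfigOut d I) ℂ) :
    ∃ ψ : Config d → ℂ, reshape I ψ = M :=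
  ⟨fun σ => M (split d I σ).1 (split d I σ).2, by ext a o; simp [reshape_apply]⟩

variable [Fintype L]

lemma reducedState_pureState (I : Finset L) (ψ : Config d → ℂ) :
    reducedState I (pureState ψ) = reshape I ψ * (reshape I ψ)ᴴ := by
  ext a b
  simp [reducedState, pureState, vecMulVec_apply, mul_apply, reshape_apply]

lemma sum_config_eq_sum_split {M : Type*} [AddCommMonoid M] (I : Finset L) (f : Config d → M) :
    ∑ σ, f σ = ∑ a : ConfigIn d I, ∑ o : ConfigOut d I, f ((split d I).symm (a, o)) := by
  rw [← Fintype.sum_prod_type', ← (split d I).symm.sum_comp]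

lemma trace_reshape_mul_conjTranspose_reshape (I : Finset L) (ψ φ : Config d → ℂ) :
    (reshape I ψ * (reshape I φ)ᴴ).trace = star φ ⬝ᵥ ψ := by
  rw [dotProduct, sum_config_eq_sum_split I, trace]
  simp [mul_apply, reshape_apply, mul_comm]

lemma entanglementEntropy_eq_vonNeumannEntropy (I : Finset L) (ψ : Config d → ℂ) :
    entanglementEntropy I ψ =
      vonNeumannEntropy (isHermitian_mul_conjTranspose_self (reshape I ψ)) := by
  simp only [entanglementEntropy, reducedState_pureState]

lemma star_dotProduct_self_eq_one {n : Type*} [Fintype n] {v : n → ℂ}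
    (hv : ∑ i, ‖v i‖ ^ 2 = 1) : star v ⬝ᵥ v = 1 := by
  rw [star_dotProduct_self, hv, Complex.ofReal_one]

lemma neg_logb_norm_sq_le_entanglementEntropy (I : Finset L) {ψ : Config d → ℂ}
    (hψ : ∑ σ, ‖ψ σ‖ ^ 2 = 1) :
    -Real.logb 2 (‖reshape I ψ‖ ^ 2) ≤ entanglementEntropy I ψ := by
  rw [entanglementEntropy_eq_vonNeumannEntropy]
  refine neg_logb_norm_sq_le_vonNeumannEntropy _ ?_
  rw [trace_reshape_mul_conjTranspose_reshape, star_dotProduct_self_eq_one hψ]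

/-- The hypothesis bounds the trace norm of `reshape I ψ`, as the trace norm is dual to the
operator norm. -/
lemma entanglementEntropy_le_of_overlap_le {I : Finset L} {ψ : Config d → ℂ}
    (hψ : ∑ σ, ‖ψ σ‖ ^ 2 = 1) {Z : ℝ}
    (hZ : ∀ φ : Config d → ℂ, ‖reshape I φ‖ ≤ 1 → ‖star φ ⬝ᵥ ψ‖ ≤ Z) :
    entanglementEntropy I ψ ≤ 2 * Real.logb 2 Z := by
  have hρ := isHermitian_mul_conjTranspose_self (reshape I ψ)
  have h_trace : (reshape I ψ * (reshape I ψ)ᴴ).trace = 1 := by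
    rw [trace_reshape_mul_conjTranspose_reshape, star_dotProduct_self_eq_one hψ]
  have h_pos := sum_sqrt_pos_of_sum_eq_one (sum_eigenvalues_eq_one hρ h_trace)
  obtain ⟨W, hW, hW_trace⟩ := exists_contraction_trace_eq_sum_sqrt_eigenvalues hρ
  obtain ⟨φ, hφ⟩ := exists_reshape_eq I Wᴴ
  have h_overlap : ‖star φ ⬝ᵥ ψ‖ = ∑ k, √(hρ.eigenvalues k) := by
    rw [← trace_reshape_mul_conjTranspose_reshape I, hφ, conjTranspose_conjTranspose, hW_trace,
      Complex.norm_real, Real.norm_of_nonneg h_pos.le]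
  calc entanglementEntropy I ψ
      = vonNeumannEntropy hρ := entanglementEntropy_eq_vonNeumannEntropy I ψ
    _ ≤ 2 * Real.logb 2 (∑ k, √(hρ.eigenvalues k)) :=
        vonNeumannEntropy_le_two_mul_logb_sum_sqrt hρ h_trace
    _ ≤ 2 * Real.logb 2 Z := by
        gcongr
        · exact one_lt_two
        · exact h_overlap ▸ hZ φ (by rwa [hφ, l2_opNorm_conjTranspose])

end Reshape

section TensorProduct

variable {ι : Type*} [Fintype ι] {n : ι → Type*}

/-- The tensor product `⨂ i, A i` of operators on the single sites. -/
def tensorProduct (A : ∀ i, Matrix (n i) (n i) ℂ) : Matrix (∀ i, n i) (∀ i, n i) ℂ :=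
  of fun x y => ∏ i, A i (x i) (y i)

lemma tensorProduct_apply (A : ∀ i, Matrix (n i) (n i) ℂ) (x y : ∀ i, n i) :
    tensorProduct A x y = ∏ i, A i (x i) (y i) := rfl

lemma conjTranspose_tensorProduct (A : ∀ i, Matrix (n i) (n i) ℂ) :
    (tensorProduct A)ᴴ = tensorProduct fun i => (A i)ᴴ := by
  ext x y
  simp [tensorProduct_apply]

lemma transpose_tensorProduct (A : ∀ i, Matrix (n i) (n i) ℂ) :
    (tensorProduct A)ᵀ = tensorProduct fun i => (A i)ᵀ := rfl

@[simp]
lemma tensorProduct_one [∀ i, DecidableEq (n i)] :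
    tensorProduct (fun i => (1 : Matrix (n i) (n i) ℂ)) = 1 := by
  ext x y
  simp [tensorProduct_apply, one_apply, Finset.prod_boole, funext_iff]

end TensorProduct

section LocalOperators

variable {L : Type} [DecidableEq L] {d : L → ℕ}

lemma split_symm_of_mem {I : Finset L} (a : ConfigIn d I) (o : ConfigOut d I) {j : L}
    (h : j ∈ I) : (split d I).symm (a, o) j = a ⟨j, h⟩ := dif_pos h

lemma split_symm_of_notMem {I : Finset L} (a : ConfigIn d I) (o : ConfigOut d I) {j : L}
    (h : j ∉ I) : (split d I).symm (a, o) j = o ⟨j, h⟩ := dif_neg h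

/-- The tensor factor at the site `j` of the matrix unit `|β⟩⟨γ| ⊗ 1`, where `β` and `γ` are basis
labels of the region `X`. -/
def siteUnit {X : Finset L} (β γ : ConfigIn d X) (j : L) : Matrix (Fin (d j)) (Fin (d j)) ℂ :=
  if h : j ∈ X then single (β ⟨j, h⟩) (γ ⟨j, h⟩) 1 else 1

lemma conjTranspose_siteUnit {X : Finset L} (β γ : ConfigIn d X) (j : L) :
    (siteUnit β γ j)ᴴ = siteUnit γ β j := by
  unfold siteUnit
  split_ifs <;> simp

lemma transpose_siteUnit {X : Finset L} (β γ : ConfigIn d X) (j : L) :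
    (siteUnit β γ j)ᵀ = siteUnit γ β j := by
  unfold siteUnit
  split_ifs <;> simp

lemma norm_siteUnit_apply_le_one {X : Finset L} (β γ : ConfigIn d X) (j : L) (x y : Fin (d j)) :
    ‖siteUnit β γ j x y‖ ≤ 1 := by
  unfold siteUnit
  split_ifs <;> simp only [single_apply, one_apply] <;> split_ifs <;> simp

lemma siteUnit_apply_ne_zero_unique {X : Finset L} {β γ : ConfigIn d X} {j : L}
    {x y y' : Fin (d j)} (hy : siteUnit β γ j x y ≠ 0) (hy' : siteUnit β γ j x y' ≠ 0) :
    y = y' := by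
  unfold siteUnit at hy hy'
  split_ifs at hy hy' <;> simp_all [single_apply, one_apply]

variable [Fintype L]

lemma tensorProduct_siteUnit_apply {X : Finset L} (β γ : ConfigIn d X) (x y : Config d) :
    tensorProduct (siteUnit β γ) x y =
      if (β, γ) = (fun j : {j // j ∈ X} => x j, fun j : {j // j ∈ X} => y j) ∧
        ∀ j, j ∉ X → x j = y j then 1 else 0 := by
  have h_site (j : L) : siteUnit β γ j (x j) (y j) =
      if (∀ h : j ∈ X, β ⟨j, h⟩ = x j ∧ γ ⟨j, h⟩ = y j) ∧ (j ∉ X → x j = y j) then 1 else 0 := by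
    by_cases h : j ∈ X <;> simp [siteUnit, h, single_apply, one_apply]
  simp only [tensorProduct_apply, h_site, Finset.prod_boole, Finset.mem_univ, true_imp_iff]
  refine if_congr ?_ rfl rfl
  simp only [Prod.mk.injEq, funext_iff, Subtype.forall, forall_and]

lemma supportedOn_iff {X : Finset L} {A : Matrix (Config d) (Config d) ℂ} :
    SupportedOn X A ↔ ∃ B : Matrix (ConfigIn d X) (ConfigIn d X) ℂ, ∀ x y,
      A x y = if ∀ j, j ∉ X → x j = y j then B (fun j => x j) (fun j => y j) else 0 := by
  have h_apply (B : Matrix (ConfigIn d X) (ConfigIn d X) ℂ) (x y : Config d) :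
      (kronecker B (1 : Matrix (ConfigOut d X) (ConfigOut d X) ℂ)).submatrix
        (split d X) (split d X) x y =
      if ∀ j, j ∉ X → x j = y j then B (fun j => x j) (fun j => y j) else 0 := by
    have h_out : (split d X x).2 = (split d X y).2 ↔ ∀ j, j ∉ X → x j = y j :=
      ⟨fun h j hj => congrFun h ⟨j, hj⟩, fun h => funext fun j => h j.1 j.2⟩
    rw [submatrix_apply, kronecker, kroneckerMap_apply, one_apply]
    simp only [h_out, mul_ite, mul_one, mul_zero]
    rfl
  refine exists_congr fun B => ?_
  simp only [← h_apply, ← Matrix.ext_iff]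

lemma SupportedOn.exists_eq_sum_smul_tensorProduct_siteUnit [Nonempty (Config d)] {X : Finset L}
    {A : Matrix (Config d) (Config d) ℂ} (hA : SupportedOn X A) :
    ∃ e : ConfigIn d X → Config d,
      A = ∑ β, ∑ γ, A (e β) (e γ) • tensorProduct (siteUnit β γ) := by
  obtain ⟨x₀⟩ := ‹Nonempty (Config d)›
  obtain ⟨B, hB⟩ := supportedOn_iff.1 hA
  set e : ConfigIn d X → Config d := fun β => (split d X).symm (β, fun j => x₀ j)
  have h_restrict (β : ConfigIn d X) : (fun j : {j // j ∈ X} => e β j) = β :=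
    funext fun j => split_symm_of_mem _ _ j.2
  have h_entry (β γ : ConfigIn d X) : A (e β) (e γ) = B β γ := by
    rw [hB, if_pos, h_restrict, h_restrict]
    intro j hj
    simp only [e, split_symm_of_notMem _ _ hj]
  refine ⟨e, ?_⟩
  ext x y
  simp only [Matrix.sum_apply, Matrix.smul_apply, smul_eq_mul, h_entry,
    tensorProduct_siteUnit_apply, ite_and, mul_ite, mul_one, mul_zero]
  rw [← Fintype.sum_prod_type' (f := fun β γ => if (β, γ) = _ then
    if ∀ j, j ∉ X → x j = y j then B β γ else 0 else 0), Finset.sum_ite_eq']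
  simp [hB]

/-- The tensor factor on the sites satisfying `p` of the matrix unit `|β⟩⟨γ| ⊗ 1`. -/
def unitOn (p : L → Prop) [Fintype {j // p j}] {X : Finset L} (β γ : ConfigIn d X) :
    Matrix (∀ j : {j // p j}, Fin (d j)) (∀ j : {j // p j}, Fin (d j)) ℂ :=
  tensorProduct fun j : {j // p j} => siteUnit β γ (j : L)

section UnitOn

variable (p : L → Prop) [Fintype {j // p j}] {X : Finset L} (β γ : ConfigIn d X)

omit [Fintype L]

lemma conjTranspose_unitOn : (unitOn p β γ)ᴴ = unitOn p γ β := by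
  simp only [unitOn, conjTranspose_tensorProduct, conjTranspose_siteUnit]

lemma transpose_unitOn : (unitOn p β γ)ᵀ = unitOn p γ β := by
  simp only [unitOn, transpose_tensorProduct, transpose_siteUnit]

lemma unitOn_apply_ne_zero_unique {a b b' : ∀ j : {j // p j}, Fin (d j)}
    (hb : unitOn p β γ a b ≠ 0) (hb' : unitOn p β γ a b' ≠ 0) : b = b' := by
  simp only [unitOn, tensorProduct_apply, Finset.prod_ne_zero_iff] at hb hb'
  exact funext fun j => siteUnit_apply_ne_zero_unique (hb j (Finset.mem_univ j))
    (hb' j (Finset.mem_univ j))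

lemma opNorm_unitOn_le_one : ‖unitOn p β γ‖ ≤ 1 := by
  refine opNorm_le_one_of_ne_zero_unique _ (fun a b => ?_)
    (fun a b b' => unitOn_apply_ne_zero_unique p β γ) (fun a a' b ha ha' => ?_)
  · rw [unitOn, tensorProduct_apply, norm_prod]
    exact Finset.prod_le_one (fun j _ => norm_nonneg _)
      fun j _ => norm_siteUnit_apply_le_one β γ j _ _
  · rw [← transpose_unitOn, transpose_apply] at ha ha'
    exact unitOn_apply_ne_zero_unique p γ β ha ha'

lemma unitOn_eq_one (hX : ∀ j ∈ X, ¬p j) : unitOn p β γ = 1 := by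
  have h_site (j : {j // p j}) : siteUnit β γ (j : L) = 1 := dif_neg fun h => hX j h j.2
  simp only [unitOn, h_site, tensorProduct_one]

end UnitOn

lemma reshape_tensorProduct_mulVec (I : Finset L) (A : ∀ j, Matrix (Fin (d j)) (Fin (d j)) ℂ)
    (ψ : Config d → ℂ) :
    reshape I (tensorProduct A *ᵥ ψ) = tensorProduct (fun j : {j // j ∈ I} => A j) *
      reshape I ψ * (tensorProduct fun j : {j // j ∉ I} => A j)ᵀ := by
  have h_apply (a a' : ConfigIn d I) (o o' : ConfigOut d I) :
      tensorProduct A ((split d I).symm (a, o)) ((split d I).symm (a', o')) =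
        tensorProduct (fun j : {j // j ∈ I} => A j) a a' *
          tensorProduct (fun j : {j // j ∉ I} => A j) o o' := by
    simp only [tensorProduct_apply]
    rw [← Fintype.prod_subtype_mul_prod_subtype (· ∈ I)]
    congr 1
    · refine Finset.prod_congr (by ext; simp) fun j _ => ?_
      simp only [split_symm_of_mem _ _ j.2]
    · refine Finset.prod_congr (by ext; simp) fun j _ => ?_
      simp only [split_symm_of_notMem _ _ j.2]
  ext a o
  rw [reshape_apply, mulVec, dotProduct, sum_config_eq_sum_split I]
  simp only [h_apply, mul_apply, transpose_apply, Finset.sum_mul, reshape_apply]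
  rw [Finset.sum_comm]
  exact Finset.sum_congr rfl fun o' _ => Finset.sum_congr rfl fun a' _ => by ring

lemma SupportedOn.exists_reshape_mulVec_eq_sum [Nonempty (Config d)] {X : Finset L}
    {A : Matrix (Config d) (Config d) ℂ} (hA : SupportedOn X A) (I : Finset L) :
    ∃ e : ConfigIn d X → Config d, ∀ ψ, reshape I (A *ᵥ ψ) = ∑ β, ∑ γ,
      A (e β) (e γ) • (unitOn (· ∈ I) β γ * reshape I ψ * unitOn (· ∉ I) γ β) := by
  obtain ⟨e, he⟩ := hA.exists_eq_sum_smul_tensorProduct_siteUnit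
  refine ⟨e, fun ψ => ?_⟩
  conv_lhs => rw [he]
  simp only [sum_mulVec, smul_mulVec, map_sum, map_smul, reshape_tensorProduct_mulVec,
    transpose_tensorProduct, transpose_siteUnit, unitOn]

omit [Fintype L] in
lemma isHermitian_sum_smul_unitOn (p : L → Prop) [Fintype {j // p j}] {X : Finset L}
    {A : Matrix (Config d) (Config d) ℂ} (hA : A.IsHermitian) (e : ConfigIn d X → Config d) :
    (∑ β, ∑ γ, A (e β) (e γ) • unitOn p β γ).IsHermitian := by
  simp only [IsHermitian, conjTranspose_sum, conjTranspose_smul, conjTranspose_unitOn, hA.apply]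
  exact Finset.sum_comm

lemma SupportedOn.exists_reshape_mulVec_eq_mul_of_subset [Nonempty (Config d)] {I X : Finset L}
    {A : Matrix (Config d) (Config d) ℂ} (hX : SupportedOn X A) (hA : A.IsHermitian)
    (h_subset : X ⊆ I) :
    ∃ K : Matrix (ConfigIn d I) (ConfigIn d I) ℂ, K.IsHermitian ∧
      ∀ ψ, reshape I (A *ᵥ ψ) = K * reshape I ψ := by
  obtain ⟨e, he⟩ := hX.exists_reshape_mulVec_eq_sum I
  have h_out (β γ : ConfigIn d X) : unitOn (· ∉ I) γ β = 1 :=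
    unitOn_eq_one _ γ β fun j hj => not_not.2 (h_subset hj)
  refine ⟨_, isHermitian_sum_smul_unitOn (· ∈ I) hA e, fun ψ => ?_⟩
  simp only [he, h_out, Matrix.mul_one, Matrix.sum_mul, Matrix.smul_mul]

lemma SupportedOn.exists_reshape_mulVec_eq_mul_of_disjoint [Nonempty (Config d)] {I X : Finset L}
    {A : Matrix (Config d) (Config d) ℂ} (hX : SupportedOn X A) (hA : A.IsHermitian)
    (h_disjoint : Disjoint X I) :
    ∃ K : Matrix (ConfigOut d I) (ConfigOut d I) ℂ, K.IsHermitian ∧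
      ∀ ψ, reshape I (A *ᵥ ψ) = reshape I ψ * K := by
  obtain ⟨e, he⟩ := hX.exists_reshape_mulVec_eq_sum I
  have h_in (β γ : ConfigIn d X) : unitOn (· ∈ I) β γ = 1 :=
    unitOn_eq_one _ β γ fun j hj => Finset.disjoint_left.1 h_disjoint hj
  refine ⟨_, (isHermitian_sum_smul_unitOn (· ∉ I) hA e).transpose, fun ψ => ?_⟩
  simp only [he, h_in, Matrix.one_mul, transpose_sum, transpose_smul, transpose_unitOn,
    Matrix.mul_sum, Matrix.mul_smul]

lemma SupportedOn.norm_reshape_mulVec_le [Nonempty (Config d)] {X : Finset L}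
    {A : Matrix (Config d) (Config d) ℂ} (hA : SupportedOn X A) (I : Finset L)
    (ψ : Config d → ℂ) :
    ‖reshape I (A *ᵥ ψ)‖ ≤ (Fintype.card (ConfigIn d X) : ℝ) ^ 2 * ‖A‖ * ‖reshape I ψ‖ := by
  obtain ⟨e, he⟩ := hA.exists_reshape_mulVec_eq_sum I
  have h_term (β γ : ConfigIn d X) :
      ‖A (e β) (e γ) • (unitOn (· ∈ I) β γ * reshape I ψ * unitOn (· ∉ I) γ β)‖ ≤
        ‖A‖ * ‖reshape I ψ‖ := by
    rw [norm_smul]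
    refine mul_le_mul (norm_apply_le_opNorm A _ _) ?_ (norm_nonneg _) (norm_nonneg _)
    refine (l2_opNorm_mul _ _).trans ((mul_le_of_le_one_right (norm_nonneg _)
      (opNorm_unitOn_le_one _ γ β)).trans ?_)
    exact (l2_opNorm_mul _ _).trans (mul_le_of_le_one_left (norm_nonneg _)
      (opNorm_unitOn_le_one _ β γ))
  calc ‖reshape I (A *ᵥ ψ)‖
      ≤ ∑ _β : ConfigIn d X, ∑ _γ : ConfigIn d X, ‖A‖ * ‖reshape I ψ‖ := by
        rw [he]
        exact norm_sum_le_of_le _ fun β _ => norm_sum_le_of_le _ fun γ _ => h_term β γ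
    _ = (Fintype.card (ConfigIn d X) : ℝ) ^ 2 * ‖A‖ * ‖reshape I ψ‖ := by
        simp only [Finset.sum_const, Finset.card_univ, nsmul_eq_mul]
        ring

end LocalOperators

section ProductStates

lemma sum_norm_sq_prod_eq_one {ι : Type*} [Fintype ι] [DecidableEq ι] {κ : ι → Type*}
    [∀ i, Fintype (κ i)] {φ : ∀ i, κ i → ℂ} (hφ : ∀ i, ∑ a, ‖φ i a‖ ^ 2 = 1) :
    ∑ σ : ∀ i, κ i, ‖∏ i, φ i (σ i)‖ ^ 2 = 1 := by
  simp only [norm_prod, ← Finset.prod_pow]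
  rw [← Fintype.prod_sum (fun i a => ‖φ i a‖ ^ 2)]
  simp only [hφ, Finset.prod_const_one]

lemma norm_sq_dotProduct_le {n : Type*} [Fintype n] (v w : n → ℂ) :
    ‖v ⬝ᵥ w‖ ^ 2 ≤ (∑ i, ‖v i‖ ^ 2) * ∑ i, ‖w i‖ ^ 2 :=
  calc ‖v ⬝ᵥ w‖ ^ 2
      ≤ (∑ i, ‖v i‖ * ‖w i‖) ^ 2 := by
        gcongr
        exact norm_sum_le_of_le _ fun i _ => (norm_mul _ _).le
    _ ≤ (∑ i, ‖v i‖ ^ 2) * ∑ i, ‖w i‖ ^ 2 := Finset.sum_mul_sq_le_sq_mul_sq _ _ _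

variable {L : Type} [Fintype L] [DecidableEq L] {d : L → ℕ} {ψ : Config d → ℂ}

lemma IsProductState.sum_norm_sq (hψ : IsProductState ψ) : ∑ σ, ‖ψ σ‖ ^ 2 = 1 := by
  obtain ⟨φ, hφ, hψφ⟩ := hψ
  simp only [hψφ, sum_norm_sq_prod_eq_one hφ]

omit [DecidableEq L] in
lemma IsProductState.nonempty_config (hψ : IsProductState ψ) : Nonempty (Config d) := by
  classical
  by_contra h_empty
  rw [not_nonempty_iff] at h_empty
  simpa using hψ.sum_norm_sq

lemma IsProductState.exists_reshape_eq_vecMulVec (hψ : IsProductState ψ) (I : Finset L) :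
    ∃ (u : ConfigIn d I → ℂ) (v : ConfigOut d I → ℂ), ∑ a, ‖u a‖ ^ 2 = 1 ∧ ∑ o, ‖v o‖ ^ 2 = 1 ∧
      reshape I ψ = vecMulVec u v := by
  obtain ⟨φ, hφ, hψφ⟩ := hψ
  have hu : ∑ a : ConfigIn d I, ‖∏ j, φ j.1 (a j)‖ ^ 2 = 1 :=
    sum_norm_sq_prod_eq_one (φ := fun j : {j // j ∈ I} => φ j.1) fun j => hφ j
  have hv : ∑ o : ConfigOut d I, ‖∏ j, φ j.1 (o j)‖ ^ 2 = 1 :=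
    sum_norm_sq_prod_eq_one (φ := fun j : {j // j ∉ I} => φ j.1) fun j => hφ j
  refine ⟨_, _, hu, hv, ?_⟩
  ext a o
  rw [reshape_apply, hψφ, vecMulVec_apply, ← Fintype.prod_subtype_mul_prod_subtype (· ∈ I)]
  congr 1
  · refine Finset.prod_congr (by ext; simp) fun j _ => ?_
    rw [split_symm_of_mem _ _ j.2]
  · refine Finset.prod_congr (by ext; simp) fun j _ => ?_
    rw [split_symm_of_notMem _ _ j.2]

lemma IsProductState.norm_star_dotProduct_le (hψ : IsProductState ψ) (I : Finset L)
    (φ : Config d → ℂ) : ‖star φ ⬝ᵥ ψ‖ ≤ ‖reshape I φ‖ := by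
  obtain ⟨u, v, hu, hv, huv⟩ := hψ.exists_reshape_eq_vecMulVec I
  have h_overlap : star φ ⬝ᵥ ψ = star (reshape I φ *ᵥ star v) ⬝ᵥ u := by
    rw [← trace_reshape_mul_conjTranspose_reshape I, huv, vecMulVec_mul, trace_vecMulVec,
      star_mulVec, star_star, dotProduct_comm]
  refine le_of_sq_le_sq ?_ (norm_nonneg _)
  calc ‖star φ ⬝ᵥ ψ‖ ^ 2
      ≤ (∑ a, ‖(reshape I φ *ᵥ star v) a‖ ^ 2) * ∑ a, ‖u a‖ ^ 2 := by
        rw [h_overlap]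
        simpa only [Pi.star_apply, norm_star] using
          norm_sq_dotProduct_le (star (reshape I φ *ᵥ star v)) u
    _ ≤ ‖reshape I φ‖ ^ 2 := by
        simpa only [Pi.star_apply, norm_star, hu, hv, mul_one] using
          sum_norm_sq_mulVec_le (reshape I φ) (star v)

lemma IsProductState.opNorm_reshape_le_one (hψ : IsProductState ψ) (I : Finset L) :
    ‖reshape I ψ‖ ≤ 1 := by
  obtain ⟨u, v, hu, hv, huv⟩ := hψ.exists_reshape_eq_vecMulVec I
  refine opNorm_le_of_sum_norm_sq_mulVec_le _ zero_le_one fun w => ?_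
  calc ∑ a, ‖(reshape I ψ *ᵥ w) a‖ ^ 2 = ∑ a, ‖u a‖ ^ 2 * ‖v ⬝ᵥ w‖ ^ 2 := by
        simp [huv, vecMulVec_mulVec, mul_pow]
    _ = ‖v ⬝ᵥ w‖ ^ 2 := by rw [← Finset.sum_mul, hu, one_mul]
    _ ≤ 1 ^ 2 * ∑ o, ‖w o‖ ^ 2 := by simpa [hv] using norm_sq_dotProduct_le v w

end ProductStates

section Evolution

variable {L : Type} [Fintype L] [DecidableEq L] {d : L → ℕ} {H : Matrix (Config d) (Config d) ℂ}

lemma sum_norm_sq_evolve (hH : H.IsHermitian) (t : ℝ) (ψ : Config d → ℂ) :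
    ∑ σ, ‖evolve H t ψ σ‖ ^ 2 = ∑ σ, ‖ψ σ‖ ^ 2 :=
  sum_norm_sq_unitary_mulVec (unitaryEvolution_mem_unitaryGroup hH t) ψ

lemma star_dotProduct_evolve (hH : H.IsHermitian) (t : ℝ) (φ ψ : Config d → ℂ) :
    star φ ⬝ᵥ evolve H t ψ = star (evolve H (-t) φ) ⬝ᵥ ψ := by
  change star φ ⬝ᵥ (unitaryEvolution H t *ᵥ ψ) = star (unitaryEvolution H (-t) *ᵥ φ) ⬝ᵥ ψ
  rw [star_mulVec, conjTranspose_unitaryEvolution hH, neg_neg, dotProduct_mulVec]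

variable {I : Finset L} {K : Matrix (ConfigIn d I) (ConfigIn d I) ℂ}
  {K' : Matrix (ConfigOut d I) (ConfigOut d I) ℂ} {c : ℝ}

lemma norm_reshape_evolve_le (hK : K.IsHermitian) (hK' : K'.IsHermitian)
    (hc : ∀ φ, ‖reshape I (H *ᵥ φ) - (K * reshape I φ + reshape I φ * K')‖ ≤ c * ‖reshape I φ‖)
    (t : ℝ) (φ : Config d → ℂ) :
    ‖reshape I (evolve H t φ)‖ ≤ Real.exp (c * |t|) * ‖reshape I φ‖ := by
  have h_bound := norm_le_exp_mul_abs_mul_norm_zero_of_hasDerivAt hK hK'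
    (F := fun s => reshape I (evolve H s φ)) (R := fun s => reshape I (H *ᵥ evolve H s φ) -
      (K * reshape I (evolve H s φ) + reshape I (evolve H s φ) * K')) ?_
    (fun s => hc (evolve H s φ)) t
  · simpa [evolve] using h_bound
  · refine fun s => hasDerivAt_matrix_iff.2 fun a o => ?_
    rw [add_sub_cancel]
    exact hasDerivAt_pi.1 (hasDerivAt_unitaryEvolution_mulVec H φ s) _

lemma IsProductState.entanglementEntropy_evolve_le {ψ : Config d → ℂ} (hψ : IsProductState ψ)
    (hH : H.IsHermitian) (hK : K.IsHermitian) (hK' : K'.IsHermitian)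
    (hc : ∀ φ, ‖reshape I (H *ᵥ φ) - (K * reshape I φ + reshape I φ * K')‖ ≤ c * ‖reshape I φ‖)
    (t : ℝ) : entanglementEntropy I (evolve H t ψ) ≤ 2 * (c * |t| / Real.log 2) := by
  have h_norm : ∑ σ, ‖evolve H t ψ σ‖ ^ 2 = 1 := by rw [sum_norm_sq_evolve hH, hψ.sum_norm_sq]
  have h_overlap (φ : Config d → ℂ) (hφ : ‖reshape I φ‖ ≤ 1) :
      ‖star φ ⬝ᵥ evolve H t ψ‖ ≤ Real.exp (c * |t|) := calc
    _ = ‖star (evolve H (-t) φ) ⬝ᵥ ψ‖ := by rw [star_dotProduct_evolve hH]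
    _ ≤ ‖reshape I (evolve H (-t) φ)‖ := hψ.norm_star_dotProduct_le I _
    _ ≤ Real.exp (c * |t|) * ‖reshape I φ‖ := abs_neg t ▸ norm_reshape_evolve_le hK hK' hc (-t) φ
    _ ≤ Real.exp (c * |t|) := mul_le_of_le_one_right (Real.exp_pos _).le hφ
  simpa only [Real.logb, Real.log_exp] using entanglementEntropy_le_of_overlap_le h_norm h_overlap

end Evolution

section CrossingSets

variable {L : Type} {G : SimpleGraph L}

lemma exists_adj_edist_le_of_edist_le_succ {u v : L} {n : ℕ} (h : G.edist u v ≤ (n + 1 : ℕ))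
    (h_ne : u ≠ v) : ∃ w, G.Adj u w ∧ G.edist w v ≤ n := by
  obtain ⟨p, hp⟩ := SimpleGraph.exists_walk_of_edist_ne_top
    (ne_top_of_le_ne_top (ENat.natCast_ne_top _) h)
  cases p with
  | nil => exact absurd rfl h_ne
  | @cons _ w _ h_adj p =>
    rw [← hp, SimpleGraph.Walk.length_cons, Nat.cast_le, Nat.add_le_add_iff_right] at h
    exact ⟨w, h_adj, (SimpleGraph.edist_le p).trans (Nat.cast_le.2 h)⟩

lemma exists_boundary_edist_le {I : Finset L} {i j : L} {r : ℕ} (hi : i ∈ I) (hj : j ∉ I)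
    (h : G.edist i j ≤ r) : ∃ b, (b ∈ I ∧ ∃ k, k ∉ I ∧ G.Adj b k) ∧ G.edist b i ≤ r := by
  classical
  obtain ⟨p, hp⟩ := SimpleGraph.exists_walk_of_edist_ne_top
    (ne_top_of_le_ne_top (ENat.natCast_ne_top r) h)
  obtain ⟨e, he, h_fst, h_snd⟩ := p.exists_boundary_dart (I : Set L) hi hj
  refine ⟨e.fst, ⟨h_fst, e.snd, h_snd, e.adj⟩, ?_⟩
  have h_mem := p.dart_fst_mem_support_of_mem_darts he
  rw [SimpleGraph.edist_comm]
  calc G.edist i e.fst ≤ (p.takeUntil _ h_mem).length := SimpleGraph.edist_le _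
    _ ≤ p.length := Nat.cast_le.2 (p.length_takeUntil_le_length h_mem)
    _ ≤ r := hp.trans_le h

variable [Fintype L]

open Classical in
lemma card_filter_edist_le [DecidableRel G.Adj] {Δ : ℕ} (hΔ : ∀ v, G.degree v ≤ Δ) (n : ℕ)
    (v : L) : (Finset.univ.filter fun u => G.edist v u ≤ n).card ≤ (Δ + 1) ^ n := by
  induction n generalizing v with
  | zero => simp [SimpleGraph.edist_eq_zero_iff, Finset.filter_eq]
  | succ n ih =>
    have h_subset : (Finset.univ.filter fun u => G.edist v u ≤ (n + 1 : ℕ)) ⊆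
        insert v ((G.neighborFinset v).biUnion fun w =>
          Finset.univ.filter fun u => G.edist w u ≤ n) := by
      intro u hu
      by_cases h_eq : v = u
      · simp [h_eq]
      obtain ⟨w, h_adj, hw⟩ :=
        exists_adj_edist_le_of_edist_le_succ (Finset.mem_filter.1 hu).2 h_eq
      simp only [Finset.mem_insert, Finset.mem_biUnion, Finset.mem_filter, Finset.mem_univ,
        true_and]
      exact Or.inr ⟨w, (G.mem_neighborFinset v w).2 h_adj, hw⟩
    calc _ ≤ _ := (Finset.card_le_card h_subset).trans (Finset.card_insert_le _ _)
      _ ≤ G.degree v * (Δ + 1) ^ n + 1 := by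
        gcongr
        exact Finset.card_biUnion_le_card_mul _ _ _ fun w _ => ih w
      _ ≤ Δ * (Δ + 1) ^ n + (Δ + 1) ^ n := by
        gcongr
        · exact hΔ v
        · exact Nat.one_le_pow _ _ Δ.succ_pos
      _ = (Δ + 1) ^ (n + 1) := by ring

open Classical in
/-- The sets of diameter at most `r` that meet both `I` and its complement: the possible supports of
the terms of a Hamiltonian of range `r` that couple `I` to the rest of the lattice. -/
noncomputable def crossingSets (G : SimpleGraph L) (r : ℕ) (I : Finset L) : Finset (Finset L) :=
  Finset.univ.filter fun X =>
    (∀ i ∈ X, ∀ j ∈ X, G.edist i j ≤ r) ∧ ¬X ⊆ I ∧ ¬Disjoint X I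

lemma mem_crossingSets {r : ℕ} {I X : Finset L} : X ∈ crossingSets G r I ↔
    (∀ i ∈ X, ∀ j ∈ X, G.edist i j ≤ r) ∧ ¬X ⊆ I ∧ ¬Disjoint X I := by
  simp only [crossingSets, Finset.mem_filter, Finset.mem_univ, true_and]

open Classical in
lemma exists_boundary_subset_of_mem_crossingSets {r : ℕ} {I X : Finset L}
    (hX : X ∈ crossingSets G r I) :
    ∃ b, (b ∈ I ∧ ∃ k, k ∉ I ∧ G.Adj b k) ∧
      X ⊆ Finset.univ.filter fun u => G.edist b u ≤ (2 * r : ℕ) := by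
  obtain ⟨h_diam, h_subset, h_disjoint⟩ := mem_crossingSets.1 hX
  obtain ⟨j, hjX, hjI⟩ := Finset.not_subset.1 h_subset
  obtain ⟨i, hiX, hiI⟩ := Finset.not_disjoint_iff.1 h_disjoint
  obtain ⟨b, hb, hbi⟩ := exists_boundary_edist_le hiI hjI (h_diam i hiX j hjX)
  refine ⟨b, hb, fun u hu => Finset.mem_filter.2 ⟨Finset.mem_univ u, ?_⟩⟩
  calc G.edist b u ≤ G.edist b i + G.edist i u := G.edist_triangle
    _ ≤ r + r := add_le_add hbi (h_diam i hiX u hu)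
    _ = (2 * r : ℕ) := by push_cast; ring

variable [DecidableRel G.Adj] {Δ : ℕ}

lemma card_le_of_mem_crossingSets (hΔ : ∀ v, G.degree v ≤ Δ) {r : ℕ} {I X : Finset L}
    (hX : X ∈ crossingSets G r I) : X.card ≤ (Δ + 1) ^ (2 * r) := by
  obtain ⟨b, -, hb⟩ := exists_boundary_subset_of_mem_crossingSets hX
  exact (Finset.card_le_card hb).trans (card_filter_edist_le hΔ _ b)

lemma card_crossingSets_le (hΔ : ∀ v, G.degree v ≤ Δ) (r : ℕ) (I : Finset L) :
    (crossingSets G r I).card ≤ boundaryArea G I * 2 ^ (Δ + 1) ^ (2 * r) := by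
  classical
  set boundary := Finset.univ.filter fun b => b ∈ I ∧ ∃ k, k ∉ I ∧ G.Adj b k with h_boundary
  have h_area : boundaryArea G I = boundary.card := by
    rw [boundaryArea, ← Set.ncard_coe_finset, h_boundary]
    simp
  have h_subset : crossingSets G r I ⊆ boundary.biUnion fun b =>
      (Finset.univ.filter fun u => G.edist b u ≤ (2 * r : ℕ)).powerset := by
    intro X hX
    obtain ⟨b, hb, hXb⟩ := exists_boundary_subset_of_mem_crossingSets hX
    exact Finset.mem_biUnion.2
      ⟨b, Finset.mem_filter.2 ⟨Finset.mem_univ b, hb⟩, Finset.mem_powerset.2 hXb⟩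
  rw [h_area]
  refine (Finset.card_le_card h_subset).trans (Finset.card_biUnion_le_card_mul _ _ _ fun b _ => ?_)
  rw [Finset.card_powerset]
  exact Nat.pow_le_pow_right two_pos (card_filter_edist_le hΔ _ b)

end CrossingSets

section AreaLaw

variable {L : Type} [DecidableEq L] {d : L → ℕ}

lemma card_configIn_le {q m : ℕ} (hd : ∀ j, d j ≤ q) {X : Finset L} (hX : X.card ≤ m) :
    Fintype.card (ConfigIn d X) ≤ (q + 1) ^ m := by
  have h_card : Fintype.card (ConfigIn d X) ≤ (q + 1) ^ X.card := by
    rw [Fintype.card_pi]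
    simpa using Finset.prod_le_pow_card Finset.univ (fun j : {j // j ∈ X} => d j) (q + 1)
      fun j _ => (hd j).trans q.le_succ
  exact h_card.trans (Nat.pow_le_pow_right q.succ_pos hX)

variable [Fintype L] {G : SimpleGraph L} {r : ℕ} {J : ℝ}

lemma IsLocalHamiltonian.isHermitian {H : Matrix (Config d) (Config d) ℂ}
    (hH : IsLocalHamiltonian G r J H) : H.IsHermitian := by
  obtain ⟨h, h_herm, -, -, -, rfl⟩ := hH
  exact isSelfAdjoint_sum _ fun X _ => h_herm X

variable [Nonempty (Config d)]

lemma SupportedOn.exists_norm_reshape_mulVec_sub_le {X : Finset L}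
    {A : Matrix (Config d) (Config d) ℂ} (hX : SupportedOn X A) (hA : A.IsHermitian)
    (I : Finset L) :
    ∃ (K : Matrix (ConfigIn d I) (ConfigIn d I) ℂ) (K' : Matrix (ConfigOut d I) (ConfigOut d I) ℂ),
      K.IsHermitian ∧ K'.IsHermitian ∧ ∀ ψ,
        ‖reshape I (A *ᵥ ψ) - (K * reshape I ψ + reshape I ψ * K')‖ ≤
          (if X ⊆ I ∨ Disjoint X I then 0 else (Fintype.card (ConfigIn d X) : ℝ) ^ 2 * ‖A‖) *
            ‖reshape I ψ‖ := by
  by_cases h_subset : X ⊆ I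
  · obtain ⟨K, hK, hKψ⟩ := hX.exists_reshape_mulVec_eq_mul_of_subset hA h_subset
    exact ⟨K, 0, hK, isHermitian_zero, fun ψ => by simp [hKψ, h_subset]⟩
  by_cases h_disjoint : Disjoint X I
  · obtain ⟨K', hK', hKψ⟩ := hX.exists_reshape_mulVec_eq_mul_of_disjoint hA h_disjoint
    exact ⟨0, K', isHermitian_zero, hK', fun ψ => by simp [hKψ, h_disjoint]⟩
  refine ⟨0, 0, isHermitian_zero, isHermitian_zero, fun ψ => ?_⟩
  rw [if_neg (not_or.2 ⟨h_subset, h_disjoint⟩)]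
  simpa using hX.norm_reshape_mulVec_le I ψ

lemma IsLocalHamiltonian.exists_norm_reshape_mulVec_sub_le [DecidableRel G.Adj] {Δ q : ℕ}
    (hΔ : ∀ v, G.degree v ≤ Δ) (hd : ∀ j, d j ≤ q) {H : Matrix (Config d) (Config d) ℂ}
    (hH : IsLocalHamiltonian G r J H) (I : Finset L) :
    ∃ (K : Matrix (ConfigIn d I) (ConfigIn d I) ℂ) (K' : Matrix (ConfigOut d I) (ConfigOut d I) ℂ),
      K.IsHermitian ∧ K'.IsHermitian ∧ ∀ ψ,
        ‖reshape I (H *ᵥ ψ) - (K * reshape I ψ + reshape I ψ * K')‖ ≤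
          (crossingSets G r I).card * (((q + 1 : ℝ) ^ (Δ + 1) ^ (2 * r)) ^ 2 * |J|) *
            ‖reshape I ψ‖ := by
  obtain ⟨h, h_herm, h_supp, h_range, h_norm, rfl⟩ := hH
  set C : ℝ := ((q + 1 : ℝ) ^ (Δ + 1) ^ (2 * r)) ^ 2 * |J| with hC
  choose K K' hK hK' h_bound using
    fun X => (h_supp X).exists_norm_reshape_mulVec_sub_le (h_herm X) I
  have h_coeff (X : Finset L) : (if X ⊆ I ∨ Disjoint X I then 0 else
      (Fintype.card (ConfigIn d X) : ℝ) ^ 2 * ‖h X‖) ≤ if X ∈ crossingSets G r I then C else 0 := by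
    have h_nonneg : 0 ≤ if X ∈ crossingSets G r I then C else 0 := by split_ifs <;> positivity
    by_cases h_one_sided : X ⊆ I ∨ Disjoint X I
    · rwa [if_pos h_one_sided]
    rw [if_neg h_one_sided]
    rcases eq_or_ne (h X) 0 with h_zero | h_ne
    · rwa [h_zero, norm_zero, mul_zero]
    have h_mem : X ∈ crossingSets G r I :=
      mem_crossingSets.2 ⟨h_range X h_ne, not_or.1 h_one_sided⟩
    have h_card : (Fintype.card (ConfigIn d X) : ℝ) ≤ (q + 1 : ℝ) ^ (Δ + 1) ^ (2 * r) := by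
      exact_mod_cast card_configIn_le hd (card_le_of_mem_crossingSets hΔ h_mem)
    rw [if_pos h_mem, hC]
    gcongr
    exact (h_norm X).trans (le_abs_self J)
  refine ⟨∑ X, K X, ∑ X, K' X, isSelfAdjoint_sum _ fun X _ => hK X,
    isSelfAdjoint_sum _ fun X _ => hK' X, fun ψ => ?_⟩
  calc _ = ‖∑ X, (reshape I (h X *ᵥ ψ) - (K X * reshape I ψ + reshape I ψ * K' X))‖ := by
        rw [sum_mulVec, map_sum, Matrix.sum_mul, Matrix.mul_sum, ← Finset.sum_add_distrib,
          ← Finset.sum_sub_distrib]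
    _ ≤ ∑ X, (if X ∈ crossingSets G r I then C else 0) * ‖reshape I ψ‖ :=
        norm_sum_le_of_le _ fun X _ =>
          (h_bound X ψ).trans (mul_le_mul_of_nonneg_right (h_coeff X) (norm_nonneg _))
    _ = (crossingSets G r I).card * C * ‖reshape I ψ‖ := by
        rw [← Finset.sum_mul, Finset.sum_ite_mem, Finset.univ_inter, Finset.sum_const,
          nsmul_eq_mul]

omit [Nonempty (Config d)] in
lemma IsProductState.entanglementEntropy_evolve_le_boundaryArea [DecidableRel G.Adj] {Δ q : ℕ}
    (hΔ : ∀ v, G.degree v ≤ Δ) (hd : ∀ j, d j ≤ q) {H : Matrix (Config d) (Config d) ℂ}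
    {ψ : Config d → ℂ} (hH : IsLocalHamiltonian G r J H) (hψ : IsProductState ψ) (I : Finset L)
    (t : ℝ) :
    entanglementEntropy I (evolve H t ψ) ≤
      2 * (2 ^ (Δ + 1) ^ (2 * r) * (((q + 1 : ℝ) ^ (Δ + 1) ^ (2 * r)) ^ 2 * |J|) * |t| /
        Real.log 2) * boundaryArea G I := by
  have := hψ.nonempty_config
  obtain ⟨K, K', hK, hK', h_bound⟩ := hH.exists_norm_reshape_mulVec_sub_le hΔ hd I
  set C : ℝ := ((q + 1 : ℝ) ^ (Δ + 1) ^ (2 * r)) ^ 2 * |J|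
  have h_card : ((crossingSets G r I).card : ℝ) ≤ boundaryArea G I * 2 ^ (Δ + 1) ^ (2 * r) := by
    exact_mod_cast card_crossingSets_le hΔ r I
  calc entanglementEntropy I (evolve H t ψ)
      ≤ 2 * ((crossingSets G r I).card * C * |t| / Real.log 2) :=
        hψ.entanglementEntropy_evolve_le hH.isHermitian hK hK' h_bound t
    _ ≤ 2 * (boundaryArea G I * 2 ^ (Δ + 1) ^ (2 * r) * C * |t| / Real.log 2) := by gcongr
    _ = _ := by ring

end AreaLaw

theorem exists_entanglementEntropy_evolve_le_boundaryArea (Δ q r : ℕ) (J t : ℝ) :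
    ∃ c₀ c₁ : ℝ, 0 < c₀ ∧ 0 < c₁ ∧
      ∀ (L : Type) [Fintype L] [DecidableEq L] (G : SimpleGraph L) [DecidableRel G.Adj],
        (∀ v, G.degree v ≤ Δ) →
      ∀ (d : L → ℕ), (∀ j, d j ≤ q) →
      ∀ (H : Matrix (Config d) (Config d) ℂ) (ψ : Config d → ℂ),
        IsLocalHamiltonian G r J H → IsProductState ψ →
      ∀ I : Finset L,
        entanglementEntropy I (evolve H t ψ) ≤ c₀ * (boundaryArea G I : ℝ) + c₁ := by
  refine ⟨2 * (2 ^ (Δ + 1) ^ (2 * r) * (((q + 1 : ℝ) ^ (Δ + 1) ^ (2 * r)) ^ 2 * |J|) * |t| /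
    Real.log 2) + 1, 1, by positivity, one_pos, ?_⟩
  intro L _ _ G _ hΔ d hd H ψ hH hψ I
  linarith [hψ.entanglementEntropy_evolve_le_boundaryArea hΔ hd hH I t,
    (boundaryArea G I).cast_nonneg (α := ℝ)]

lemma degree_cubicLattice_le (D n : ℕ) [NeZero n] [DecidableRel (cubicLattice D n).Adj]
    (v : Fin D → ZMod n) : (cubicLattice D n).degree v ≤ 2 * D := by
  classical
  have h_subset : (cubicLattice D n).neighborFinset v ⊆
      (Finset.univ : Finset (Bool × Fin D)).image fun p =>
        Function.update v p.2 (if p.1 then v p.2 + 1 else v p.2 - 1) := by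
    intro w hw
    obtain ⟨-, k, hk, h_agree⟩ := ((cubicLattice D n).mem_neighborFinset v w).1 hw
    have h_update : Function.update v k (w k) = w :=
      Function.update_eq_iff.2 ⟨rfl, fun l hl => h_agree l hl⟩
    refine Finset.mem_image.2 ?_
    rcases hk with hk | hk
    · exact ⟨(true, k), Finset.mem_univ _, by simpa [← hk] using h_update⟩
    · exact ⟨(false, k), Finset.mem_univ _, by simpa [hk] using h_update⟩
  rw [← SimpleGraph.card_neighborFinset_eq_degree]
  refine (Finset.card_le_card h_subset).trans (Finset.card_image_le.trans ?_)
  simp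

section TensorProduct

variable {ι : Type*} [Fintype ι] {n : ι → Type*}

lemma tensorProduct_mul [∀ i, Fintype (n i)] [DecidableEq ι] (A B : ∀ i, Matrix (n i) (n i) ℂ) :
    tensorProduct A * tensorProduct B = tensorProduct fun i => A i * B i := by
  ext x z
  simp only [mul_apply, tensorProduct_apply, ← Finset.prod_mul_distrib, Finset.prod_univ_sum,
    Fintype.piFinset_univ]

lemma tensorProduct_mulVec [∀ i, Fintype (n i)] [DecidableEq ι] (A : ∀ i, Matrix (n i) (n i) ℂ)
    (φ : ∀ i, n i → ℂ) :
    (tensorProduct A *ᵥ fun x => ∏ i, φ i (x i)) = fun x => ∏ i, (A i *ᵥ φ i) (x i) := by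
  funext x
  simp only [mulVec, dotProduct, tensorProduct_apply, ← Finset.prod_mul_distrib,
    Finset.prod_univ_sum, Fintype.piFinset_univ]

lemma tensorProduct_eq_zero {A : ∀ i, Matrix (n i) (n i) ℂ} {j : ι} (hj : A j = 0) :
    tensorProduct A = 0 := by
  ext x y
  exact Finset.prod_eq_zero (Finset.mem_univ j) (by rw [hj, Matrix.zero_apply])

lemma tensorProduct_add_tensorProduct {A B C : ∀ i, Matrix (n i) (n i) ℂ} {j : ι}
    (hj : A j + B j = C j) (hA : ∀ i, i ≠ j → A i = C i) (hB : ∀ i, i ≠ j → B i = C i) :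
    tensorProduct A + tensorProduct B = tensorProduct C := by
  classical
  ext x y
  have h_erase {D : ∀ i, Matrix (n i) (n i) ℂ} (hD : ∀ i, i ≠ j → D i = C i) :
      tensorProduct D x y = D j (x j) (y j) * ∏ i ∈ Finset.univ.erase j, C i (x i) (y i) := by
    rw [tensorProduct_apply, ← Finset.mul_prod_erase _ _ (Finset.mem_univ j)]
    congr 1
    exact Finset.prod_congr rfl fun i hi => by rw [hD i (Finset.ne_of_mem_erase hi)]
  rw [Matrix.add_apply, h_erase hA, h_erase hB, h_erase fun _ _ => rfl, ← add_mul,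
    ← Matrix.add_apply, hj]

end TensorProduct

section JordanWigner

/-- The Pauli matrix `σ_z`, the parity operator of a single site. -/
def pauliZ : Matrix (Fin 2) (Fin 2) ℂ := diagonal ![1, -1]

lemma pauliZ_mul_self : pauliZ * pauliZ = 1 := by
  ext i j
  fin_cases i <;> fin_cases j <;> simp [pauliZ]

lemma conjTranspose_pauliZ : pauliZᴴ = pauliZ := by
  ext i j
  fin_cases i <;> fin_cases j <;> simp [pauliZ]

lemma pauliZ_mul_single_add_single_mul_pauliZ (b : Fin 2) :
    pauliZ * single b (1 - b) 1 + single b (1 - b) 1 * pauliZ = 0 := by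
  ext i j
  fin_cases b <;> fin_cases i <;> fin_cases j <;> simp [pauliZ, single, Matrix.mul_apply]

variable {ι : Type*} [DecidableEq ι]

/-- The factor at the site `i` of the fermionic operator at the site `j`. -/
def fermiFactor (r : ι → ℕ) (b : Fin 2) (j i : ι) : Matrix (Fin 2) (Fin 2) ℂ :=
  if i = j then single b (1 - b) 1 else if r i < r j then pauliZ else 1

section FermiFactor

variable {r : ι → ℕ} {b : Fin 2} {i j : ι}

lemma fermiFactor_self : fermiFactor r b j j = single b (1 - b) 1 := if_pos rfl

lemma fermiFactor_of_lt (h : r i < r j) : fermiFactor r b j i = pauliZ := by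
  rw [fermiFactor, if_neg (by rintro rfl; exact lt_irrefl _ h), if_pos h]

lemma fermiFactor_of_gt (h : r j < r i) : fermiFactor r b j i = 1 := by
  rw [fermiFactor, if_neg (by rintro rfl; exact lt_irrefl _ h), if_neg h.not_gt]

lemma fermiFactor_eq_pauliZ_or_one (h : i ≠ j) (c : Fin 2) :
    (fermiFactor r b j i = pauliZ ∧ fermiFactor r c j i = pauliZ) ∨
      (fermiFactor r b j i = 1 ∧ fermiFactor r c j i = 1) := by
  simp only [fermiFactor, if_neg h]
  split_ifs <;> simp

lemma fermiFactor_mul_fermiFactor_of_ne (h : i ≠ j) (c : Fin 2) :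
    fermiFactor r b j i * fermiFactor r c j i = 1 := by
  obtain ⟨hb, hc⟩ | ⟨hb, hc⟩ := fermiFactor_eq_pauliZ_or_one (r := r) (b := b) h c <;>
    simp [hb, hc, pauliZ_mul_self]

lemma conjTranspose_fermiFactor : (fermiFactor r b j i)ᴴ = fermiFactor r (1 - b) j i := by
  unfold fermiFactor
  split_ifs <;> simp [conjTranspose_pauliZ]

end FermiFactor

variable [Fintype ι]

/-- The fermionic creation (`b = 1`) and annihilation (`b = 0`) operators of the Jordan–Wigner
representation, the sites being ordered by their rank `r`. -/
def fermi (r : ι → ℕ) (b : Fin 2) (j : ι) : Matrix (ι → Fin 2) (ι → Fin 2) ℂ :=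
  tensorProduct (fermiFactor r b j)

variable {r : ι → ℕ}

lemma conjTranspose_fermi (b : Fin 2) (j : ι) : (fermi r b j)ᴴ = fermi r (1 - b) j := by
  simp only [fermi, conjTranspose_tensorProduct, conjTranspose_fermiFactor]

lemma transpose_fermi (b : Fin 2) (j : ι) : (fermi r b j)ᵀ = fermi r (1 - b) j := by
  rw [fermi, transpose_tensorProduct, fermi]
  congr 1
  funext i
  unfold fermiFactor
  split_ifs <;> simp [pauliZ]

lemma fermi_anticomm_of_lt {i j : ι} (h : r i < r j) (b c : Fin 2) :
    fermi r b i * fermi r c j + fermi r c j * fermi r b i = 0 := by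
  simp only [fermi, tensorProduct_mul]
  set C : ι → Matrix (Fin 2) (Fin 2) ℂ :=
    Function.update (fun k => fermiFactor r b i k * fermiFactor r c j k) i 0
  rw [tensorProduct_add_tensorProduct (C := C) (j := i), tensorProduct_eq_zero (j := i)]
  · simp [C]
  · simp only [C, Function.update_self, fermiFactor_self, fermiFactor_of_lt h]
    rw [add_comm, pauliZ_mul_single_add_single_mul_pauliZ]
  · intro k hk
    simp [C, hk]
  · intro k hk
    simp only [C, Function.update_of_ne hk]
    obtain rfl | hkj := eq_or_ne k j
    · simp only [fermiFactor_of_gt h, one_mul, mul_one]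
    · simp only [fermiFactor, if_neg hk, if_neg hkj]
      split_ifs <;> simp

lemma fermi_anticomm (hr : Function.Injective r) {i j : ι} (h : i ≠ j) (b c : Fin 2) :
    fermi r b i * fermi r c j + fermi r c j * fermi r b i = 0 := by
  rcases lt_or_gt_of_ne (hr.ne h) with hlt | hlt
  · exact fermi_anticomm_of_lt hlt b c
  · rw [add_comm]
    exact fermi_anticomm_of_lt hlt c b

lemma fermi_mul_fermi_self (b : Fin 2) (j : ι) : fermi r b j * fermi r b j = 0 := by
  rw [fermi, tensorProduct_mul, tensorProduct_eq_zero (j := j)]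
  rw [fermiFactor_self]
  exact single_mul_single_of_ne _ _ _ _ (by fin_cases b <;> decide) _

lemma fermi_zero_mul_fermi_one_add (j : ι) :
    fermi r 0 j * fermi r 1 j + fermi r 1 j * fermi r 0 j = 1 := by
  simp only [fermi, tensorProduct_mul]
  rw [← tensorProduct_one]
  refine tensorProduct_add_tensorProduct (j := j) ?_
    (fun i hi => fermiFactor_mul_fermiFactor_of_ne hi 1)
    (fun i hi => fermiFactor_mul_fermiFactor_of_ne hi 0)
  simp only [fermiFactor_self]
  ext x y
  fin_cases x <;> fin_cases y <;> simp [single, Matrix.mul_apply]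

variable (r)

/-- The creation operator `∑ j, v j c_j†` of the orbital `v`. -/
def create : (ι → ℂ) →ₗ[ℂ] Matrix (ι → Fin 2) (ι → Fin 2) ℂ :=
  Fintype.linearCombination ℂ (fermi r 1)

variable {r}

lemma create_apply (v : ι → ℂ) : create r v = ∑ j, v j • fermi r 1 j := rfl

lemma create_single (j : ι) : create r (Pi.single j 1) = fermi r 1 j := by
  rw [create, Fintype.linearCombination_apply_single, one_smul]

lemma conjTranspose_create (v : ι → ℂ) : (create r v)ᴴ = ∑ j, star (v j) • fermi r 0 j := by
  simp [create_apply, conjTranspose_sum, conjTranspose_smul, conjTranspose_fermi]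

lemma transpose_create (v : ι → ℂ) : (create r v)ᵀ = (create r (star v))ᴴ := by
  rw [conjTranspose_create]
  simp [create_apply, transpose_sum, transpose_fermi]

lemma conjTranspose_create_mul_create_add (hr : Function.Injective r) (v w : ι → ℂ) :
    (create r v)ᴴ * create r w + create r w * (create r v)ᴴ = (star v ⬝ᵥ w) • 1 := by
  rw [conjTranspose_create, create_apply, Finset.sum_mul_sum, Finset.sum_mul_sum,
    Finset.sum_comm (f := fun i j => w i • fermi r 1 i * star (v j) • fermi r 0 j),
    ← Finset.sum_add_distrib, dotProduct, Finset.sum_smul]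
  refine Finset.sum_congr rfl fun i _ => ?_
  simp only [← Finset.sum_add_distrib, smul_mul_smul_comm, mul_comm (w _), ← smul_add]
  rw [Finset.sum_eq_single i (fun j _ hj => by rw [fermi_anticomm hr hj.symm, smul_zero])
    (by simp), fermi_zero_mul_fermi_one_add, Pi.star_apply]

lemma create_mul_create_add (hr : Function.Injective r) (v w : ι → ℂ) :
    create r v * create r w + create r w * create r v = 0 := by
  have h_anticomm (i j : ι) : fermi r 1 i * fermi r 1 j + fermi r 1 j * fermi r 1 i = 0 := by
    obtain rfl | h := eq_or_ne i j
    · rw [fermi_mul_fermi_self, add_zero]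
    · exact fermi_anticomm hr h 1 1
  rw [create_apply, create_apply, Finset.sum_mul_sum, Finset.sum_mul_sum,
    Finset.sum_comm (f := fun i j => w i • fermi r 1 i * v j • fermi r 1 j)]
  simp only [← Finset.sum_add_distrib, smul_mul_smul_comm, mul_comm (w _), ← smul_add,
    h_anticomm, smul_zero, Finset.sum_const_zero]

lemma create_mul_self (hr : Function.Injective r) (v : ι → ℂ) : create r v * create r v = 0 := by
  have h := create_mul_create_add hr v v
  rwa [← two_smul ℂ, smul_eq_zero_iff_right two_ne_zero] at h

lemma opNorm_create_sq_le (hr : Function.Injective r) (v : ι → ℂ) :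
    ‖create r v‖ ^ 2 ≤ ∑ j, ‖v j‖ ^ 2 := by
  set N := (create r v)ᴴ * create r v
  have h_mul : N * (create r v * (create r v)ᴴ) = 0 := by
    rw [Matrix.mul_assoc, ← Matrix.mul_assoc (create r v), create_mul_self hr, Matrix.zero_mul,
      Matrix.mul_zero]
  have h_sq : Nᴴ * N = (star v ⬝ᵥ v) • N := by
    calc Nᴴ * N = N * (N + create r v * (create r v)ᴴ) := by
          rw [(isHermitian_conjTranspose_mul_self _).eq, mul_add, h_mul, add_zero]
      _ = (star v ⬝ᵥ v) • N := by
          rw [conjTranspose_create_mul_create_add hr, mul_smul_comm, mul_one]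
  have h_norm := congrArg norm h_sq
  rw [l2_opNorm_conjTranspose_mul_self, norm_smul, star_dotProduct_self, Complex.norm_real,
    Real.norm_of_nonneg (by positivity), l2_opNorm_conjTranspose_mul_self, ← sq] at h_norm
  obtain h_zero | h_pos := (norm_nonneg (create r v)).eq_or_lt
  · rw [← h_zero, zero_pow two_ne_zero]
    positivity
  · exact (mul_right_cancel₀ (pow_pos h_pos 2).ne' (by linarith [h_norm])).le

variable (ι) in
/-- The state without particles. -/
def vacuum : (ι → Fin 2) → ℂ := fun x => ∏ i, (Pi.single 0 1 : Fin 2 → ℂ) (x i)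

lemma fermi_zero_mulVec_vacuum (j : ι) : fermi r 0 j *ᵥ vacuum ι = 0 := by
  refine (tensorProduct_mulVec _ fun _ => Pi.single 0 1).trans ?_
  funext x
  refine Finset.prod_eq_zero (Finset.mem_univ j) ?_
  simp [fermiFactor_self]

lemma conjTranspose_create_mulVec_vacuum (v : ι → ℂ) : (create r v)ᴴ *ᵥ vacuum ι = 0 := by
  simp [conjTranspose_create, sum_mulVec, smul_mulVec, fermi_zero_mulVec_vacuum]

end JordanWigner

section Orthogonal

lemma opNorm_add_eq_max {m n : Type*} [Fintype m] [Fintype n] [DecidableEq n]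
    {X Y : Matrix m n ℂ} (hXY : Xᴴ * Y = 0) (hXY' : X * Yᴴ = 0) :
    ‖X + Y‖ = max ‖X‖ ‖Y‖ := by
  let _ : CStarAlgebra (Matrix n n ℂ) := { }
  have hYX : Yᴴ * X = 0 := by simpa using congrArg conjTranspose hXY
  have h_gram : (X + Y)ᴴ * (X + Y) = Xᴴ * X + Yᴴ * Y := by
    rw [conjTranspose_add, Matrix.add_mul, Matrix.mul_add, Matrix.mul_add, hXY, hYX, add_zero,
      zero_add]
  have h_mul : Xᴴ * X * (Yᴴ * Y) = 0 := by
    rw [Matrix.mul_assoc, ← Matrix.mul_assoc X, hXY', Matrix.zero_mul, Matrix.mul_zero]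
  have h_sq : ‖X + Y‖ ^ 2 = max (‖X‖ ^ 2) (‖Y‖ ^ 2) := by
    simp only [sq, ← l2_opNorm_conjTranspose_mul_self, h_gram]
    exact IsSelfAdjoint.norm_add_eq_max (isHermitian_conjTranspose_mul_self X)
      (isHermitian_conjTranspose_mul_self Y) h_mul
  rw [← (pow_left_monotoneOn (M₀ := ℝ) (n := 2)).map_max (norm_nonneg X) (norm_nonneg Y)] at h_sq
  exact (pow_left_inj₀ (norm_nonneg _) (by positivity) two_ne_zero).1 h_sq

lemma opNorm_mul_add_mul_mul_le {m n : Type*} [Fintype m] [DecidableEq m] [Fintype n]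
    [DecidableEq n] {A Z : Matrix m m ℂ} {M : Matrix m n ℂ} {B : Matrix n n ℂ} {c : ℝ}
    (hZ : Z ∈ unitaryGroup m ℂ) (hAZ : Aᴴ * Z = -(Z * Aᴴ)) (hAM : Aᴴ * M = 0) (hMB : M * Bᴴ = 0)
    (hA : ‖A‖ ≤ c) (hB : ‖B‖ ≤ c) :
    ‖A * M + Z * M * B‖ ≤ c * ‖M‖ := by
  have h_left : (A * M)ᴴ * (Z * M * B) = 0 := by
    calc (A * M)ᴴ * (Z * M * B) = Mᴴ * (Aᴴ * Z) * M * B := by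
          simp only [conjTranspose_mul, Matrix.mul_assoc]
      _ = -(Mᴴ * Z * (Aᴴ * M) * B) := by
          simp only [hAZ, Matrix.mul_assoc, Matrix.neg_mul, Matrix.mul_neg]
      _ = 0 := by rw [hAM, Matrix.mul_zero, Matrix.zero_mul, neg_zero]
  have h_right : A * M * (Z * M * B)ᴴ = 0 := by
    calc A * M * (Z * M * B)ᴴ = A * (M * Bᴴ) * (Z * M)ᴴ := by
          simp only [conjTranspose_mul, Matrix.mul_assoc]
      _ = 0 := by rw [hMB, Matrix.mul_zero, Matrix.zero_mul]
  rw [opNorm_add_eq_max h_left h_right, max_le_iff, Matrix.mul_assoc Z, opNorm_unitary_mul hZ]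
  exact ⟨(l2_opNorm_mul _ _).trans (by gcongr),
    (l2_opNorm_mul _ _).trans ((by gcongr : ‖M‖ * ‖B‖ ≤ ‖M‖ * c).trans_eq (mul_comm _ _))⟩

end Orthogonal

section Bipartition

/-- The parity of the number of particles, a diagonal matrix. -/
def parity (ι : Type*) [Fintype ι] : Matrix (ι → Fin 2) (ι → Fin 2) ℂ :=
  tensorProduct fun _ => pauliZ

section Parity

variable {ι : Type*} [Fintype ι] [DecidableEq ι]

lemma parity_mul_self : parity ι * parity ι = 1 := by
  simp only [parity, tensorProduct_mul, pauliZ_mul_self, tensorProduct_one]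

lemma parity_mem_unitaryGroup : parity ι ∈ unitaryGroup (ι → Fin 2) ℂ := by
  rw [mem_unitaryGroup_iff, star_eq_conjTranspose, parity, conjTranspose_tensorProduct]
  simp only [conjTranspose_pauliZ]
  exact parity_mul_self

lemma parity_mul_fermi_add (r : ι → ℕ) (b : Fin 2) (j : ι) :
    parity ι * fermi r b j + fermi r b j * parity ι = 0 := by
  simp only [parity, fermi, tensorProduct_mul]
  rw [tensorProduct_add_tensorProduct (j := j)
    (C := Function.update (fun i => pauliZ * fermiFactor r b j i) j 0),
    tensorProduct_eq_zero (j := j) (Function.update_self _ _ _)]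
  · rw [Function.update_self, fermiFactor_self, pauliZ_mul_single_add_single_mul_pauliZ]
  · intro i hi
    rw [Function.update_of_ne hi]
  · intro i hi
    rw [Function.update_of_ne hi]
    simp only [fermiFactor, if_neg hi]
    split_ifs <;> simp

lemma parity_mul_conjTranspose_create (r : ι → ℕ) (v : ι → ℂ) :
    parity ι * (create r v)ᴴ = -((create r v)ᴴ * parity ι) := by
  rw [eq_neg_iff_add_eq_zero, conjTranspose_create]
  simp only [Matrix.mul_sum, Matrix.sum_mul, Matrix.mul_smul, Matrix.smul_mul,
    ← Finset.sum_add_distrib, ← smul_add, parity_mul_fermi_add, smul_zero, Finset.sum_const_zero]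

end Parity

variable {L : Type} [Fintype L] [DecidableEq L] {r : L → ℕ} {I : Finset L}

lemma reshape_fermi_mulVec_of_mem (hI : ∀ i ∈ I, ∀ j, j ∉ I → r i < r j) (b : Fin 2)
    (j : {j // j ∈ I}) (ψ : Config (fun _ : L => 2) → ℂ) :
    reshape I (fermi r b j *ᵥ ψ) = fermi (fun i : {j // j ∈ I} => r i) b j * reshape I ψ := by
  have h_in : (fun i : {j // j ∈ I} => fermiFactor r b j i) =
      fermiFactor (fun i : {j // j ∈ I} => r i) b j := by
    funext i
    simp only [fermiFactor, Subtype.ext_iff]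
  have h_out (i : {j // j ∉ I}) : fermiFactor r b j i = 1 :=
    fermiFactor_of_gt (hI j j.2 i i.2)
  rw [fermi, reshape_tensorProduct_mulVec, h_in]
  simp only [h_out, tensorProduct_one, transpose_one, Matrix.mul_one]
  rfl

lemma reshape_fermi_mulVec_of_notMem (hI : ∀ i ∈ I, ∀ j, j ∉ I → r i < r j) (b : Fin 2)
    (j : {j // j ∉ I}) (ψ : Config (fun _ : L => 2) → ℂ) :
    reshape I (fermi r b j *ᵥ ψ) =
      parity {j // j ∈ I} * reshape I ψ * (fermi (fun i : {j // j ∉ I} => r i) b j)ᵀ := by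
  have h_out : (fun i : {j // j ∉ I} => fermiFactor r b j i) =
      fermiFactor (fun i : {j // j ∉ I} => r i) b j := by
    funext i
    simp only [fermiFactor, Subtype.ext_iff]
  have h_in (i : {j // j ∈ I}) : fermiFactor r b j i = pauliZ :=
    fermiFactor_of_lt (hI i i.2 j j.2)
  rw [fermi, reshape_tensorProduct_mulVec, h_out]
  simp only [h_in]
  rfl

lemma reshape_sum_fermi_mulVec (hI : ∀ i ∈ I, ∀ j, j ∉ I → r i < r j) (b : Fin 2) (v : L → ℂ)
    (ψ : Config (fun _ : L => 2) → ℂ) :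
    reshape I ((∑ j, v j • fermi r b j) *ᵥ ψ) =
      (∑ j : {j // j ∈ I}, v j • fermi (fun i : {j // j ∈ I} => r i) b j) * reshape I ψ +
      parity {j // j ∈ I} * reshape I ψ *
        (∑ j : {j // j ∉ I}, v j • fermi (fun i : {j // j ∉ I} => r i) b j)ᵀ := by
  simp only [sum_mulVec, smul_mulVec, map_sum, map_smul, Matrix.sum_mul, transpose_sum,
    Matrix.mul_sum, transpose_smul, Matrix.smul_mul, Matrix.mul_smul,
    ← reshape_fermi_mulVec_of_mem hI, ← reshape_fermi_mulVec_of_notMem hI]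
  rw [← Fintype.sum_subtype_add_sum_subtype (· ∈ I)]
  congr 1
  exact Finset.sum_congr (by ext; simp) fun j _ => rfl

lemma reshape_create_mulVec (hI : ∀ i ∈ I, ∀ j, j ∉ I → r i < r j) (v : L → ℂ)
    (ψ : Config (fun _ : L => 2) → ℂ) :
    reshape I (create r v *ᵥ ψ) =
      create (fun i : {j // j ∈ I} => r i) (fun j => v j) * reshape I ψ +
      parity {j // j ∈ I} * reshape I ψ *
        (create (fun i : {j // j ∉ I} => r i) (fun j => v j))ᵀ :=
  reshape_sum_fermi_mulVec hI 1 v ψ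

lemma reshape_conjTranspose_create_mulVec (hI : ∀ i ∈ I, ∀ j, j ∉ I → r i < r j) (v : L → ℂ)
    (ψ : Config (fun _ : L => 2) → ℂ) :
    reshape I ((create r v)ᴴ *ᵥ ψ) =
      (create (fun i : {j // j ∈ I} => r i) (fun j => v j))ᴴ * reshape I ψ +
      parity {j // j ∈ I} * reshape I ψ *
        ((create (fun i : {j // j ∉ I} => r i) (fun j => v j))ᴴ)ᵀ := by
  simp only [conjTranspose_create]
  exact reshape_sum_fermi_mulVec hI 0 (fun j => star (v j)) ψ

lemma conjTranspose_create_mul_reshape_eq_zero (hI : ∀ i ∈ I, ∀ j, j ∉ I → r i < r j)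
    {v : L → ℂ} {ψ : Config (fun _ : L => 2) → ℂ}
    (hψ : (create r (fun j => if j ∈ I then v j else 0))ᴴ *ᵥ ψ = 0) :
    (create (fun i : {j // j ∈ I} => r i) (fun j => v j))ᴴ * reshape I ψ = 0 := by
  have h := reshape_conjTranspose_create_mulVec hI (fun j => if j ∈ I then v j else 0) ψ
  have h_in : (fun j : {j // j ∈ I} => if (j : L) ∈ I then v j else 0) =
      fun j : {j // j ∈ I} => v j := funext fun j => if_pos j.2
  have h_out : (fun j : {j // j ∉ I} => if (j : L) ∈ I then v j else 0) = 0 :=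
    funext fun j => if_neg j.2
  rw [hψ, map_zero, h_in, h_out, map_zero, conjTranspose_zero, transpose_zero, Matrix.mul_zero,
    add_zero] at h
  exact h.symm

lemma reshape_mul_transpose_conjTranspose_create_eq_zero
    (hI : ∀ i ∈ I, ∀ j, j ∉ I → r i < r j) {v : L → ℂ} {ψ : Config (fun _ : L => 2) → ℂ}
    (hψ : (create r (fun j => if j ∈ I then 0 else v j))ᴴ *ᵥ ψ = 0) :
    reshape I ψ * ((create (fun i : {j // j ∉ I} => r i) (fun j => v j))ᴴ)ᵀ = 0 := by
  have h := reshape_conjTranspose_create_mulVec hI (fun j => if j ∈ I then 0 else v j) ψ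
  have h_in : (fun j : {j // j ∈ I} => if (j : L) ∈ I then 0 else v j) = 0 :=
    funext fun j => if_pos j.2
  have h_out : (fun j : {j // j ∉ I} => if (j : L) ∈ I then 0 else v j) =
      fun j : {j // j ∉ I} => v j := funext fun j => if_neg j.2
  rw [hψ, map_zero, h_in, h_out, map_zero, conjTranspose_zero, Matrix.zero_mul, zero_add,
    Matrix.mul_assoc] at h
  have h' := congrArg (parity {j // j ∈ I} * ·) h.symm
  simpa only [← Matrix.mul_assoc, parity_mul_self, Matrix.one_mul, Matrix.mul_zero] using h'

/-- The contributions of the two sides of the cut are orthogonal, so their norms do not add up. -/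
lemma opNorm_reshape_create_mulVec_le (hr : Function.Injective r)
    (hI : ∀ i ∈ I, ∀ j, j ∉ I → r i < r j) {v : L → ℂ} {ψ : Config (fun _ : L => 2) → ℂ}
    (hψ : (create r (fun j => if j ∈ I then v j else 0))ᴴ *ᵥ ψ = 0)
    (hψ' : (create r (fun j => if j ∈ I then 0 else v j))ᴴ *ᵥ ψ = 0) {c : ℝ} (hc : 0 ≤ c)
    (hin : ∑ j ∈ I, ‖v j‖ ^ 2 ≤ c ^ 2) (hout : ∑ j ∈ Iᶜ, ‖v j‖ ^ 2 ≤ c ^ 2) :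
    ‖reshape I (create r v *ᵥ ψ)‖ ≤ c * ‖reshape I ψ‖ := by
  rw [reshape_create_mulVec hI]
  refine opNorm_mul_add_mul_mul_le parity_mem_unitaryGroup
    (by rw [parity_mul_conjTranspose_create, neg_neg])
    (conjTranspose_create_mul_reshape_eq_zero hI hψ)
    (reshape_mul_transpose_conjTranspose_create_eq_zero hI hψ')
    (le_of_sq_le_sq ((opNorm_create_sq_le (hr.comp Subtype.val_injective) _).trans ?_) hc) ?_
  · rwa [← Finset.sum_subtype I (fun _ => Iff.rfl) fun j => ‖v j‖ ^ 2]
  · rw [transpose_create, l2_opNorm_conjTranspose]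
    refine le_of_sq_le_sq ((opNorm_create_sq_le (hr.comp Subtype.val_injective) _).trans ?_) hc
    simpa only [Pi.star_apply, norm_star,
      ← Finset.sum_subtype Iᶜ (fun _ => Finset.mem_compl) fun j => ‖v j‖ ^ 2] using hout

end Bipartition

section Slater

variable {ι : Type*} [Fintype ι] [DecidableEq ι] {r : ι → ℕ}

/-- The Slater determinant with particles in the orbitals `v 0, …, v (n - 1)`. Creation operators
square to zero, so by the universal property of the exterior algebra it is an alternating function
of the orbitals. -/
noncomputable def slater (hr : Function.Injective r) (n : ℕ) :
    (ι → ℂ) [⋀^Fin n]→ₗ[ℂ] ((ι → Fin 2) → ℂ) :=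
  ((LinearMap.flip (mulVecBilin ℂ ℂ) (vacuum ι)).comp
    (ExteriorAlgebra.lift ℂ ⟨create r, create_mul_self hr⟩).toLinearMap).compAlternatingMap
      (ExteriorAlgebra.ιMulti ℂ n)

lemma slater_zero (hr : Function.Injective r) (v : Fin 0 → ι → ℂ) :
    slater hr 0 v = vacuum ι := by
  change (ExteriorAlgebra.lift ℂ ⟨create r, create_mul_self hr⟩ (ExteriorAlgebra.ιMulti ℂ 0 v))
    *ᵥ vacuum ι = _
  rw [ExteriorAlgebra.ιMulti_zero_apply, map_one, one_mulVec]

lemma slater_succ (hr : Function.Injective r) (n : ℕ) (v : Fin (n + 1) → ι → ℂ) :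
    slater hr (n + 1) v = create r (v 0) *ᵥ slater hr n (fun k => v k.succ) := by
  change (ExteriorAlgebra.lift ℂ ⟨create r, create_mul_self hr⟩
    (ExteriorAlgebra.ιMulti ℂ (n + 1) v)) *ᵥ vacuum ι = create r (v 0) *ᵥ
      ((ExteriorAlgebra.lift ℂ ⟨create r, create_mul_self hr⟩
        (ExteriorAlgebra.ιMulti ℂ n fun k => v k.succ)) *ᵥ vacuum ι)
  rw [ExteriorAlgebra.ιMulti_succ_apply, map_mul, ExteriorAlgebra.lift_ι_apply, mulVec_mulVec]
  rfl

lemma slater_linearCombination (hr : Function.Injective r) {n : ℕ} (u : Fin n → ι → ℂ)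
    (W : Matrix (Fin n) (Fin n) ℂ) :
    slater hr n (fun k => ∑ l, W k l • u l) = W.det • slater hr n u := by
  funext x
  let T : (Fin n → ℂ) →ₗ[ℂ] (ι → ℂ) := Fintype.linearCombination ℂ u
  let g : (Fin n → ℂ) [⋀^Fin n]→ₗ[ℂ] ℂ :=
    (LinearMap.proj x).compAlternatingMap ((slater hr n).compLinearMap T)
  have h_basis : g (Pi.basisFun ℂ (Fin n)) = slater hr n u x := by
    change slater hr n (fun k => T (Pi.basisFun ℂ (Fin n) k)) x = _
    simp [T]
  calc g W = g (Pi.basisFun ℂ (Fin n)) * (Pi.basisFun ℂ (Fin n)).det W :=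
        congrArg (fun f => f W) (g.eq_smul_basis_det (Pi.basisFun ℂ (Fin n)))
    _ = W.det * slater hr n u x := by rw [h_basis, Pi.basisFun_det, mul_comm]; rfl

lemma conjTranspose_create_mulVec_slater (hr : Function.Injective r) (w : ι → ℂ) {n : ℕ}
    (v : Fin n → ι → ℂ) (h : ∀ k, star w ⬝ᵥ v k = 0) :
    (create r w)ᴴ *ᵥ slater hr n v = 0 := by
  induction n with
  | zero => rw [slater_zero, conjTranspose_create_mulVec_vacuum]
  | succ n ih =>
    have h_anticomm := conjTranspose_create_mul_create_add hr w (v 0)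
    rw [h 0, zero_smul, add_eq_zero_iff_eq_neg] at h_anticomm
    rw [slater_succ, mulVec_mulVec, h_anticomm, neg_mulVec, ← mulVec_mulVec, ih _ fun k => h k.succ,
      mulVec_zero, neg_zero]

end Slater

section ReshapeSlater

variable {L : Type} [Fintype L] [DecidableEq L] {r : L → ℕ}

omit [DecidableEq L] in
lemma isProductState_vacuum : IsProductState (d := fun _ : L => 2) (vacuum L) :=
  ⟨fun _ => Pi.single 0 1, fun _ => sum_norm_sq_single_one 0, fun _ => rfl⟩

lemma opNorm_reshape_slater_le (hr : Function.Injective r) {I : Finset L}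
    (hI : ∀ i ∈ I, ∀ j, j ∉ I → r i < r j) {n : ℕ} (v : Fin n → L → ℂ)
    (horth : ∀ k l, k ≠ l → ∑ j ∈ I, star (v k j) * v l j = 0)
    (horth' : ∀ k l, k ≠ l → ∑ j ∈ Iᶜ, star (v k j) * v l j = 0)
    {c : Fin n → ℝ} (hc : ∀ k, 0 ≤ c k)
    (hin : ∀ k, ∑ j ∈ I, ‖v k j‖ ^ 2 ≤ c k ^ 2) (hout : ∀ k, ∑ j ∈ Iᶜ, ‖v k j‖ ^ 2 ≤ c k ^ 2) :
    ‖reshape (d := fun _ : L => 2) I (slater hr n v)‖ ≤ ∏ k, c k := by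
  induction n with
  | zero =>
    rw [slater_zero, Finset.univ_eq_empty, Finset.prod_empty]
    exact isProductState_vacuum.opNorm_reshape_le_one I
  | succ n ih =>
    rw [slater_succ, Fin.prod_univ_succ]
    refine (opNorm_reshape_create_mulVec_le hr hI ?_ ?_ (hc 0) (hin 0) (hout 0)).trans ?_
    · refine conjTranspose_create_mulVec_slater hr _ _ fun k => ?_
      refine Eq.trans ?_ (horth 0 k.succ (Fin.succ_ne_zero k).symm)
      simp [dotProduct, apply_ite star, ite_mul]
    · refine conjTranspose_create_mulVec_slater hr _ _ fun k => ?_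
      refine Eq.trans ?_ (horth' 0 k.succ (Fin.succ_ne_zero k).symm)
      simp [dotProduct, apply_ite star, ite_mul, Finset.sum_ite, Finset.compl_eq_univ_sdiff,
        Finset.filter_notMem_eq_sdiff]
    · refine mul_le_mul_of_nonneg_left ?_ (hc 0)
      exact ih _ (fun k l hkl => horth _ _ (by simpa using hkl))
        (fun k l hkl => horth' _ _ (by simpa using hkl)) (fun k => hc _) (fun k => hin _)
        (fun k => hout _)

lemma pauliZ_mulVec_single_zero : pauliZ *ᵥ Pi.single 0 1 = Pi.single 0 1 := by
  ext a
  fin_cases a <;> simp [pauliZ]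

omit [Fintype L] in
lemma fermiFactor_mulVec_single_zero_of_ne {i j : L} (h : i ≠ j) (b : Fin 2) :
    fermiFactor r b j i *ᵥ Pi.single 0 1 = Pi.single 0 1 := by
  obtain ⟨h_eq, -⟩ | ⟨h_eq, -⟩ := fermiFactor_eq_pauliZ_or_one (r := r) (b := b) h b <;>
    simp only [h_eq, pauliZ_mulVec_single_zero, one_mulVec]

omit [Fintype L] in
lemma fermiFactor_mem_unitaryGroup {i j : L} (h : i ≠ j) (b : Fin 2) :
    fermiFactor r b j i ∈ unitaryGroup (Fin 2) ℂ := by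
  rw [mem_unitaryGroup_iff, star_eq_conjTranspose, conjTranspose_fermiFactor,
    fermiFactor_mul_fermiFactor_of_ne h]

lemma exists_slater_single_eq_prod (hr : Function.Injective r) {n : ℕ} {y : Fin n → L}
    (hy : Function.Injective y) :
    ∃ φ : L → Fin 2 → ℂ, (∀ j, ∑ a, ‖φ j a‖ ^ 2 = 1) ∧
      (∀ j, (∀ k, y k ≠ j) → φ j = Pi.single 0 1) ∧
      slater hr n (fun k => Pi.single (y k) 1) = fun x => ∏ j, φ j (x j) := by
  induction n with
  | zero =>
    exact ⟨fun _ => Pi.single 0 1, fun _ => sum_norm_sq_single_one 0, fun _ _ => rfl,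
      slater_zero hr _⟩
  | succ n ih =>
    obtain ⟨φ, hφ, h_empty, h_slater⟩ := ih (hy.comp (Fin.succ_injective n))
    have h_new : φ (y 0) = Pi.single 0 1 :=
      h_empty (y 0) fun k => hy.ne (Fin.succ_ne_zero k)
    refine ⟨fun j => fermiFactor r 1 (y 0) j *ᵥ φ j, fun j => ?_, fun j hj => ?_, ?_⟩
    · obtain rfl | hj := eq_or_ne j (y 0)
      · simp [h_new, fermiFactor_self]
      · rw [sum_norm_sq_unitary_mulVec (fermiFactor_mem_unitaryGroup hj 1), hφ]
    · change fermiFactor r 1 (y 0) j *ᵥ φ j = _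
      rw [h_empty j fun k => hj k.succ, fermiFactor_mulVec_single_zero_of_ne (hj 0).symm]
    · rw [slater_succ, create_single]
      exact (congrArg (fermi r 1 (y 0) *ᵥ ·) h_slater).trans (tensorProduct_mulVec _ φ)

lemma isProductState_slater_single (hr : Function.Injective r) {n : ℕ} {y : Fin n → L}
    (hy : Function.Injective y) :
    IsProductState (d := fun _ : L => 2) (slater hr n fun k => Pi.single (y k) 1) := by
  obtain ⟨φ, hφ, -, h_slater⟩ := exists_slater_single_eq_prod hr hy
  exact ⟨φ, hφ, congrFun h_slater⟩

end ReshapeSlater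

section SecondQuantization

variable {ι : Type*} [Fintype ι] [DecidableEq ι] {r : ι → ℕ}

variable (r) in
/-- The second quantization of the one-particle operator `h`, the Hamiltonian of non-interacting
particles each of which evolves under `h`. -/
noncomputable def secondQuantize (h : Matrix ι ι ℂ) : Matrix (ι → Fin 2) (ι → Fin 2) ℂ :=
  ∑ i, ∑ j, h i j • (fermi r 1 i * fermi r 0 j)

lemma fermi_one_mul_create (hr : Function.Injective r) (j : ι) (v : ι → ℂ) :
    fermi r 1 j * create r v = -(create r v * fermi r 1 j) := by
  rw [← create_single, eq_neg_iff_add_eq_zero, create_mul_create_add hr]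

lemma fermi_zero_mul_create (hr : Function.Injective r) (j : ι) (v : ι → ℂ) :
    fermi r 0 j * create r v = v j • 1 - create r v * fermi r 0 j := by
  have h := conjTranspose_create_mul_create_add hr (Pi.single j 1) v
  rw [create_single, conjTranspose_fermi, sub_self, ← Pi.single_star, star_one,
    single_one_dotProduct] at h
  exact eq_sub_of_add_eq h

lemma secondQuantize_mul_create (hr : Function.Injective r) (h : Matrix ι ι ℂ) (v : ι → ℂ) :
    secondQuantize r h * create r v = create r v * secondQuantize r h + create r (h *ᵥ v) := by
  have h_hop (i j : ι) : fermi r 1 i * fermi r 0 j * create r v =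
      create r v * (fermi r 1 i * fermi r 0 j) + v j • fermi r 1 i := by
    rw [Matrix.mul_assoc, fermi_zero_mul_create hr, Matrix.mul_sub, ← Matrix.mul_assoc,
      fermi_one_mul_create hr, Matrix.mul_smul, Matrix.mul_one, Matrix.neg_mul, Matrix.mul_assoc]
    abel
  simp only [secondQuantize, create_apply (h *ᵥ v), mulVec, dotProduct, Matrix.sum_mul,
    Matrix.mul_sum, Finset.sum_smul, ← Finset.sum_add_distrib, Matrix.smul_mul, h_hop, smul_add,
    Matrix.mul_smul, smul_smul]

lemma secondQuantize_mulVec_vacuum (h : Matrix ι ι ℂ) : secondQuantize r h *ᵥ vacuum ι = 0 := by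
  simp only [secondQuantize, sum_mulVec, smul_mulVec, ← mulVec_mulVec, fermi_zero_mulVec_vacuum,
    mulVec_zero, smul_zero, Finset.sum_const_zero]

lemma hasDerivAt_create (r : ι → ℕ) {v : ℝ → ι → ℂ} {v' : ι → ℂ} {t : ℝ}
    (hv : HasDerivAt v v' t) : HasDerivAt (fun s => create r (v s)) (create r v') t := by
  simp only [create_apply]
  exact HasDerivAt.fun_sum fun j _ => (hasDerivAt_pi.1 hv j).smul_const _

lemma unitaryEvolution_secondQuantize_mul_create (hr : Function.Injective r) (h : Matrix ι ι ℂ)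
    (v : ι → ℂ) (t : ℝ) :
    unitaryEvolution (secondQuantize r h) t * create r v =
      create r (unitaryEvolution h t *ᵥ v) * unitaryEvolution (secondQuantize r h) t := by
  have h_deriv (s : ℝ) := hasDerivAt_create r (hasDerivAt_unitaryEvolution_mulVec h v s)
  have h_create := eq_unitaryEvolution_mul_mul_of_hasDerivAt (K := secondQuantize r h)
    (K' := -secondQuantize r h) (F := fun s => create r (unitaryEvolution h s *ᵥ v))
    (fun s => by
      rw [secondQuantize_mul_create hr, Matrix.mul_neg, add_neg_cancel_comm, ← map_smul, ← map_neg]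
      exact h_deriv s) t
  rw [h_create, unitaryEvolution_zero, one_mulVec, unitaryEvolution_neg, Matrix.mul_assoc _ _
    (unitaryEvolution (secondQuantize r h) t), unitaryEvolution_neg_mul, Matrix.mul_one]

lemma unitaryEvolution_secondQuantize_mulVec_slater (hr : Function.Injective r) (h : Matrix ι ι ℂ)
    (t : ℝ) {n : ℕ} (v : Fin n → ι → ℂ) :
    unitaryEvolution (secondQuantize r h) t *ᵥ slater hr n v =
      slater hr n (fun k => unitaryEvolution h t *ᵥ v k) := by
  induction n with
  | zero =>
    have h_vacuum : secondQuantize r h *ᵥ vacuum ι = (0 : ℂ) • vacuum ι := by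
      rw [secondQuantize_mulVec_vacuum, zero_smul]
    simp [slater_zero, unitaryEvolution_mulVec_of_mulVec_eq_smul h_vacuum]
  | succ n ih =>
    rw [slater_succ, slater_succ, mulVec_mulVec, unitaryEvolution_secondQuantize_mul_create hr,
      ← mulVec_mulVec, ih]

end SecondQuantization

section RegionProjection

variable {L n : Type*} [DecidableEq L]

/-- The orthogonal projection of the one-particle space `ℂ^L` onto the orbitals supported
in `S`. -/
def regionProjection (S : Finset L) : Matrix L L ℂ :=
  diagonal fun x => if x ∈ S then 1 else 0

variable [Fintype L]

lemma regionProjection_compl (S : Finset L) :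
    regionProjection Sᶜ = 1 - regionProjection S := by
  ext x z
  by_cases hx : x ∈ S <;> by_cases hxz : x = z <;> simp_all [regionProjection]

lemma conjTranspose_mul_regionProjection_mul_apply (S : Finset L) (A : Matrix L n ℂ) (k l : n) :
    (Aᴴ * regionProjection S * A) k l = ∑ j ∈ S, star (A j k) * A j l := by
  rw [mul_apply]
  simp [regionProjection, mul_diagonal, conjTranspose_apply]

lemma isHermitian_conjTranspose_mul_regionProjection_mul (S : Finset L) (A : Matrix L n ℂ) :
    (Aᴴ * regionProjection S * A).IsHermitian := by
  ext k l
  simp [conjTranspose_apply, conjTranspose_mul_regionProjection_mul_apply, mul_comm]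

lemma trace_regionProjection_mul_mul (S T : Finset L) (C : Matrix L L ℂ) :
    (regionProjection S * C * (regionProjection T * C)).trace =
      ∑ x ∈ S, ∑ z ∈ T, C x z * C z x := by
  simp only [trace, diag_apply, mul_apply (M := _ * C), regionProjection, diagonal_mul]
  simp

variable [DecidableEq n] {W : Matrix L n ℂ} {S : Finset L} {ν : n → ℝ}

lemma sum_star_mul_eq_zero_of_eq_diagonal
    (h : Wᴴ * regionProjection S * W = diagonal fun k => (ν k : ℂ)) {k l : n} (hkl : k ≠ l) :
    ∑ j ∈ S, star (W j k) * W j l = 0 := by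
  rw [← conjTranspose_mul_regionProjection_mul_apply, h, diagonal_apply_ne _ hkl]

lemma sum_norm_sq_eq_of_eq_diagonal
    (h : Wᴴ * regionProjection S * W = diagonal fun k => (ν k : ℂ)) (k : n) :
    ∑ j ∈ S, ‖W j k‖ ^ 2 = ν k := by
  have h_diag := conjTranspose_mul_regionProjection_mul_apply S W k k
  rw [h, diagonal_apply_eq] at h_diag
  simp only [Complex.star_def, Complex.conj_mul'] at h_diag
  exact_mod_cast h_diag.symm

lemma conjTranspose_mul_regionProjection_compl_mul (hW : Wᴴ * W = 1)
    (h : Wᴴ * regionProjection S * W = diagonal fun k => (ν k : ℂ)) :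
    Wᴴ * regionProjection Sᶜ * W = diagonal fun k => ((1 - ν k : ℝ) : ℂ) := by
  rw [regionProjection_compl, Matrix.mul_sub, Matrix.sub_mul, h, Matrix.mul_one, hW,
    ← diagonal_one, diagonal_sub]
  simp

lemma sum_mul_one_sub_eq_sum_norm_sq [Fintype n] (hW : Wᴴ * W = 1)
    (h : Wᴴ * regionProjection S * W = diagonal fun k => (ν k : ℂ)) :
    ∑ k, ν k * (1 - ν k) = ∑ x ∈ S, ∑ z ∈ Sᶜ, ‖(W * Wᴴ) x z‖ ^ 2 := by
  have h_symm (x z : L) : (W * Wᴴ) z x = star ((W * Wᴴ) x z) :=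
    ((isHermitian_mul_conjTranspose_self W).apply z x).symm
  have h_trace : ((∑ k, ν k * (1 - ν k) : ℝ) : ℂ) =
      ((∑ x ∈ S, ∑ z ∈ Sᶜ, ‖(W * Wᴴ) x z‖ ^ 2 : ℝ) : ℂ) := by
    calc ((∑ k, ν k * (1 - ν k) : ℝ) : ℂ)
        = (Wᴴ * regionProjection S * W * (Wᴴ * regionProjection Sᶜ * W)).trace := by
          rw [h, conjTranspose_mul_regionProjection_compl_mul hW h, diagonal_mul_diagonal,
            trace_diagonal]
          push_cast
          rfl
      _ = (Wᴴ * (regionProjection S * (W * Wᴴ) * regionProjection Sᶜ * W)).trace := by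
          simp only [Matrix.mul_assoc]
      _ = (regionProjection S * (W * Wᴴ) * (regionProjection Sᶜ * (W * Wᴴ))).trace := by
          rw [trace_mul_comm]
          simp only [Matrix.mul_assoc]
      _ = ((∑ x ∈ S, ∑ z ∈ Sᶜ, ‖(W * Wᴴ) x z‖ ^ 2 : ℝ) : ℂ) := by
          rw [trace_regionProjection_mul_mul]
          push_cast
          exact Finset.sum_congr rfl fun x _ => Finset.sum_congr rfl fun z _ => by
            rw [h_symm x z, Complex.star_def, Complex.mul_conj']
  exact_mod_cast h_trace

end RegionProjection

section SlaterEntropy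

lemma exists_unitary_conjTranspose_mul_mul_eq_diagonal {n : Type*} [Fintype n] [DecidableEq n]
    {G : Matrix n n ℂ} (hG : G.IsHermitian) :
    ∃ E ∈ unitaryGroup n ℂ, ∃ ν : n → ℝ, Eᴴ * G * E = diagonal fun k => (ν k : ℂ) := by
  refine ⟨hG.eigenvectorUnitary, hG.eigenvectorUnitary.2, hG.eigenvalues, ?_⟩
  have := hG.conjStarAlgAut_star_eigenvectorUnitary
  rwa [Unitary.conjStarAlgAut_star_apply] at this

lemma max_le_exp_neg (ν : ℝ) : max ν (1 - ν) ≤ Real.exp (-(ν * (1 - ν))) := by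
  have := Real.add_one_le_exp (-(ν * (1 - ν)))
  refine (max_le ?_ ?_).trans this <;> nlinarith [sq_nonneg (1 - ν), sq_nonneg ν]

variable {L : Type} [Fintype L] [DecidableEq L] {r : L → ℕ}

lemma norm_sq_reshape_slater_le_exp (hr : Function.Injective r) {I : Finset L}
    (hI : ∀ i ∈ I, ∀ j, j ∉ I → r i < r j) {n : ℕ} {W : Matrix L (Fin n) ℂ} (hW : Wᴴ * W = 1)
    {ν : Fin n → ℝ} (hν : Wᴴ * regionProjection I * W = diagonal fun k => (ν k : ℂ)) :
    ‖reshape (d := fun _ : L => 2) I (slater hr n W.col)‖ ^ 2 ≤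
      Real.exp (-∑ k, ν k * (1 - ν k)) := by
  have hν' := conjTranspose_mul_regionProjection_compl_mul hW hν
  have h_in := sum_norm_sq_eq_of_eq_diagonal hν
  have h_out := sum_norm_sq_eq_of_eq_diagonal hν'
  have h_max (k : Fin n) : 0 ≤ max (ν k) (1 - ν k) :=
    le_max_of_le_left (h_in k ▸ Finset.sum_nonneg fun _ _ => by positivity)
  have h_norm := opNorm_reshape_slater_le hr hI W.col
    (fun k l hkl => sum_star_mul_eq_zero_of_eq_diagonal hν hkl)
    (fun k l hkl => sum_star_mul_eq_zero_of_eq_diagonal hν' hkl)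
    (fun k => Real.sqrt_nonneg (max (ν k) (1 - ν k)))
    (fun k => by
      rw [Real.sq_sqrt (h_max k)]
      exact (h_in k).le.trans (le_max_left _ _))
    (fun k => by
      rw [Real.sq_sqrt (h_max k)]
      exact (h_out k).le.trans (le_max_right _ _))
  calc ‖reshape (d := fun _ : L => 2) I (slater hr n W.col)‖ ^ 2
      ≤ (∏ k, √(max (ν k) (1 - ν k))) ^ 2 := by gcongr
    _ = ∏ k, max (ν k) (1 - ν k) := by simp only [← Finset.prod_pow, Real.sq_sqrt (h_max _)]
    _ ≤ ∏ k, Real.exp (-(ν k * (1 - ν k))) :=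
        Finset.prod_le_prod (fun k _ => h_max k) fun k _ => max_le_exp_neg (ν k)
    _ = Real.exp (-∑ k, ν k * (1 - ν k)) := by rw [← Real.exp_sum, Finset.sum_neg_distrib]

lemma slater_col_mul {ι : Type*} [Fintype ι] [DecidableEq ι] {r : ι → ℕ}
    (hr : Function.Injective r) {n : ℕ} (V : Matrix ι (Fin n) ℂ) (E : Matrix (Fin n) (Fin n) ℂ) :
    slater hr n (V * E).col = E.det • slater hr n V.col := by
  rw [← det_transpose, ← slater_linearCombination]
  congr 1
  ext k x
  simp [mul_apply, mul_comm]

lemma norm_det_of_mem_unitaryGroup {n : Type*} [Fintype n] [DecidableEq n] {E : Matrix n n ℂ}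
    (hE : E ∈ unitaryGroup n ℂ) : ‖E.det‖ = 1 :=
  CStarRing.norm_of_mem_unitary (det_of_mem_unitary hE)

lemma norm_sq_reshape_slater_le_exp_neg_sum_norm_sq (hr : Function.Injective r) {I : Finset L}
    (hI : ∀ i ∈ I, ∀ j, j ∉ I → r i < r j) {n : ℕ} {V : Matrix L (Fin n) ℂ} (hV : Vᴴ * V = 1) :
    ‖reshape (d := fun _ : L => 2) I (slater hr n V.col)‖ ^ 2 ≤
      Real.exp (-∑ x ∈ I, ∑ z ∈ Iᶜ, ‖(V * Vᴴ) x z‖ ^ 2) := by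
  obtain ⟨E, hE, ν, hν⟩ := exists_unitary_conjTranspose_mul_mul_eq_diagonal
    (isHermitian_conjTranspose_mul_regionProjection_mul I V)
  have hW : (V * E)ᴴ * (V * E) = 1 := by
    rw [conjTranspose_mul, Matrix.mul_assoc, ← Matrix.mul_assoc Vᴴ, hV, Matrix.one_mul]
    exact mem_unitaryGroup_iff'.1 hE
  have hW_proj : V * E * (V * E)ᴴ = V * Vᴴ := by
    rw [conjTranspose_mul, Matrix.mul_assoc, ← Matrix.mul_assoc E, ← star_eq_conjTranspose E,
      mem_unitaryGroup_iff.1 hE, Matrix.one_mul]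
  have hW_diag : (V * E)ᴴ * regionProjection I * (V * E) = diagonal fun k => (ν k : ℂ) := by
    rw [← hν, conjTranspose_mul]
    simp only [Matrix.mul_assoc]
  have h_norm := norm_sq_reshape_slater_le_exp hr hI hW hW_diag
  rwa [sum_mul_one_sub_eq_sum_norm_sq hW hW_diag, hW_proj, slater_col_mul, map_smul, norm_smul,
    norm_det_of_mem_unitaryGroup hE, one_mul] at h_norm

lemma reshape_ne_zero {d : L → ℕ} (I : Finset L) {ψ : Config d → ℂ}
    (hψ : ∑ σ, ‖ψ σ‖ ^ 2 = 1) : reshape I ψ ≠ 0 := by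
  intro h_zero
  have h_trace := trace_reshape_mul_conjTranspose_reshape I ψ ψ
  simp [h_zero, star_dotProduct_self_eq_one hψ] at h_trace

lemma sum_norm_sq_le_entanglementEntropy_slater (hr : Function.Injective r) {I : Finset L}
    (hI : ∀ i ∈ I, ∀ j, j ∉ I → r i < r j) {n : ℕ} {V : Matrix L (Fin n) ℂ} (hV : Vᴴ * V = 1)
    (h_norm : ∑ σ, ‖slater hr n V.col σ‖ ^ 2 = 1) :
    ∑ x ∈ I, ∑ z ∈ Iᶜ, ‖(V * Vᴴ) x z‖ ^ 2 ≤
      entanglementEntropy (d := fun _ => 2) I (slater hr n V.col) := by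
  set T := ∑ x ∈ I, ∑ z ∈ Iᶜ, ‖(V * Vᴴ) x z‖ ^ 2
  have hT : 0 ≤ T := by positivity
  have h_pos : 0 < ‖reshape (d := fun _ : L => 2) I (slater hr n V.col)‖ ^ 2 :=
    pow_pos (norm_pos_iff.2 (reshape_ne_zero I h_norm)) 2
  calc T ≤ T / Real.log 2 := by
        rw [le_div_iff₀ (Real.log_pos one_lt_two)]
        exact mul_le_of_le_one_right hT (by linarith [Real.log_two_lt_d9])
    _ = -Real.logb 2 (Real.exp (-T)) := by rw [Real.logb, Real.log_exp, neg_div, neg_neg]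
    _ ≤ -Real.logb 2 (‖reshape (d := fun _ : L => 2) I (slater hr n V.col)‖ ^ 2) :=
        neg_le_neg (Real.logb_le_logb_of_le one_lt_two h_pos
          (norm_sq_reshape_slater_le_exp_neg_sum_norm_sq hr hI hV))
    _ ≤ entanglementEntropy (d := fun _ => 2) I (slater hr n V.col) :=
        neg_logb_norm_sq_le_entanglementEntropy I h_norm

end SlaterEntropy

section SupportedOn

variable {L : Type} [Fintype L] [DecidableEq L] {d : L → ℕ} {X : Finset L}

lemma supportedOn_zero : SupportedOn X (0 : Matrix (Config d) (Config d) ℂ) :=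
  supportedOn_iff.2 ⟨0, fun x y => by simp⟩

lemma SupportedOn.add {A B : Matrix (Config d) (Config d) ℂ} (hA : SupportedOn X A)
    (hB : SupportedOn X B) : SupportedOn X (A + B) := by
  obtain ⟨A', hA⟩ := supportedOn_iff.1 hA
  obtain ⟨B', hB⟩ := supportedOn_iff.1 hB
  refine supportedOn_iff.2 ⟨A' + B', fun x y => ?_⟩
  rw [Matrix.add_apply, hA, hB, Matrix.add_apply]
  split_ifs <;> simp

lemma SupportedOn.sum {κ : Type*} {s : Finset κ} {A : κ → Matrix (Config d) (Config d) ℂ}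
    (hA : ∀ k ∈ s, SupportedOn X (A k)) : SupportedOn X (∑ k ∈ s, A k) :=
  Finset.sum_induction _ _ (fun _ _ => SupportedOn.add) supportedOn_zero hA

lemma supportedOn_tensorProduct {A : ∀ j, Matrix (Fin (d j)) (Fin (d j)) ℂ}
    (hA : ∀ j, j ∉ X → A j = 1) : SupportedOn (d := d) X (tensorProduct A) := by
  refine supportedOn_iff.2 ⟨tensorProduct fun j => A j, fun x y => ?_⟩
  split_ifs with h
  · rw [tensorProduct_apply, tensorProduct_apply, ← Fintype.prod_subtype_mul_prod_subtype (· ∈ X)]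
    rw [Finset.prod_eq_one (s := (Finset.univ : Finset {j // j ∉ X}))
      fun j _ => by rw [hA j j.2, h j j.2, one_apply_eq], mul_one]
    exact Finset.prod_congr (by ext; simp) fun j _ => rfl
  · push Not at h
    obtain ⟨j, hj, h_ne⟩ := h
    rw [tensorProduct_apply]
    exact Finset.prod_eq_zero (Finset.mem_univ j) (by rw [hA j hj, one_apply_ne h_ne])

end SupportedOn

section Hopping

variable {L : Type} [Fintype L] [DecidableEq L] {r : L → ℕ}

lemma opNorm_fermi_le_one (hr : Function.Injective r) (b : Fin 2) (j : L) :
    ‖fermi r b j‖ ≤ 1 := by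
  have h_one : ‖fermi r 1 j‖ ≤ 1 := by
    have h_sq := opNorm_create_sq_le hr (Pi.single j 1)
    rw [create_single, sum_norm_sq_single_one] at h_sq
    exact (sq_le_one_iff₀ (norm_nonneg _)).1 h_sq
  fin_cases b
  · rwa [← l2_opNorm_conjTranspose, conjTranspose_fermi]
  · exact h_one

/-- For consecutive sites the Jordan–Wigner strings cancel. -/
lemma supportedOn_fermi_one_mul_fermi_zero (hr : Function.Injective r) {i j : L}
    (h : r j = r i + 1 ∨ r i = r j + 1) :
    SupportedOn (d := fun _ => 2) {i, j} (fermi r 1 i * fermi r 0 j) := by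
  rw [fermi, fermi, tensorProduct_mul]
  refine supportedOn_tensorProduct fun k hk => ?_
  simp only [Finset.mem_insert, Finset.mem_singleton, not_or] at hk
  have h_between : r k < r i ↔ r k < r j := by
    have := hr.ne hk.1
    have := hr.ne hk.2
    omega
  have h_eq : fermiFactor r 1 i k = fermiFactor r 1 j k := by
    simp only [fermiFactor, if_neg hk.1, if_neg hk.2, h_between]
  rw [h_eq, fermiFactor_mul_fermiFactor_of_ne hk.2]

variable (r) (G : SimpleGraph L) [DecidableRel G.Adj]

/-- The part of the second quantization of the adjacency matrix of `G` that lives on the edge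
`X`; it vanishes unless `X` is an edge. -/
noncomputable def hoppingTerm (X : Finset L) : Matrix (L → Fin 2) (L → Fin 2) ℂ :=
  ∑ p : L × L with G.Adj p.1 p.2 ∧ ({p.1, p.2} : Finset L) = X, fermi r 1 p.1 * fermi r 0 p.2

lemma isHermitian_hoppingTerm (X : Finset L) : (hoppingTerm r G X).IsHermitian := by
  rw [IsHermitian, hoppingTerm, conjTranspose_sum]
  refine Finset.sum_equiv (Equiv.prodComm L L) (fun p => ?_) fun p _ => ?_
  · simp [G.adj_comm p.1, Finset.pair_comm p.1]
  · simp [conjTranspose_fermi]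

lemma sum_hoppingTerm : ∑ X, hoppingTerm r G X = secondQuantize r (G.adjMatrix ℂ) := by
  simp only [hoppingTerm, ← Finset.filter_filter, secondQuantize]
  rw [Finset.sum_fiberwise, Finset.sum_filter, Fintype.sum_prod_type]
  simp [SimpleGraph.adjMatrix_apply, ite_smul]

variable {r G} {X : Finset L}

lemma exists_adj_of_hoppingTerm_ne_zero (hX : hoppingTerm r G X ≠ 0) :
    ∃ i j, G.Adj i j ∧ X = {i, j} := by
  obtain ⟨p, hp, -⟩ := Finset.exists_ne_zero_of_sum_ne_zero hX
  obtain ⟨h_adj, rfl⟩ := (Finset.mem_filter.1 hp).2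
  exact ⟨p.1, p.2, h_adj, rfl⟩

lemma edist_le_one_of_hoppingTerm_ne_zero (hX : hoppingTerm r G X ≠ 0) {i j : L} (hi : i ∈ X)
    (hj : j ∈ X) : G.edist i j ≤ 1 := by
  obtain ⟨a, b, h_adj, rfl⟩ := exists_adj_of_hoppingTerm_ne_zero hX
  simp only [Finset.mem_insert, Finset.mem_singleton] at hi hj
  rcases hi with rfl | rfl <;> rcases hj with rfl | rfl
  · simp
  · exact (SimpleGraph.edist_eq_one_iff_adj.2 h_adj).le
  · exact (SimpleGraph.edist_eq_one_iff_adj.2 h_adj.symm).le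
  · simp

lemma opNorm_hoppingTerm_le (hr : Function.Injective r) (X : Finset L) :
    ‖hoppingTerm r G X‖ ≤ 4 := by
  by_cases h_zero : hoppingTerm r G X = 0
  · simp [h_zero]
  obtain ⟨a, b, -, rfl⟩ := exists_adj_of_hoppingTerm_ne_zero h_zero
  have h_subset : ({p : L × L | G.Adj p.1 p.2 ∧ ({p.1, p.2} : Finset L) = {a, b}} : Finset _) ⊆
      {a, b} ×ˢ {a, b} := fun p hp => by
    simp [← (Finset.mem_filter.1 hp).2.2]
  have h_card := (Finset.card_le_card h_subset).trans_eq (Finset.card_product _ _) |>.trans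
    (Nat.mul_le_mul Finset.card_le_two Finset.card_le_two)
  calc ‖hoppingTerm r G {a, b}‖
      ≤ ∑ p : L × L with G.Adj p.1 p.2 ∧ ({p.1, p.2} : Finset L) = {a, b}, (1 : ℝ) :=
        norm_sum_le_of_le _ fun p _ => (l2_opNorm_mul _ _).trans (mul_le_one₀
          (opNorm_fermi_le_one hr _ _) (norm_nonneg _) (opNorm_fermi_le_one hr _ _))
    _ ≤ 4 := by
        rw [Finset.sum_const, nsmul_one]
        exact_mod_cast h_card

lemma isLocalHamiltonian_secondQuantize_adjMatrix (hr : Function.Injective r)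
    (hG : ∀ i j, G.Adj i j → r j = r i + 1 ∨ r i = r j + 1) :
    IsLocalHamiltonian (d := fun _ => 2) G 1 4 (secondQuantize r (G.adjMatrix ℂ)) := by
  refine ⟨hoppingTerm r G, isHermitian_hoppingTerm r G, fun X => SupportedOn.sum fun p hp => ?_,
    fun X hX i hi j hj => ?_, opNorm_hoppingTerm_le hr, (sum_hoppingTerm r G).symm⟩
  · obtain ⟨h_adj, rfl⟩ := (Finset.mem_filter.1 hp).2
    exact supportedOn_fermi_one_mul_fermi_zero hr (hG _ _ h_adj)
  · exact_mod_cast edist_le_one_of_hoppingTerm_ne_zero hX hi hj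

end Hopping

section Chord

open ZMod

lemma mul_abs_le_norm_exp_I_mul_sub_one {x : ℝ} (hx : |x| ≤ Real.pi) :
    2 / Real.pi * |x| ≤ ‖Complex.exp (Complex.I * x) - 1‖ := by
  have h_half : |x / 2| ≤ Real.pi / 2 := by
    rw [abs_div, abs_two]
    linarith
  have h_sin := Real.mul_abs_le_abs_sin h_half
  rw [Complex.norm_exp_I_mul_ofReal_sub_one, norm_mul, Real.norm_eq_abs, Real.norm_eq_abs, abs_two]
  rw [abs_div, abs_two] at h_sin
  linarith

lemma norm_one_sub_pow_le {z : ℂ} (hz : ‖z‖ = 1) (k : ℕ) : ‖1 - z ^ k‖ ≤ k * ‖1 - z‖ := by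
  rw [← mul_neg_geom_sum, norm_mul, mul_comm]
  gcongr
  simpa [hz] using norm_sum_le (Finset.range k) fun i => z ^ i

variable {R : ℕ}

lemma abs_two_pi_mul_valMinAbs_div (n : ZMod R) :
    |2 * Real.pi * n.valMinAbs / R| = 2 * Real.pi * n.valMinAbs.natAbs / R := by
  rw [abs_div, abs_mul, abs_of_pos Real.two_pi_pos, Nat.abs_cast, Nat.cast_natAbs, Int.cast_abs]

lemma eq_natAbs_valMinAbs_or_eq_neg (n : ZMod R) :
    n = (n.valMinAbs.natAbs : ZMod R) ∨ n = -(n.valMinAbs.natAbs : ZMod R) := by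
  rcases Int.natAbs_eq n.valMinAbs with h | h
  · exact .inl (by rw [← Int.cast_natCast (R := ZMod R), ← h, coe_valMinAbs])
  · exact .inr (by rw [← Int.cast_natCast (R := ZMod R), ← Int.cast_neg, ← h, coe_valMinAbs])

variable [NeZero R]

lemma stdAddChar_eq_exp_valMinAbs (n : ZMod R) :
    stdAddChar n = Complex.exp (Complex.I * (2 * Real.pi * n.valMinAbs / R : ℝ)) := by
  conv_lhs => rw [← coe_valMinAbs n, stdAddChar_coe]
  congr 1
  push_cast
  ring

lemma le_norm_one_sub_stdAddChar (n : ZMod R) :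
    4 * (n.valMinAbs.natAbs : ℝ) / R ≤ ‖1 - stdAddChar n‖ := by
  have hR : (0 : ℝ) < R := by exact_mod_cast NeZero.pos R
  have h_half : 2 * (n.valMinAbs.natAbs : ℝ) ≤ R := by
    exact_mod_cast (by have := natAbs_valMinAbs_le n; lia : 2 * n.valMinAbs.natAbs ≤ R)
  have h_chord := mul_abs_le_norm_exp_I_mul_sub_one (x := 2 * Real.pi * n.valMinAbs / R) (by
    rw [abs_two_pi_mul_valMinAbs_div, div_le_iff₀ hR]
    nlinarith [Real.pi_pos])
  rw [norm_sub_rev, stdAddChar_eq_exp_valMinAbs]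
  refine le_of_eq_of_le ?_ h_chord
  rw [abs_two_pi_mul_valMinAbs_div]
  field_simp
  norm_num [mul_comm]

lemma norm_one_sub_stdAddChar_le (n : ZMod R) :
    ‖1 - stdAddChar n‖ ≤ 2 * Real.pi * n.valMinAbs.natAbs / R := by
  rw [norm_sub_rev, stdAddChar_eq_exp_valMinAbs, ← abs_two_pi_mul_valMinAbs_div]
  exact Real.norm_exp_I_mul_ofReal_sub_one_le

lemma norm_one_sub_stdAddChar_le_two (n : ZMod R) : ‖1 - stdAddChar n‖ ≤ 2 := by
  refine (norm_sub_le _ _).trans_eq ?_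
  rw [norm_one, AddChar.norm_apply, one_add_one_eq_two]

lemma norm_one_sub_stdAddChar_mul_le (a n : ZMod R) :
    ‖1 - stdAddChar (a * n)‖ ≤ n.valMinAbs.natAbs * ‖1 - stdAddChar a‖ := by
  have h_pow (k : ℕ) : stdAddChar (a * (k : ZMod R)) = stdAddChar a ^ k := by
    rw [← AddChar.map_nsmul_eq_pow, nsmul_eq_mul, mul_comm]
  have h_le := norm_one_sub_pow_le (AddChar.norm_apply stdAddChar a) n.valMinAbs.natAbs
  rcases eq_natAbs_valMinAbs_or_eq_neg n with h | h
  · conv_lhs => rw [h, h_pow]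
    exact h_le
  · conv_lhs => rw [h, mul_neg, AddChar.map_neg_eq_conj, h_pow, ← Complex.norm_conj, map_sub,
      map_one, Complex.conj_conj]
    exact h_le

lemma exists_norm_one_sub_stdAddChar_mul_mem_Icc {τ : ℝ} (hτ : 1 / 2 ≤ τ) (hR : 8 * τ ≤ R) :
    ∃ a : ZMod R, ‖1 - stdAddChar a‖ * τ ∈ Set.Icc (1 / 2) (Real.pi / 2) := by
  have hR_pos : (0 : ℝ) < R := by linarith
  have : 0 < τ := by linarith
  obtain ⟨a, ha_le, ha_ge⟩ : ∃ a : ℕ, a * (4 * τ) ≤ R ∧ (R : ℝ) / 2 ≤ a * (4 * τ) := by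
    refine ⟨⌊(R : ℝ) / (4 * τ)⌋₊, ?_, ?_⟩
    · rw [← le_div_iff₀ (by positivity)]
      exact Nat.floor_le (by positivity)
    · have h_floor := (Nat.lt_floor_add_one ((R : ℝ) / (4 * τ))).le
      rw [div_le_iff₀ (by positivity)] at h_floor
      linarith
  have ha_half : a ≤ R / 2 := by
    have : (2 * a : ℝ) ≤ R := by nlinarith [(Nat.cast_nonneg a : (0 : ℝ) ≤ a)]
    have : 2 * a ≤ R := by exact_mod_cast this
    lia
  have h_abs : (a : ZMod R).valMinAbs.natAbs = a := by
    rw [valMinAbs_natCast_of_le_half ha_half, Int.natAbs_natCast]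
  have h_lower := le_norm_one_sub_stdAddChar (a : ZMod R)
  have h_upper := norm_one_sub_stdAddChar_le (a : ZMod R)
  rw [h_abs] at h_lower h_upper
  refine ⟨a, ?_, ?_⟩
  · calc (1 / 2 : ℝ) ≤ a * (4 * τ) / R := by rw [le_div_iff₀ hR_pos]; linarith
      _ = 4 * a / R * τ := by ring
      _ ≤ _ := by gcongr
  · calc ‖1 - stdAddChar (a : ZMod R)‖ * τ ≤ 2 * Real.pi * a / R * τ := by gcongr
      _ = Real.pi / 2 * (a * (4 * τ)) / R := by ring
      _ ≤ Real.pi / 2 := by rw [div_le_iff₀ hR_pos]; gcongr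

end Chord

section InverseFourier

open ZMod

variable {R : ℕ} [NeZero R] (g : ZMod R → ℂ)

lemma sum_norm_sq_invDFT : ∑ n, ‖𝓕⁻ g n‖ ^ 2 = (R : ℝ)⁻¹ * ∑ l, ‖g l‖ ^ 2 := by
  have hR : (R : ℂ) ≠ 0 := NeZero.ne _
  have h_orthogonal (l k : ZMod R) :
      ∑ n, stdAddChar (l * n) * star (stdAddChar (k * n)) = if k = l then (R : ℂ) else 0 := by
    simp only [Complex.star_def, ← AddChar.map_neg_eq_conj, ← AddChar.map_add_eq_mul]
    simpa [← sub_eq_add_neg, ← sub_mul, mul_comm, sub_eq_zero, eq_comm] using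
      AddChar.sum_mulShift (l - k) (isPrimitive_stdAddChar R)
  have h_complex : ∑ n, 𝓕⁻ g n * star (𝓕⁻ g n) = (R : ℂ)⁻¹ * ∑ l, g l * star (g l) := by
    calc ∑ n, 𝓕⁻ g n * star (𝓕⁻ g n)
        = ∑ n, ∑ l, ∑ k, (R : ℂ)⁻¹ * (R : ℂ)⁻¹ * (g l * star (g k)) *
            (stdAddChar (l * n) * star (stdAddChar (k * n))) := by
          refine Finset.sum_congr rfl fun n _ => ?_
          simp only [invDFT_apply, smul_eq_mul, star_mul', star_sum, Complex.star_def, map_inv₀,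
            map_natCast]
          rw [mul_mul_mul_comm, Finset.sum_mul_sum, Finset.mul_sum]
          refine Finset.sum_congr rfl fun l _ => ?_
          rw [Finset.mul_sum]
          exact Finset.sum_congr rfl fun k _ => by ring
      _ = ∑ l, ∑ k, (R : ℂ)⁻¹ * (R : ℂ)⁻¹ * (g l * star (g k)) *
            ∑ n, stdAddChar (l * n) * star (stdAddChar (k * n)) := by
          simp only [Finset.mul_sum]
          rw [Finset.sum_comm]
          exact Finset.sum_congr rfl fun l _ => Finset.sum_comm
      _ = _ := by
          simp only [h_orthogonal, mul_ite, mul_zero, Finset.sum_ite_eq', Finset.mem_univ, if_true,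
            Finset.mul_sum]
          exact Finset.sum_congr rfl fun l _ => by field_simp
  simp only [Complex.star_def, Complex.mul_conj, Complex.normSq_eq_norm_sq] at h_complex
  rw [← Complex.ofReal_inj]
  simpa using h_complex

lemma invDFT_comp_add_right (a n : ZMod R) :
    𝓕⁻ (fun l => g (l + a)) n = stdAddChar (-(a * n)) * 𝓕⁻ g n := by
  simp only [invDFT_apply, smul_eq_mul]
  rw [mul_left_comm]
  congr 1
  rw [Finset.mul_sum]
  refine Fintype.sum_equiv (Equiv.addRight a) _ _ fun l => ?_
  rw [Equiv.coe_addRight, ← mul_assoc, ← AddChar.map_add_eq_mul]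
  ring_nf

lemma sum_norm_sq_invDFT_mul_norm_sq_one_sub_stdAddChar (a : ZMod R) :
    ∑ n, ‖𝓕⁻ g n‖ ^ 2 * ‖1 - stdAddChar (a * n)‖ ^ 2 =
      (R : ℝ)⁻¹ * ∑ l, ‖g (l + a) - g l‖ ^ 2 := by
  rw [← sum_norm_sq_invDFT fun l => g (l + a) - g l]
  refine Finset.sum_congr rfl fun n _ => ?_
  have h_sub : 𝓕⁻ (fun l => g (l + a) - g l) n = (stdAddChar (-(a * n)) - 1) * 𝓕⁻ g n := by
    rw [sub_mul, one_mul, ← invDFT_comp_add_right]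
    exact congrFun (map_sub 𝓕⁻ (fun l => g (l + a)) g) n
  rw [h_sub, norm_mul, mul_pow, mul_comm, ← Complex.norm_conj (1 - _), map_sub, map_one,
    ← AddChar.map_neg_eq_conj, norm_sub_rev]

end InverseFourier

section Ring

open ZMod

variable {R : ℕ} [NeZero R]

/-- The energy of momentum `l` for hopping on the cycle `ZMod R`, that is, the eigenvalue
`2 cos (2πl/R)` of the adjacency matrix of the cycle on the character `n ↦ stdAddChar (l * n)`. -/
noncomputable def dispersion (l : ZMod R) : ℝ := 2 * (stdAddChar l).re

lemma dispersion_neg (l : ZMod R) : dispersion (-l) = dispersion l := by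
  simp [dispersion, AddChar.map_neg_eq_conj]

lemma ofReal_dispersion (l : ZMod R) :
    ((dispersion l : ℝ) : ℂ) = stdAddChar l + stdAddChar (-l) := by
  rw [AddChar.map_neg_eq_conj, Complex.add_conj]
  simp [dispersion]

lemma dispersion_sub_dispersion_add (l a : ZMod R) :
    dispersion l - dispersion (l + a) = 2 * ((1 - stdAddChar a) * stdAddChar l).re := by
  rw [dispersion, dispersion, AddChar.map_add_eq_mul, sub_mul, one_mul, Complex.sub_re,
    mul_comm (stdAddChar l)]
  ring

lemma abs_dispersion_sub_dispersion_add_le (l a : ZMod R) :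
    |dispersion l - dispersion (l + a)| ≤ 2 * ‖1 - stdAddChar a‖ := by
  rw [dispersion_sub_dispersion_add, abs_mul, abs_two]
  refine mul_le_mul_of_nonneg_left ((Complex.abs_re_le_norm _).trans ?_) zero_le_two
  rw [norm_mul, AddChar.norm_apply, mul_one]

lemma sum_dispersion_sub_dispersion_add_sq (hR : 2 < R) (a : ZMod R) :
    ∑ l : ZMod R, (dispersion l - dispersion (l + a)) ^ 2 = R * (2 * ‖1 - stdAddChar a‖ ^ 2) := by
  have h_sq (l : ZMod R) : (dispersion l - dispersion (l + a)) ^ 2 =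
      2 * ‖1 - stdAddChar a‖ ^ 2 + 2 * ((1 - stdAddChar a) ^ 2 * stdAddChar (l * 2)).re := by
    have h_norm : ‖1 - stdAddChar a‖ ^ 2 = ‖(1 - stdAddChar a) * stdAddChar l‖ ^ 2 := by
      rw [norm_mul, AddChar.norm_apply, mul_one]
    rw [dispersion_sub_dispersion_add, h_norm, mul_two, AddChar.map_add_eq_mul, ← sq, ← mul_pow,
      ← Complex.normSq_eq_norm_sq, Complex.normSq_apply, sq ((1 - stdAddChar a) * _),
      Complex.mul_re ((1 - stdAddChar a) * _)]
    ring
  have h_two : (2 : ZMod R) ≠ 0 := fun h => by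
    have h_dvd := (natCast_eq_zero_iff 2 R).1 (by exact_mod_cast h)
    exact hR.not_ge (Nat.le_of_dvd two_pos h_dvd)
  have h_osc : ∑ l : ZMod R, 2 * ((1 - stdAddChar a) ^ 2 * stdAddChar (l * 2)).re = 0 := by
    rw [← Finset.mul_sum, ← Complex.re_sum, ← Finset.mul_sum,
      AddChar.sum_mulShift _ (isPrimitive_stdAddChar R), if_neg h_two]
    simp
  simp only [h_sq]
  rw [Finset.sum_add_distrib, h_osc]
  simp

/-- The amplitude for hopping by `n` on the cycle `ZMod R` within time `τ`. -/
noncomputable def propagator (τ : ℝ) : ZMod R → ℂ :=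
  𝓕⁻ fun l => Complex.exp (-(Complex.I * τ) * dispersion l)

lemma propagator_neg (τ : ℝ) (n : ZMod R) : propagator τ (-n) = propagator τ n := by
  simp only [propagator, invDFT_apply]
  congr 1
  refine Fintype.sum_equiv (Equiv.neg _) _ _ fun l => ?_
  simp [dispersion_neg]

lemma sum_norm_sq_propagator_mul_norm_sq_one_sub_stdAddChar (τ : ℝ) (a : ZMod R) :
    ∑ n, ‖propagator τ n‖ ^ 2 * ‖1 - stdAddChar (a * n)‖ ^ 2 =
      (R : ℝ)⁻¹ * ∑ l : ZMod R,
        ‖Complex.exp (Complex.I * (τ * (dispersion l - dispersion (l + a)) : ℝ)) - 1‖ ^ 2 := by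
  rw [propagator, sum_norm_sq_invDFT_mul_norm_sq_one_sub_stdAddChar]
  congr 1
  refine Finset.sum_congr rfl fun l _ => ?_
  set u := Complex.exp (-(Complex.I * τ) * dispersion l)
  have h_unit : ‖u‖ = 1 := by simp [u, Complex.norm_exp]
  have h_exp : Complex.exp (-(Complex.I * τ) * dispersion (l + a)) =
      u * Complex.exp (Complex.I * (τ * (dispersion l - dispersion (l + a)) : ℝ)) := by
    rw [← Complex.exp_add]
    push_cast
    ring_nf
  rw [h_exp, ← mul_sub_one, norm_mul, h_unit, one_mul]

lemma sum_norm_sq_propagator_mul_norm_sq_one_sub_stdAddChar_le (hR : 2 < R) (τ : ℝ) (a : ZMod R) :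
    ∑ n, ‖propagator τ n‖ ^ 2 * ‖1 - stdAddChar (a * n)‖ ^ 2 ≤
      2 * τ ^ 2 * ‖1 - stdAddChar a‖ ^ 2 := by
  have hR_ne : (R : ℝ) ≠ 0 := NeZero.ne _
  calc ∑ n, ‖propagator τ n‖ ^ 2 * ‖1 - stdAddChar (a * n)‖ ^ 2
      ≤ (R : ℝ)⁻¹ * ∑ l : ZMod R, τ ^ 2 * (dispersion l - dispersion (l + a)) ^ 2 := by
        rw [sum_norm_sq_propagator_mul_norm_sq_one_sub_stdAddChar]
        gcongr with l
        rw [← mul_pow, ← sq_abs (τ * _), ← Real.norm_eq_abs]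
        gcongr
        exact Real.norm_exp_I_mul_ofReal_sub_one_le
    _ = 2 * τ ^ 2 * ‖1 - stdAddChar a‖ ^ 2 := by
        rw [← Finset.mul_sum, sum_dispersion_sub_dispersion_add_sq hR]
        field_simp

lemma le_sum_norm_sq_propagator_mul_norm_sq_one_sub_stdAddChar (hR : 2 < R) {τ : ℝ} (hτ : 0 ≤ τ)
    {a : ZMod R} (ha : ‖1 - stdAddChar a‖ * τ ≤ Real.pi / 2) :
    8 / Real.pi ^ 2 * (‖1 - stdAddChar a‖ * τ) ^ 2 ≤
      ∑ n, ‖propagator τ n‖ ^ 2 * ‖1 - stdAddChar (a * n)‖ ^ 2 := by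
  have hR_ne : (R : ℝ) ≠ 0 := NeZero.ne _
  have h_small (l : ZMod R) : |τ * (dispersion l - dispersion (l + a))| ≤ Real.pi := by
    rw [abs_mul, abs_of_nonneg hτ]
    have := mul_le_mul_of_nonneg_left (abs_dispersion_sub_dispersion_add_le l a) hτ
    linarith
  calc 8 / Real.pi ^ 2 * (‖1 - stdAddChar a‖ * τ) ^ 2
      = (R : ℝ)⁻¹ * ∑ l : ZMod R,
          (2 / Real.pi) ^ 2 * τ ^ 2 * (dispersion l - dispersion (l + a)) ^ 2 := by
        rw [← Finset.mul_sum, sum_dispersion_sub_dispersion_add_sq hR]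
        field_simp
        ring
    _ ≤ _ := by
        rw [sum_norm_sq_propagator_mul_norm_sq_one_sub_stdAddChar]
        gcongr with l
        rw [← mul_pow, ← mul_pow, mul_assoc, ← sq_abs, abs_mul,
          abs_of_pos (div_pos two_pos Real.pi_pos)]
        gcongr
        exact mul_abs_le_norm_exp_I_mul_sub_one (h_small l)

lemma sum_norm_sq_propagator_tail_le (hR : 2 < R) (τ : ℝ) {m : ℕ} (hm : 0 < m) :
    ∑ n : ZMod R with m ≤ n.valMinAbs.natAbs, ‖propagator τ n‖ ^ 2 ≤ 5 * τ ^ 2 / m ^ 2 := by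
  have : (0 : ℝ) < R := by exact_mod_cast NeZero.pos R
  have h_one : ‖1 - stdAddChar (1 : ZMod R)‖ ≤ 2 * Real.pi / R := by
    have h_abs : (1 : ZMod R).valMinAbs.natAbs = 1 := by
      rw [← Nat.cast_one, valMinAbs_natCast_of_le_half (by lia), Int.natAbs_natCast]
    simpa [h_abs] using norm_one_sub_stdAddChar_le (1 : ZMod R)
  have h_chebyshev : (4 * m / R : ℝ) ^ 2 *
      ∑ n : ZMod R with m ≤ n.valMinAbs.natAbs, ‖propagator τ n‖ ^ 2 ≤
        2 * τ ^ 2 * (2 * Real.pi / R) ^ 2 := by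
    calc (4 * m / R : ℝ) ^ 2 * ∑ n : ZMod R with m ≤ n.valMinAbs.natAbs, ‖propagator τ n‖ ^ 2
        ≤ ∑ n : ZMod R with m ≤ n.valMinAbs.natAbs,
            ‖propagator τ n‖ ^ 2 * ‖1 - stdAddChar (1 * n)‖ ^ 2 := by
          rw [Finset.mul_sum]
          refine Finset.sum_le_sum fun n hn => ?_
          rw [mul_comm, one_mul]
          gcongr
          refine le_trans ?_ (le_norm_one_sub_stdAddChar n)
          gcongr
          exact (Finset.mem_filter.1 hn).2
      _ ≤ ∑ n, ‖propagator τ n‖ ^ 2 * ‖1 - stdAddChar (1 * n)‖ ^ 2 :=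
          Finset.sum_le_univ_sum_of_nonneg fun n => by positivity
      _ ≤ 2 * τ ^ 2 * ‖1 - stdAddChar (1 : ZMod R)‖ ^ 2 :=
          sum_norm_sq_propagator_mul_norm_sq_one_sub_stdAddChar_le hR τ 1
      _ ≤ _ := by gcongr
  have h_pi : Real.pi ^ 2 ≤ 10 := by nlinarith [Real.pi_lt_d2, Real.pi_pos]
  rw [div_pow, div_pow, div_mul_eq_mul_div, ← mul_div_assoc,
    div_le_div_iff_of_pos_right (by positivity)] at h_chebyshev
  rw [le_div_iff₀ (by positivity)]
  nlinarith [mul_le_mul_of_nonneg_left h_pi (sq_nonneg τ)]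

lemma sum_norm_sq_propagator_mul_norm_sq_one_sub_stdAddChar_le_add (τ : ℝ) (a : ZMod R) (m : ℕ) :
    ∑ n, ‖propagator τ n‖ ^ 2 * ‖1 - stdAddChar (a * n)‖ ^ 2 ≤
      2 * ‖1 - stdAddChar a‖ * (∑ n : ZMod R with n.valMinAbs.natAbs < m,
        (n.valMinAbs.natAbs : ℝ) * ‖propagator τ n‖ ^ 2) +
      4 * ∑ n : ZMod R with m ≤ n.valMinAbs.natAbs, ‖propagator τ n‖ ^ 2 := by
  rw [← Finset.sum_filter_add_sum_filter_not _ fun n : ZMod R => n.valMinAbs.natAbs < m]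
  simp only [not_lt, Finset.mul_sum]
  have h_two (n : ZMod R) : ‖1 - stdAddChar (a * n)‖ ≤ 2 := norm_one_sub_stdAddChar_le_two _
  refine add_le_add (Finset.sum_le_sum fun n _ => ?_) (Finset.sum_le_sum fun n _ => ?_)
  · calc ‖propagator τ n‖ ^ 2 * ‖1 - stdAddChar (a * n)‖ ^ 2
        ≤ ‖propagator τ n‖ ^ 2 * (2 * (n.valMinAbs.natAbs * ‖1 - stdAddChar a‖)) := by
          rw [sq ‖1 - _‖]
          gcongr
          exacts [h_two n, norm_one_sub_stdAddChar_mul_le a n]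
      _ = _ := by ring
  · calc ‖propagator τ n‖ ^ 2 * ‖1 - stdAddChar (a * n)‖ ^ 2
        ≤ ‖propagator τ n‖ ^ 2 * 2 ^ 2 := by
          gcongr
          exact h_two n
      _ = _ := by ring

/-- Ballistic spreading: at a momentum `a` of order `R / τ`, the second moment of the chord length
`‖1 - χ (a * n)‖` is of order one, while the chord length is at most `|n| ‖1 - χ a‖`, of order
`|n| / τ`. -/
lemma le_sum_natAbs_mul_norm_sq_propagator {τ : ℝ} {m : ℕ} (hτ : 1 / 2 ≤ τ)
    (hm : 1000 * τ ≤ m) (hmR : 2 * m ≤ R) :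
    τ / 10 ≤ ∑ n : ZMod R with n.valMinAbs.natAbs < m,
      (n.valMinAbs.natAbs : ℝ) * ‖propagator τ n‖ ^ 2 := by
  have hm_pos : (0 : ℝ) < m := by linarith
  have hmR_real : 2 * (m : ℝ) ≤ R := by exact_mod_cast hmR
  have hR : 2 < R := by exact_mod_cast (by linarith : (2 : ℝ) < R)
  obtain ⟨a, ha_lower, ha_upper⟩ :=
    exists_norm_one_sub_stdAddChar_mul_mem_Icc (R := R) hτ (by linarith)
  have h_moment := (le_sum_norm_sq_propagator_mul_norm_sq_one_sub_stdAddChar hR (by linarith)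
    ha_upper).trans (sum_norm_sq_propagator_mul_norm_sq_one_sub_stdAddChar_le_add τ a m)
  have h_tail := sum_norm_sq_propagator_tail_le hR τ (m := m) (by exact_mod_cast hm_pos)
  have h_tail_const : 5 * τ ^ 2 / m ^ 2 ≤ 1 / 100000 := by
    rw [div_le_iff₀ (by positivity)]
    have := pow_le_pow_left₀ (by positivity) hm 2
    nlinarith
  have h_pi : 4 / 5 ≤ 8 / Real.pi ^ 2 := by
    rw [le_div_iff₀ (by positivity)]
    nlinarith [Real.pi_lt_d2, Real.pi_pos]
  set w := ‖1 - stdAddChar a‖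
  have hw : 0 ≤ w := norm_nonneg _
  have h_main := (mul_le_mul_of_nonneg_right h_pi (sq_nonneg (w * τ))).trans h_moment
  by_contra! h_small
  have := mul_le_mul_of_nonneg_left h_small.le hw
  nlinarith

end Ring

section SineWave

open ZMod

variable {R : ℕ} [NeZero R]

/-- The sine wave of momentum `l` on the cycle `ZMod R`, up to the factor `2i`. -/
noncomputable def sineWave (l n : ZMod R) : ℂ := stdAddChar (l * n) - stdAddChar (-(l * n))

lemma sineWave_eq_zero_of_neg_eq_self (l : ZMod R) {n : ZMod R} (hn : -n = n) :
    sineWave l n = 0 := by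
  rw [sineWave, ← mul_neg, hn, sub_self]

lemma sineWave_add_one_add_sineWave_sub_one (l n : ZMod R) :
    sineWave l (n + 1) + sineWave l (n - 1) = dispersion l * sineWave l n := by
  simp only [sineWave, ofReal_dispersion, mul_add, add_mul, mul_one, mul_neg, neg_add, neg_neg,
    AddChar.map_add_eq_mul, sub_eq_add_neg]
  ring

lemma propagator_zero (n : ZMod R) : propagator 0 n = if n = 0 then 1 else 0 := by
  simp only [propagator, invDFT_apply, Complex.ofReal_zero, mul_zero, neg_zero, zero_mul,
    Complex.exp_zero, smul_eq_mul, mul_one]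
  rw [AddChar.sum_mulShift n (isPrimitive_stdAddChar R), Nat.cast_ite]
  simp

lemma sum_exp_dispersion_mul_sineWave (τ : ℝ) (x y : ZMod R) :
    (R : ℂ)⁻¹ * ∑ l : ZMod R, stdAddChar (-(l * y)) *
      (Complex.exp (-(Complex.I * τ) * dispersion l) * sineWave l x) =
      propagator τ (x - y) - propagator τ (x + y) := by
  rw [← propagator_neg τ (x + y)]
  simp only [propagator, invDFT_apply, smul_eq_mul]
  rw [← mul_sub, ← Finset.sum_sub_distrib]
  congr 1
  refine Finset.sum_congr rfl fun l _ => ?_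
  simp only [sineWave, sub_eq_add_neg, neg_add, mul_add, mul_neg, AddChar.map_add_eq_mul]
  ring

end SineWave

section Chain

open ZMod

variable {N : ℕ}

/-- Site `x` of the open chain `{1, …, N}`, seen on the cycle of length `2 (N + 1)`; the chain
occupies `1, …, N`, and its mirror image `-1, …, -N`. -/
def toCycle (x : Fin N) : ZMod (2 * (N + 1)) := ((x.val + 1 : ℕ) : ZMod _)

lemma toCycle_sub_eq_zero_iff {x y : Fin N} : toCycle x - toCycle y = 0 ↔ x = y := by
  rw [sub_eq_zero, toCycle, toCycle, natCast_eq_natCast_iff', Nat.mod_eq_of_lt (by lia),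
    Nat.mod_eq_of_lt (by lia), Fin.ext_iff]
  lia

lemma toCycle_add_ne_zero (x y : Fin N) : toCycle x + toCycle y ≠ 0 := by
  rw [toCycle, toCycle, ← Nat.cast_add, Ne, natCast_eq_zero_iff]
  intro h
  have := Nat.le_of_dvd (by lia) h
  lia

lemma sum_ite_val_add_one_eq {F : ℕ → ℂ} (h_zero : F 0 = 0) (h_last : F (N + 1) = 0) {j : ℕ}
    (hj : j ≤ N + 1) : ∑ y : Fin N, (if y.val + 1 = j then F (y.val + 1) else 0) = F j := by
  by_cases h_mem : 0 < j ∧ j < N + 1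
  · rw [Finset.sum_eq_single ⟨j - 1, by lia⟩ (fun y _ hy => if_neg fun h => hy (by ext; simp; lia))
      (by simp), if_pos (by simp; lia)]
    congr 1
    simp
    lia
  · obtain rfl | rfl : j = 0 ∨ j = N + 1 := by lia
    · simp [h_zero]
    · rw [h_last]
      exact Finset.sum_eq_zero fun y _ => if_neg (by lia)

variable [DecidableRel (SimpleGraph.pathGraph N).Adj]

lemma adjMatrix_pathGraph_mulVec {F : ℕ → ℂ} (h_zero : F 0 = 0) (h_last : F (N + 1) = 0)
    (x : Fin N) : ((SimpleGraph.pathGraph N).adjMatrix ℂ *ᵥ fun y => F (y.val + 1)) x =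
      F (x.val + 2) + F x.val := by
  rw [← sum_ite_val_add_one_eq h_zero h_last (by lia : x.val + 2 ≤ N + 1),
    ← sum_ite_val_add_one_eq h_zero h_last (by lia : x.val ≤ N + 1), ← Finset.sum_add_distrib]
  simp only [mulVec, dotProduct]
  refine Finset.sum_congr rfl fun y _ => ?_
  simp only [SimpleGraph.adjMatrix_apply, SimpleGraph.pathGraph_adj]
  split_ifs <;> first | lia | simp

lemma adjMatrix_pathGraph_mulVec_sineWave (l : ZMod (2 * (N + 1))) :
    (SimpleGraph.pathGraph N).adjMatrix ℂ *ᵥ (fun x => sineWave l (toCycle x)) =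
      (dispersion l : ℂ) • fun x => sineWave l (toCycle x) := by
  have h_last : -((N + 1 : ℕ) : ZMod (2 * (N + 1))) = (N + 1 : ℕ) := by
    rw [neg_eq_iff_add_eq_zero, ← Nat.cast_add, ← two_mul, natCast_self]
  funext x
  have h_adj := adjMatrix_pathGraph_mulVec (F := fun n => sineWave l (n : ZMod (2 * (N + 1))))
    (sineWave_eq_zero_of_neg_eq_self l (by simp)) (sineWave_eq_zero_of_neg_eq_self l h_last) x
  refine h_adj.trans ?_
  rw [Pi.smul_apply, smul_eq_mul, ← sineWave_add_one_add_sineWave_sub_one]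
  congr 2 <;> simp [toCycle, add_assoc, one_add_one_eq_two]

/-- Method of images: the amplitude on the open chain is that on the cycle minus the one coming from
the mirror image of the source. -/
lemma unitaryEvolution_adjMatrix_pathGraph_apply (τ : ℝ) (x y : Fin N) :
    unitaryEvolution ((SimpleGraph.pathGraph N).adjMatrix ℂ) τ x y =
      propagator τ (toCycle x - toCycle y) - propagator τ (toCycle x + toCycle y) := by
  set c : ℂ := ((2 * (N + 1) : ℕ) : ℂ)⁻¹
  have h_single : Pi.single y 1 = c • ∑ l : ZMod (2 * (N + 1)),
      (stdAddChar (-(l * toCycle y)) : ℂ) • fun x => sineWave l (toCycle x) := by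
    funext x
    have h_zero := sum_exp_dispersion_mul_sineWave 0 (toCycle x) (toCycle y)
    simp only [propagator_zero, toCycle_sub_eq_zero_iff, toCycle_add_ne_zero] at h_zero
    simpa [c, Finset.sum_apply, Pi.single_apply] using h_zero.symm
  calc unitaryEvolution ((SimpleGraph.pathGraph N).adjMatrix ℂ) τ x y
      = (unitaryEvolution ((SimpleGraph.pathGraph N).adjMatrix ℂ) τ *ᵥ Pi.single y 1) x := by
        rw [mulVec_single_one, col_apply]
    _ = c * ∑ l : ZMod (2 * (N + 1)), stdAddChar (-(l * toCycle y)) *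
          (Complex.exp (-(Complex.I * τ) * dispersion l) * sineWave l (toCycle x)) := by
        simp only [h_single, mulVec_smul, mulVec_sum, unitaryEvolution_mulVec_of_mulVec_eq_smul
          (adjMatrix_pathGraph_mulVec_sineWave _), Pi.smul_apply, Finset.sum_apply, smul_eq_mul]
    _ = _ := sum_exp_dispersion_mul_sineWave τ (toCycle x) (toCycle y)

end Chain

section Block

open ZMod

lemma propagator_natAbs_valMinAbs {R : ℕ} [NeZero R] (τ : ℝ) (n : ZMod R) :
    propagator τ (n.valMinAbs.natAbs : ZMod R) = propagator τ n := by
  rcases eq_natAbs_valMinAbs_or_eq_neg n with h | h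
  · rw [← h]
  · rw [← propagator_neg, ← h]

lemma sum_natAbs_mul_norm_sq_propagator_le {R : ℕ} [NeZero R] (τ : ℝ) (m : ℕ) :
    ∑ n : ZMod R with n.valMinAbs.natAbs < m,
      (n.valMinAbs.natAbs : ℝ) * ‖propagator τ n‖ ^ 2 ≤
    2 * ∑ j ∈ Finset.range m, (j : ℝ) * ‖propagator τ (j : ZMod R)‖ ^ 2 := by
  rw [← Finset.sum_fiberwise_of_maps_to (t := Finset.range m)
    (g := fun n : ZMod R => n.valMinAbs.natAbs) (fun n hn => by simpa using hn), Finset.mul_sum]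
  refine Finset.sum_le_sum fun j _ => ?_
  have h_subset : ({n ∈ ({n | n.valMinAbs.natAbs < m} : Finset (ZMod R)) |
      n.valMinAbs.natAbs = j} : Finset _) ⊆ {(j : ZMod R), -(j : ZMod R)} := fun n hn => by
    rw [Finset.mem_insert, Finset.mem_singleton, ← (Finset.mem_filter.1 hn).2]
    exact eq_natAbs_valMinAbs_or_eq_neg n
  have h_card := (Finset.card_le_card h_subset).trans Finset.card_le_two
  rw [Finset.sum_congr rfl (g := fun _ => (j : ℝ) * ‖propagator τ (j : ZMod R)‖ ^ 2) fun n hn => by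
    rw [← (Finset.mem_filter.1 hn).2, propagator_natAbs_valMinAbs], Finset.sum_const, nsmul_eq_mul]
  gcongr
  exact_mod_cast h_card

variable {N s m : ℕ}

lemma mem_block {x : Fin N} : x ∈ block N s ↔ x.val < s := by
  simp [block]

lemma mem_block_compl {x : Fin N} : x ∈ (block N s)ᶜ ↔ s ≤ x.val := by
  rw [Finset.mem_compl, mem_block, not_lt]

lemma card_block (hs : s ≤ N) : (block N s).card = s := by
  rw [block, Fin.card_filter_val_lt, min_eq_right hs]

lemma le_card_block_pairs {j : ℕ} (hjs : j ≤ s) (hjN : s + j ≤ N) :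
    j ≤ (((block N s) ×ˢ (block N s)ᶜ).filter fun p => p.2.val - p.1.val = j).card := by
  conv_lhs => rw [← Fintype.card_fin j]
  refine Finset.card_le_card_of_injOn (fun i : Fin j =>
    ((⟨s - 1 - i, by lia⟩ : Fin N), (⟨s - 1 - i + j, by lia⟩ : Fin N))) (fun i _ => ?_)
    fun i _ i' _ h => ?_
  · simp only [Finset.coe_filter, Finset.mem_product, mem_block, mem_block_compl,
      Set.mem_ofPred_eq]
    lia
  · simp only [Prod.mk.injEq, Fin.mk.injEq] at h
    lia

lemma sum_range_mul_le_sum_block_toCycle_sub (hms : m ≤ s) (hmN : s + m ≤ N)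
    {f : ZMod (2 * (N + 1)) → ℝ} (hf : ∀ n, 0 ≤ f n) (hf_neg : ∀ n, f (-n) = f n) :
    ∑ j ∈ Finset.range m, (j : ℝ) * f j ≤
      ∑ x ∈ block N s, ∑ z ∈ (block N s)ᶜ, f (toCycle x - toCycle z) := by
  have h_dist {j : ℕ} {p : Fin N × Fin N} (hp : p ∈ ((block N s) ×ˢ (block N s)ᶜ).filter
      fun p => p.2.val - p.1.val = j) : f (toCycle p.1 - toCycle p.2) = f j := by
    simp only [Finset.mem_filter, Finset.mem_product, mem_block, mem_block_compl] at hp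
    obtain ⟨⟨hx, hz⟩, rfl⟩ := hp
    rw [← hf_neg, neg_sub, toCycle, toCycle, ← Nat.cast_sub (by lia)]
    congr 2
    lia
  rw [← Finset.sum_product']
  calc ∑ j ∈ Finset.range m, (j : ℝ) * f j
      ≤ ∑ j ∈ Finset.range m, ∑ p ∈ (block N s) ×ˢ (block N s)ᶜ with p.2.val - p.1.val = j,
          f (toCycle p.1 - toCycle p.2) := by
        refine Finset.sum_le_sum fun j hj => ?_
        have hjm := Finset.mem_range.1 hj
        rw [Finset.sum_congr rfl fun p => h_dist, Finset.sum_const, nsmul_eq_mul]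
        exact mul_le_mul_of_nonneg_right
          (by exact_mod_cast le_card_block_pairs (by lia) (by lia)) (hf _)
    _ ≤ _ := Finset.sum_fiberwise_le_sum_of_sum_fiber_nonneg fun _ _ =>
        Finset.sum_nonneg fun _ _ => hf _

lemma sum_sum_le_card_mul_sum {α β γ : Type*} {A : Finset α} {B : Finset β}
    {T : Finset γ} {f : γ → ℝ} (hf : ∀ c, 0 ≤ f c) {φ : α → β → γ}
    (h_inj : ∀ a ∈ A, Set.InjOn (φ a) B) (h_mem : ∀ a ∈ A, ∀ b ∈ B, φ a b ∈ T) :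
    ∑ a ∈ A, ∑ b ∈ B, f (φ a b) ≤ A.card * ∑ c ∈ T, f c := by
  classical
  rw [← nsmul_eq_mul]
  refine Finset.sum_le_card_nsmul _ _ _ fun a ha => ?_
  rw [← Finset.sum_image (h_inj a ha)]
  exact Finset.sum_le_sum_of_subset_of_nonneg (Finset.image_subset_iff.2 (h_mem a ha))
    fun c _ _ => hf c

lemma toCycle_injective : Function.Injective (toCycle (N := N)) := fun _ _ h =>
  toCycle_sub_eq_zero_iff.1 (sub_eq_zero.2 h)

lemma min_le_natAbs_valMinAbs_toCycle_add (hs : s ≤ N) {x z : Fin N} (hx : x ∈ block N s)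
    (hz : z ∈ (block N s)ᶜ) : min s (N - s) ≤ (toCycle x + toCycle z).valMinAbs.natAbs := by
  rw [mem_block] at hx
  rw [mem_block_compl] at hz
  rw [valMinAbs_natAbs_eq_min, toCycle, toCycle, ← Nat.cast_add, val_natCast,
    Nat.mod_eq_of_lt (by lia)]
  lia

lemma sum_block_toCycle_add_le (hs : s ≤ N) {f : ZMod (2 * (N + 1)) → ℝ} (hf : ∀ n, 0 ≤ f n) :
    ∑ x ∈ block N s, ∑ z ∈ (block N s)ᶜ, f (toCycle x + toCycle z) ≤
      (min s (N - s) : ℕ) *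
        ∑ n : ZMod (2 * (N + 1)) with min s (N - s) ≤ n.valMinAbs.natAbs, f n := by
  have h_mem : ∀ x ∈ block N s, ∀ z ∈ (block N s)ᶜ, toCycle x + toCycle z ∈
      Finset.univ.filter fun n : ZMod (2 * (N + 1)) => min s (N - s) ≤ n.valMinAbs.natAbs :=
    fun x hx z hz => Finset.mem_filter.2
      ⟨Finset.mem_univ _, min_le_natAbs_valMinAbs_toCycle_add hs hx hz⟩
  rcases le_total s (N - s) with h | h
  · have h_sum := sum_sum_le_card_mul_sum hf (φ := fun x z => toCycle x + toCycle z)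
      (fun x _ z _ z' _ h => toCycle_injective (add_left_cancel h)) h_mem
    simpa only [card_block hs, min_eq_left h] using h_sum
  · have h_sum := sum_sum_le_card_mul_sum hf (φ := fun z x => toCycle x + toCycle z)
      (fun z _ x _ x' _ h => toCycle_injective (add_right_cancel h))
      fun z hz x hx => h_mem x hx z hz
    rw [Finset.sum_comm]
    simpa only [Finset.card_compl, card_block hs, Fintype.card_fin, min_eq_right h] using h_sum

variable [DecidableRel (SimpleGraph.pathGraph N).Adj]

lemma norm_sq_propagator_sub_le_norm_sq_unitaryEvolution (τ : ℝ) (x z : Fin N) :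
    ‖propagator τ (toCycle x - toCycle z)‖ ^ 2 / 2 - ‖propagator τ (toCycle x + toCycle z)‖ ^ 2 ≤
      ‖unitaryEvolution ((SimpleGraph.pathGraph N).adjMatrix ℂ) τ x z‖ ^ 2 := by
  rw [unitaryEvolution_adjMatrix_pathGraph_apply]
  generalize propagator τ (toCycle x - toCycle z) = u
  generalize propagator τ (toCycle x + toCycle z) = v
  have h_triangle : ‖u‖ ≤ ‖u - v‖ + ‖v‖ := by simpa using norm_add_le (u - v) v
  nlinarith [norm_nonneg u, sq_nonneg (‖u - v‖ - ‖v‖)]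

lemma le_sum_block_norm_sq_unitaryEvolution_adjMatrix_pathGraph (hs : s ≤ N) {τ : ℝ}
    (hτ : 1 / 2 ≤ τ) (hm : 1000 * τ ≤ (min s (N - s) : ℕ)) :
    τ / 200 ≤ ∑ x ∈ block N s, ∑ z ∈ (block N s)ᶜ,
      ‖unitaryEvolution ((SimpleGraph.pathGraph N).adjMatrix ℂ) τ x z‖ ^ 2 := by
  have h_image_sum := sum_block_toCycle_add_le hs fun n => sq_nonneg ‖propagator τ n‖
  have h_source_sum := sum_range_mul_le_sum_block_toCycle_sub (N := N) (min_le_left s (N - s))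
    (by lia) (fun n => sq_nonneg ‖propagator τ n‖) fun n => by rw [propagator_neg]
  set m := min s (N - s)
  have hm_pos : (0 : ℝ) < m := by linarith
  have hm_pos_nat : 0 < m := by exact_mod_cast hm_pos
  have h_spread := (le_sum_natAbs_mul_norm_sq_propagator (R := 2 * (N + 1)) hτ hm (by lia)).trans
    (sum_natAbs_mul_norm_sq_propagator_le τ m)
  have h_tail := mul_le_mul_of_nonneg_left (sum_norm_sq_propagator_tail_le (R := 2 * (N + 1))
    (by lia) τ hm_pos_nat) hm_pos.le
  have h_tail_const : (m : ℝ) * (5 * τ ^ 2 / m ^ 2) ≤ τ / 200 := by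
    rw [mul_div_assoc', div_le_iff₀ (by positivity)]
    nlinarith [mul_le_mul_of_nonneg_left hm (by positivity : 0 ≤ (m : ℝ) * τ)]
  have h_pointwise := Finset.sum_le_sum fun x (_ : x ∈ block N s) => Finset.sum_le_sum
    fun z (_ : z ∈ (block N s)ᶜ) => norm_sq_propagator_sub_le_norm_sq_unitaryEvolution τ x z
  simp only [Finset.sum_sub_distrib, ← Finset.sum_div] at h_pointwise
  linarith

end Block

section NeelState

variable {N : ℕ}

/-- The `k`-th site with even value of the open chain. -/
def evenSite (N : ℕ) (k : Fin ((N + 1) / 2)) : Fin N := ⟨2 * k.val, by omega⟩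

lemma evenSite_injective (N : ℕ) : Function.Injective (evenSite N) := fun k l h => by
  simp only [evenSite, Fin.mk.injEq] at h
  omega

lemma sum_evenSite (f : Fin N → ℂ) :
    ∑ k, f (evenSite N k) = ∑ w, (1 + (-1) ^ w.val) / 2 * f w := by
  rw [← Finset.sum_image (f := f) (evenSite_injective N).injOn]
  refine Finset.sum_subset_zero_on_sdiff (Finset.subset_univ _) (fun w hw => ?_) fun w hw => ?_
  · have h_odd : Odd w.val := Nat.not_even_iff_odd.1 fun ⟨k, hk⟩ =>
      (Finset.mem_sdiff.1 hw).2 (Finset.mem_image.2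
        ⟨⟨k, by omega⟩, Finset.mem_univ _, Fin.ext (by simp only [evenSite]; omega)⟩)
    simp [h_odd.neg_one_pow]
  · obtain ⟨k, -, rfl⟩ := Finset.mem_image.1 hw
    simp [evenSite]

/-- The Néel state: the sites of even value are occupied, those of odd value are empty. -/
noncomputable def neelState (N : ℕ) : (Fin N → Fin 2) → ℂ :=
  slater Fin.val_injective ((N + 1) / 2) fun k => Pi.single (evenSite N k) 1

lemma isProductState_neelState (N : ℕ) : IsProductState (d := fun _ => 2) (neelState N) :=
  isProductState_slater_single Fin.val_injective (evenSite_injective N)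

/-- The staggered sign `(-1)ˣ` as an operator on one-particle states. -/
def stagger (N : ℕ) : Matrix (Fin N) (Fin N) ℂ := diagonal fun x => (-1) ^ x.val

variable [DecidableRel (SimpleGraph.pathGraph N).Adj]

lemma adjMatrix_pathGraph_mul_stagger :
    (SimpleGraph.pathGraph N).adjMatrix ℂ * stagger N =
      stagger N * -(SimpleGraph.pathGraph N).adjMatrix ℂ := by
  ext x z
  rw [stagger, mul_diagonal, diagonal_mul, Matrix.neg_apply, SimpleGraph.adjMatrix_apply]
  split_ifs with h
  · rcases SimpleGraph.pathGraph_adj.1 h with h | h <;> simp [← h, pow_succ]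
  · simp

lemma unitaryEvolution_mul_stagger_mul_unitaryEvolution_neg (t : ℝ) :
    unitaryEvolution ((SimpleGraph.pathGraph N).adjMatrix ℂ) t * stagger N *
        unitaryEvolution ((SimpleGraph.pathGraph N).adjMatrix ℂ) (-t) =
      unitaryEvolution ((SimpleGraph.pathGraph N).adjMatrix ℂ) (2 * t) * stagger N := by
  rw [Matrix.mul_assoc, ← unitaryEvolution_neg,
    ← unitaryEvolution_mul_eq_of_intertwining adjMatrix_pathGraph_mul_stagger, ← Matrix.mul_assoc,
    ← unitaryEvolution_add, two_mul]

lemma isHermitian_adjMatrix_pathGraph :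
    ((SimpleGraph.pathGraph N).adjMatrix ℂ).IsHermitian := by
  ext x z
  simp [SimpleGraph.adjMatrix_apply, SimpleGraph.adj_comm, apply_ite (star : ℂ → ℂ)]

/-- The one-particle orbitals, as columns, into which free hopping takes those of the Néel state
after time `t`. -/
noncomputable def neelOrbitals (N : ℕ) [DecidableRel (SimpleGraph.pathGraph N).Adj] (t : ℝ) :
    Matrix (Fin N) (Fin ((N + 1) / 2)) ℂ :=
  (unitaryEvolution ((SimpleGraph.pathGraph N).adjMatrix ℂ) t).submatrix id (evenSite N)

lemma conjTranspose_neelOrbitals (t : ℝ) :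
    (neelOrbitals N t)ᴴ = (unitaryEvolution ((SimpleGraph.pathGraph N).adjMatrix ℂ) (-t)).submatrix
      (evenSite N) id := by
  rw [neelOrbitals, conjTranspose_submatrix,
    conjTranspose_unitaryEvolution isHermitian_adjMatrix_pathGraph]

lemma conjTranspose_neelOrbitals_mul_self (t : ℝ) :
    (neelOrbitals N t)ᴴ * neelOrbitals N t = 1 := by
  rw [conjTranspose_neelOrbitals, neelOrbitals,
    ← submatrix_mul _ _ (evenSite N) id (evenSite N) Function.bijective_id,
    unitaryEvolution_neg_mul, submatrix_one _ (evenSite_injective N)]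

/-- Particle-hole symmetry: projecting onto the even sites is `(1 + stagger) / 2`, and hopping
reverses its sign when conjugated with `stagger`. -/
lemma neelOrbitals_mul_conjTranspose (t : ℝ) :
    neelOrbitals N t * (neelOrbitals N t)ᴴ = (1 / 2 : ℂ) •
      (1 + unitaryEvolution ((SimpleGraph.pathGraph N).adjMatrix ℂ) (2 * t) * stagger N) := by
  rw [← unitaryEvolution_mul_stagger_mul_unitaryEvolution_neg,
    ← unitaryEvolution_mul_neg ((SimpleGraph.pathGraph N).adjMatrix ℂ) t,
    conjTranspose_neelOrbitals, neelOrbitals]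
  generalize unitaryEvolution ((SimpleGraph.pathGraph N).adjMatrix ℂ) t = U
  generalize unitaryEvolution ((SimpleGraph.pathGraph N).adjMatrix ℂ) (-t) = U'
  ext x z
  rw [Matrix.smul_apply, Matrix.add_apply, stagger, mul_apply, mul_apply, mul_apply, smul_eq_mul]
  simp only [submatrix_apply, id_eq, mul_diagonal]
  rw [sum_evenSite fun w => U x w * U' w z, ← Finset.sum_add_distrib, Finset.mul_sum]
  exact Finset.sum_congr rfl fun w _ => by ring

lemma norm_sq_neelOrbitals_mul_conjTranspose_apply (t : ℝ) {x z : Fin N} (h : x ≠ z) :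
    ‖(neelOrbitals N t * (neelOrbitals N t)ᴴ) x z‖ ^ 2 =
      ‖unitaryEvolution ((SimpleGraph.pathGraph N).adjMatrix ℂ) (2 * t) x z‖ ^ 2 / 4 := by
  rw [neelOrbitals_mul_conjTranspose, Matrix.smul_apply, Matrix.add_apply, one_apply_ne h, zero_add,
    stagger, mul_diagonal]
  simp only [smul_eq_mul, norm_mul, norm_pow, norm_neg, norm_one, one_pow, mul_one, norm_div,
    Complex.norm_ofNat]
  ring

/-- The XX chain, written as free fermion hopping. -/
noncomputable def hoppingHamiltonian (N : ℕ) [DecidableRel (SimpleGraph.pathGraph N).Adj] :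
    Matrix (Fin N → Fin 2) (Fin N → Fin 2) ℂ :=
  secondQuantize Fin.val ((SimpleGraph.pathGraph N).adjMatrix ℂ)

lemma isLocalHamiltonian_hoppingHamiltonian :
    IsLocalHamiltonian (d := fun _ => 2) (SimpleGraph.pathGraph N) 1 4 (hoppingHamiltonian N) :=
  isLocalHamiltonian_secondQuantize_adjMatrix Fin.val_injective fun i j h => by
    rw [SimpleGraph.pathGraph_adj] at h
    omega

lemma evolve_hoppingHamiltonian_neelState (t : ℝ) :
    evolve (d := fun _ => 2) (hoppingHamiltonian N) t (neelState N) =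
      slater Fin.val_injective ((N + 1) / 2) (neelOrbitals N t).col := by
  refine (unitaryEvolution_secondQuantize_mulVec_slater Fin.val_injective _ t _).trans ?_
  simp only [mulVec_single_one]
  rfl

lemma le_entanglementEntropy_evolve_neelState {s : ℕ} (hs : s ≤ N) {t : ℝ} (ht : 1 ≤ t)
    (hm : 2000 * t ≤ (min s (N - s) : ℕ)) :
    t / 400 ≤ entanglementEntropy (d := fun _ => 2) (block N s)
      (evolve (hoppingHamiltonian N) t (neelState N)) := by
  have h_norm : ∑ σ, ‖slater (r := Fin.val) Fin.val_injective ((N + 1) / 2)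
      (neelOrbitals N t).col σ‖ ^ 2 = 1 := by
    rw [← evolve_hoppingHamiltonian_neelState,
      sum_norm_sq_evolve isLocalHamiltonian_hoppingHamiltonian.isHermitian,
      (isProductState_neelState N).sum_norm_sq]
  have h_block : ∀ x ∈ block N s, ∀ z, z ∉ block N s → x.val < z.val := fun x hx z hz => by
    rw [mem_block] at hx hz
    omega
  have h_spread := le_sum_block_norm_sq_unitaryEvolution_adjMatrix_pathGraph hs (τ := 2 * t)
    (by linarith) (by linarith)
  calc t / 400
      ≤ (∑ x ∈ block N s, ∑ z ∈ (block N s)ᶜ,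
          ‖unitaryEvolution ((SimpleGraph.pathGraph N).adjMatrix ℂ) (2 * t) x z‖ ^ 2) / 4 := by
        linarith
    _ = ∑ x ∈ block N s, ∑ z ∈ (block N s)ᶜ,
          ‖(neelOrbitals N t * (neelOrbitals N t)ᴴ) x z‖ ^ 2 := by
        simp only [Finset.sum_div]
        refine Finset.sum_congr rfl fun x hx => Finset.sum_congr rfl fun z hz =>
          (norm_sq_neelOrbitals_mul_conjTranspose_apply t ?_).symm
        exact ne_of_mem_of_not_mem hx (Finset.mem_compl.1 hz)
    _ ≤ _ := by
        rw [evolve_hoppingHamiltonian_neelState]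
        exact sum_norm_sq_le_entanglementEntropy_slater Fin.val_injective h_block
          (conjTranspose_neelOrbitals_mul_self t) h_norm

end NeelState

end SpinLattice

open SpinLattice in
theorem mainTheorem9 :
    -- general lattices of bounded degree, local dimensions at most `q`
    (∀ (Δ q r : ℕ) (J t : ℝ), 0 < t → ∃ c₀ c₁ : ℝ, 0 < c₀ ∧ 0 < c₁ ∧
      ∀ (L : Type) [Fintype L] [DecidableEq L] (G : SimpleGraph L) [DecidableRel G.Adj],
        (∀ v, G.degree v ≤ Δ) →
      ∀ (d : L → ℕ), (∀ j, d j ≤ q) →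
      ∀ (H : Matrix (Config d) (Config d) ℂ) (ψ : Config d → ℂ),
        IsLocalHamiltonian G r J H → IsProductState ψ →
      ∀ I : Finset L,
        entanglementEntropy I (evolve H t ψ) ≤ c₀ * (boundaryArea G I : ℝ) + c₁) ∧
    -- cubic lattices of dimension `D`
    (∀ (D q r : ℕ) (J t : ℝ), 0 < t → ∃ c₀ c₁ : ℝ, 0 < c₀ ∧ 0 < c₁ ∧
      ∀ (n : ℕ) [NeZero n] (d : (Fin D → ZMod n) → ℕ), (∀ j, d j ≤ q) →
      ∀ (H : Matrix (Config d) (Config d) ℂ) (ψ : Config d → ℂ),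
        IsLocalHamiltonian (cubicLattice D n) r J H → IsProductState ψ →
      ∀ I : Finset (Fin D → ZMod n),
        entanglementEntropy I (evolve H t ψ) ≤
          c₀ * (boundaryArea (cubicLattice D n) I : ℝ) + c₁) ∧
    -- linear growth in open spin chains with nearest-neighbour interactions
    (∃ (q : ℕ) (J : ℝ)
      (H : ∀ N : ℕ, Matrix (Config (fun _ : Fin N => q)) (Config (fun _ : Fin N => q)) ℂ)
      (ψ : ∀ N : ℕ, Config (fun _ : Fin N => q) → ℂ),
      (∀ N, IsLocalHamiltonian (SimpleGraph.pathGraph N) 1 J (H N)) ∧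
      (∀ N, IsProductState (ψ N)) ∧
      ∃ (c₂ c₃ c₄ t₀ : ℝ) (L₀ s₀ : ℕ),
        0 < c₂ ∧ 0 < c₃ ∧ 0 < c₄ ∧ 0 < t₀ ∧ 0 < L₀ ∧ 0 < s₀ ∧
        ∀ (N s : ℕ), L₀ ≤ N → s₀ ≤ s → s ≤ N →
        ∀ t : ℝ, t₀ ≤ t → t ≤ c₄ * min (s : ℝ) ((N : ℝ) - (s : ℝ)) →
          c₂ * t + c₃ ≤ entanglementEntropy (block N s) (evolve (H N) t (ψ N))) := by
  classical
  have h_bounded_degree (Δ q r : ℕ) (J t : ℝ) (_ : 0 < t) :=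
    exists_entanglementEntropy_evolve_le_boundaryArea Δ q r J t
  refine ⟨h_bounded_degree, fun D q r J t ht => ?_, 2, 4, fun N => hoppingHamiltonian N, neelState,
    fun N => isLocalHamiltonian_hoppingHamiltonian, isProductState_neelState,
    1 / 800, 1 / 800, 1 / 2000, 1, 1, 1, by norm_num, by norm_num, by norm_num, one_pos, one_pos,
    one_pos, fun N s _ _ hs t ht htm => ?_⟩
  · obtain ⟨c₀, c₁, h₀, h₁, h_area⟩ := h_bounded_degree (2 * D) q r J t ht
    exact ⟨c₀, c₁, h₀, h₁, fun n _ => h_area _ (cubicLattice D n) (degree_cubicLattice_le D n)⟩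
  · have h_light_cone : 2000 * t ≤ (min s (N - s) : ℕ) := by
      rw [Nat.cast_min, Nat.cast_sub hs]
      linarith
    linarith [le_entanglementEntropy_evolve_neelState hs ht h_light_cone]
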